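/- Let $(\varepsilon_n)_{n\in\mathbb Z}$ be i.i.d. real random variables, let $G:\mathbb R^{\mathbb N}\to\mathbb R$ be measurable, and let $X_n=G(\dots,\varepsilon_{n-1},\varepsilon_n)$, $n\in\mathbb Z$ (a stationary causal process). Assume $X_n\in\mathcal L^2$ and $\mathbf E X_n=0$. Let $\mathcal F_k=\sigma(\dots,\varepsilon_{k-1},\varepsilon_k)$ and $\mathcal P_k\xi=\mathbf E(\xi\mid\mathcal F_k)-\mathbf E(\xi\mid\mathcal F_{k-1})$, let $\|\xi\|=(\mathbf E|\xi|^2)^{1/2}$, and assume $$\kappa:=\sum_{k=0}^{\infty}\|\mathcal P_0X_k\|<\infty .$$ Let $r(k)=\mathbf E(X_0X_k)$ and let $f(\theta)=\frac1{2\pi}\sum_{k\in\mathbb Z}r(k)e^{ik\theta}$ be the spectral density; assume that $f_*:=\min_{\theta\in\mathbb R}f(\theta)>0$. For $n\ge 1$ put $S_n(\theta)=\sum_{k=1}^nX_ke^{ik\theta}$, $I_n(\theta)=\frac1{2\pi n}|S_n(\theta)|^2$, $\tilde I_n(\theta)=I_n(\theta)/f(\theta)$, $\theta_j=2\pi j/n$,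 $m=m_n=\lfloor (n-1)/2\rfloor$, and $$F_{\tilde I,m}(x)=\frac1m\sum_{j=1}^m\mathbf 1_{\{\tilde I_n(\theta_j)\le x\}},\qquad F_E(x)=1-e^{-x}\quad(x\ge 0).$$ Then, as $n\to\infty$, $$\sup_{x\ge 0}\bigl|F_{\tilde I,m}(x)-F_E(x)\bigr|\to 0\quad\text{in probability.}$$ -/

import Mathlib

open MeasureTheory ProbabilityTheory Filter Topology

namespace CausalSpectral

noncomputable section

variable {Ω : Type*} [mΩ : MeasurableSpace Ω]

/-- The causal process `X_n = G(…, ε_{n-1}, ε_n)`, `n ∈ ℤ`. The past is listed backwards in time: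
`G` is evaluated at the sequence `k ↦ ε_{n-k}`, `k = 0, 1, 2, …`. -/
def causalProcess (G : (ℕ → ℝ) → ℝ) (ε : ℤ → Ω → ℝ) (n : ℤ) (ω : Ω) : ℝ :=
  G (fun k : ℕ => ε (n - k) ω)

/-- The σ-algebra `𝓕_k` generated by `…, ε_{k-1}, ε_k`. -/
@[reducible] def pastSigma (ε : ℤ → Ω → ℝ) (k : ℤ) : MeasurableSpace Ω :=
  ⨆ j : Set.Iic k, MeasurableSpace.comap (ε j) inferInstance

/-- The projection operator `𝓟_k ξ = E(ξ | 𝓕_k) - E(ξ | 𝓕_{k-1})`. -/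
def proj (P : Measure Ω) (ε : ℤ → Ω → ℝ) (k : ℤ) (ξ : Ω → ℝ) : Ω → ℝ :=
  P[ξ | pastSigma ε k] - P[ξ | pastSigma ε (k - 1)]

/-- `κ = ∑_{k ≥ 0} ‖𝓟_0 X_k‖`, with the `L²` norm, as an element of `[0, ∞]`. -/
def kappa (P : Measure Ω) (ε : ℤ → Ω → ℝ) (X : ℤ → Ω → ℝ) : ENNReal :=
  ∑' k : ℕ, eLpNorm (proj P ε 0 (X k)) 2 P

/-- The covariance function `r(k) = E(X_0 X_k)` (of a mean zero stationary process). -/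
def covariance (P : Measure Ω) (X : ℤ → Ω → ℝ) (k : ℤ) : ℝ :=
  ∫ ω, X 0 ω * X k ω ∂P

/-- The spectral density `f(θ) = (2π)⁻¹ ∑_{k ∈ ℤ} r(k) e^{ikθ}`. The sum is real because `r` is
even; the real part only serves to give `f` the type `ℝ → ℝ`. -/
def spectralDensity (P : Measure Ω) (X : ℤ → Ω → ℝ) (θ : ℝ) : ℝ :=
  1 / (2 * Real.pi) *
    (∑' k : ℤ, (covariance P X k : ℂ) * Complex.exp (Complex.I * (k : ℂ) * (θ : ℂ))).re

/-- The Fourier transform `S_n(θ) = ∑_{k=1}^n X_k e^{ikθ}`. -/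
def fourierSum (X : ℤ → Ω → ℝ) (n : ℕ) (θ : ℝ) (ω : Ω) : ℂ :=
  ∑ k ∈ Finset.Icc 1 n, (X (k : ℤ) ω : ℂ) * Complex.exp (Complex.I * (k : ℂ) * (θ : ℂ))

/-- The periodogram `I_n(θ) = (2πn)⁻¹ |S_n(θ)|²`. -/
def periodogram (X : ℤ → Ω → ℝ) (n : ℕ) (θ : ℝ) (ω : Ω) : ℝ :=
  1 / (2 * Real.pi * n) * ‖fourierSum X n θ ω‖ ^ 2

/-- The normalized periodogram `Ĩ_n(θ) = I_n(θ) / f(θ)`. -/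
def normPeriodogram (P : Measure Ω) (X : ℤ → Ω → ℝ) (n : ℕ) (θ : ℝ) (ω : Ω) : ℝ :=
  periodogram X n θ ω / spectralDensity P X θ

/-- The Fourier frequency `θ_j = 2πj/n`. -/
def fourierFreq (n j : ℕ) : ℝ := 2 * Real.pi * j / n

/-- `m = m_n = ⌊(n-1)/2⌋` (division and subtraction of natural numbers, for `n ≥ 1`). -/
def numFreq (n : ℕ) : ℕ := (n - 1) / 2

/-- The empirical distribution function `m⁻¹ ∑_{j=1}^m 1{Ĩ_n(θ_j) ≤ x}`, `m = m_n`, of the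
normalized periodogram ordinates. -/
def empiricalCDF (P : Measure Ω) (X : ℤ → Ω → ℝ) (n : ℕ) (ω : Ω) (x : ℝ) : ℝ :=
  1 / (numFreq n : ℝ) * ∑ j ∈ Finset.Icc 1 (numFreq n),
    (Set.Iic x).indicator (fun _ => (1 : ℝ)) (normPeriodogram P X n (fourierFreq n j) ω)

/-- The distribution function `F_E(x) = 1 - e^{-x}`, `x ≥ 0`, of the `Exp(1)` law. -/
def expCDF (x : ℝ) : ℝ := 1 - Real.exp (-x)

/-- `sup_{x ≥ 0} |F_{Ĩ,m}(x) - F_E(x)|`. For every outcome this is the supremum of a set of reals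
that is non-empty and bounded by `1`. -/
def supDistance (P : Measure Ω) (X : ℤ → Ω → ℝ) (n : ℕ) (ω : Ω) : ℝ :=
  ⨆ x : Set.Ici (0 : ℝ), |empiricalCDF P X n ω x - expCDF x|

end

end CausalSpectral

namespace CausalSpectral

/-! The engine is a central limit theorem for linear combinations `∑ c_k X_k` with `|c_k| ≤ C/√n`,
uniform in the coefficients (`IsIID.exists_norm_charFun_le`). Write `X_k` as the sum over `i` of its
projections `𝓟_{k-i} X_k = H_i(ε_{k-i}, ε_{k-i-1}, …)`. For a fixed lag `i` these are orthogonal in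
`k`, so their combination has norm `‖𝓟_0 X_i‖ √(∑ c_k²)`. Finiteness of `κ` then permits keeping
finitely many lags and replacing each `H_i` by a bounded function of finitely many innovations
(`IsIID.exists_finiteWindow_approx`). What remains is a sum with finite-range dependence. Stein's
method for characteristic functions (`norm_charFun_sum_sub_gaussian_le`) bounds its distance to the
Gaussian by a multiple of `n (C/√n)³`. Characteristic functions are compared without normalizing, so
no lower bound on the variance is needed.

At the Fourier frequencies, summability of the covariances and orthogonality of the exponentials
(`abs_variance_sub_le`) show that the real and imaginary parts of `S_n(θ_j)/(2πn f(θ_j))^{1/2}` at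
two distinct frequencies are asymptotically independent with variance `1/2`, uniformly over the
pairs. Averaging the characteristic function over a Gaussian argument turns this into convergence of
`E exp(-a Ĩ_n(θ_j) - b Ĩ_n(θ_l))` to `1/((1+a)(1+b))` (`IsIID.tendsto_laplace`).

Put `U_j = exp(-Ĩ_n(θ_j))`, which lies in `[0,1]` and would be uniform if `Ĩ_n(θ_j)` were exactly
exponential. Integer `a`, `b` show that the `U_j^k` have mean near `1/(k+1)` and are nearly
uncorrelated in pairs, so a second moment argument makes the empirical moments converge in
probability. Weierstrass approximation and a finite grid (`eventually_abs_tail_sub_le`) upgrade this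
to uniform convergence of the empirical tails, which is the claim after the change of variable `u =
e^{-x}`. -/

/-! ### Elementary bounds for complex exponentials. -/

lemma norm_exp_I_sub_one_sub_le (x : ℝ) :
    ‖Complex.exp (Complex.I * x) - 1 - Complex.I * x‖ ≤ 2 * x ^ 2 := by
  have h1 := Real.norm_exp_I_mul_ofReal_sub_one_le (x := x)
  have hx : ‖Complex.I * (x : ℂ)‖ = |x| := by simp
  rcases le_or_gt |x| 1 with h | h
  · have := Complex.norm_exp_sub_one_sub_id_le (x := Complex.I * x) (by rw [hx]; exact h)
    rw [hx, sq_abs] at this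
    nlinarith [sq_nonneg x]
  · have h2 : ‖Complex.exp (Complex.I * x) - 1 - Complex.I * x‖ ≤ |x| + |x| := by
      refine (norm_sub_le _ _).trans ?_
      rw [hx]
      exact add_le_add (by simpa using h1) le_rfl
    nlinarith [sq_abs x]

lemma norm_exp_I_sub_exp_I_le (x y : ℝ) :
    ‖Complex.exp (Complex.I * x) - Complex.exp (Complex.I * y)‖ ≤ |x - y| := by
  have h : Complex.exp (Complex.I * x) - Complex.exp (Complex.I * y)
      = Complex.exp (Complex.I * y) * (Complex.exp (Complex.I * ((x - y : ℝ) : ℂ)) - 1) := by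
    rw [mul_sub, ← Complex.exp_add]; push_cast; ring_nf
  rw [h, norm_mul, mul_comm Complex.I (y : ℂ), Complex.norm_exp_ofReal_mul_I, one_mul]
  simpa using Real.norm_exp_I_mul_ofReal_sub_one_le (x := x - y)

/-! ### Stein's method for sums with dependency neighbourhoods. -/

section DependencyNeighbourhoods

variable {Ω : Type*} [MeasurableSpace Ω] {P : Measure Ω} [IsProbabilityMeasure P]

lemma abs_sum_le_of_card_le {ι : Type*} {s : Finset ι} {ξ : ι → ℝ} {a D : ℝ} (ha : 0 ≤ a)
    (hD : (s.card : ℝ) ≤ D) (hξ : ∀ k ∈ s, |ξ k| ≤ a) : |∑ k ∈ s, ξ k| ≤ D * a := by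
  refine (Finset.abs_sum_le_sum_abs _ _).trans ((Finset.sum_le_card_nsmul _ _ _ hξ).trans ?_)
  rw [nsmul_eq_mul]; gcongr

/-- The local expansion behind Stein's method, for one summand `ξ` with neighbourhood sums `A`
and `B` in the total `W`. -/
lemma norm_integral_mul_exp_sub_le {W ξ A B : Ω → ℝ} (hW : Measurable W) (hξ : Measurable ξ)
    (hA : Measurable A) (hB : Measurable B) {a b : ℝ} (hξa : ∀ ω, |ξ ω| ≤ a)
    (hAb : ∀ ω, |A ω| ≤ b) (hBb : ∀ ω, |B ω| ≤ b) (hBAb : ∀ ω, |B ω - A ω| ≤ b)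
    (hmean : ∫ ω, ξ ω ∂P = 0) (h1 : IndepFun ξ (fun ω => W ω - A ω) P)
    (h2 : IndepFun (fun ω => ξ ω * A ω) (fun ω => W ω - B ω) P) (t : ℝ) :
    ‖∫ ω, (ξ ω : ℂ) * Complex.exp (Complex.I * (t * W ω : ℝ)) ∂P
      - Complex.I * t * (∫ ω, ξ ω * A ω ∂P : ℝ)
        * ∫ ω, Complex.exp (Complex.I * (t * W ω : ℝ)) ∂P‖ ≤ 4 * t ^ 2 * a * b ^ 2 := by
  have ha : 0 ≤ a := by
    obtain ⟨ω⟩ := nonempty_of_isProbabilityMeasure P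
    exact (abs_nonneg _).trans (hξa ω)
  have hb : 0 ≤ b := by
    obtain ⟨ω⟩ := nonempty_of_isProbabilityMeasure P
    exact (abs_nonneg _).trans (hAb ω)
  have hnorm : ∀ x : ℝ, ‖Complex.exp (Complex.I * x)‖ = 1 := fun x => by
    rw [mul_comm, Complex.norm_exp_ofReal_mul_I]
  have hexp : Measurable fun x : ℝ => Complex.exp (Complex.I * (t * x : ℝ)) := by fun_prop
  have int_of : ∀ {f : Ω → ℂ} (C : ℝ), Measurable f → (∀ ω, ‖f ω‖ ≤ C) → Integrable f P :=
    fun C hf hC => Integrable.of_bound hf.aestronglyMeasurable C (ae_of_all _ hC)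
  have hξA : ∀ ω, |ξ ω * A ω| ≤ a * b := fun ω => by
    rw [abs_mul]; exact mul_le_mul (hξa ω) (hAb ω) (abs_nonneg _) ha
  have hWA : Measurable fun ω => W ω - A ω := hW.sub hA
  have hWB : Measurable fun ω => W ω - B ω := hW.sub hB
  have hξAm : Measurable fun ω => ξ ω * A ω := hξ.mul hA
  have e1 : ∫ ω, (ξ ω : ℂ) * Complex.exp (Complex.I * (t * (W ω - A ω) : ℝ)) ∂P = 0 := by
    have := (h1.comp Complex.measurable_ofReal hexp).integral_fun_mul_eq_mul_integral
      (by simp only [Function.comp_def]; fun_prop) (by simp only [Function.comp_def]; fun_prop)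
    simp only [Function.comp_def] at this
    rw [this, integral_complex_ofReal, hmean]; simp
  have e2 : ∫ ω, ((ξ ω * A ω : ℝ) : ℂ) * Complex.exp (Complex.I * (t * (W ω - B ω) : ℝ)) ∂P
      = (∫ ω, ξ ω * A ω ∂P : ℝ) * ∫ ω, Complex.exp (Complex.I * (t * (W ω - B ω) : ℝ)) ∂P := by
    have := (h2.comp Complex.measurable_ofReal hexp).integral_fun_mul_eq_mul_integral
      (by simp only [Function.comp_def]; fun_prop) (by simp only [Function.comp_def]; fun_prop)
    simp only [Function.comp_def] at this
    rw [this, integral_complex_ofReal]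
  set m : ℝ := ∫ ω, ξ ω * A ω ∂P with hm
  have hmb : |m| ≤ a * b := by
    have := norm_integral_le_of_norm_le_const (μ := P) (f := fun ω => ξ ω * A ω) (ae_of_all _ hξA)
    simpa using this
  have i1 : Integrable (fun ω => (ξ ω : ℂ) * Complex.exp (Complex.I * (t * W ω : ℝ))) P :=
    int_of a (by fun_prop) fun ω => by rw [norm_mul, hnorm]; simpa using hξa ω
  have i2 : Integrable (fun ω => (ξ ω : ℂ) * Complex.exp (Complex.I * (t * (W ω - A ω) : ℝ))) P :=
    int_of a (by fun_prop) fun ω => by rw [norm_mul, hnorm]; simpa using hξa ω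
  have i3 : Integrable (fun ω => ((ξ ω * A ω : ℝ) : ℂ)
      * Complex.exp (Complex.I * (t * (W ω - B ω) : ℝ))) P :=
    int_of (a * b) (by fun_prop) fun ω => by
      rw [norm_mul, hnorm, mul_one, Complex.norm_real]; exact hξA ω
  have i4 : Integrable (fun ω => Complex.exp (Complex.I * (t * (W ω - B ω) : ℝ))) P :=
    int_of 1 (by fun_prop) fun ω => (hnorm _).le
  have i5 : Integrable (fun ω => Complex.exp (Complex.I * (t * W ω : ℝ))) P :=
    int_of 1 (by fun_prop) fun ω => (hnorm _).le
  -- The two inserted terms have known integrals: `e1` vanishes and `e2` factorizes. The integrand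
  -- becomes a second-order Taylor remainder of `e^{itA}` plus two first-order errors from
  -- exchanging `W - A`, `W - B` and `W`. Their bounds `2 + 1 + 1` give the constant `4`.
  have key : ∫ ω, (ξ ω : ℂ) * Complex.exp (Complex.I * (t * W ω : ℝ)) ∂P
      - Complex.I * t * m * ∫ ω, Complex.exp (Complex.I * (t * W ω : ℝ)) ∂P
      = ∫ ω, (((ξ ω : ℂ) * Complex.exp (Complex.I * (t * W ω : ℝ))
          - (ξ ω : ℂ) * Complex.exp (Complex.I * (t * (W ω - A ω) : ℝ))
          - Complex.I * t * (((ξ ω * A ω : ℝ) : ℂ)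
            * Complex.exp (Complex.I * (t * (W ω - B ω) : ℝ))))
          + Complex.I * t * m * (Complex.exp (Complex.I * (t * (W ω - B ω) : ℝ))
            - Complex.exp (Complex.I * (t * W ω : ℝ)))) ∂P := by
    have j3 := i3.const_mul (Complex.I * t)
    have j4 := (i4.sub i5).const_mul (Complex.I * t * m)
    have j12 := (i1.sub i2).sub j3
    simp only [Pi.sub_def] at j4 j12
    have j11 := i1.sub i2
    simp only [Pi.sub_def] at j11
    rw [integral_add j12 j4, integral_sub j11 j3, integral_sub i1 i2, integral_const_mul,
      integral_const_mul, integral_sub i4 i5, e1, e2]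
    ring
  rw [key]
  refine (norm_integral_le_of_norm_le_const (C := 4 * t ^ 2 * a * b ^ 2)
    (ae_of_all _ fun ω => ?_)).trans (by simp)
  have d1 : (ξ ω : ℂ) * Complex.exp (Complex.I * (t * W ω : ℝ))
          - (ξ ω : ℂ) * Complex.exp (Complex.I * (t * (W ω - A ω) : ℝ))
          - Complex.I * t * (((ξ ω * A ω : ℝ) : ℂ)
            * Complex.exp (Complex.I * (t * (W ω - B ω) : ℝ)))
      = (ξ ω : ℂ) * Complex.exp (Complex.I * (t * (W ω - A ω) : ℝ))
          * (Complex.exp (Complex.I * (t * A ω : ℝ)) - 1 - Complex.I * (t * A ω : ℝ))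
        + Complex.I * t * ((ξ ω * A ω : ℝ) : ℂ)
          * (Complex.exp (Complex.I * (t * (W ω - A ω) : ℝ))
            - Complex.exp (Complex.I * (t * (W ω - B ω) : ℝ))) := by
    have : Complex.exp (Complex.I * (t * W ω : ℝ))
        = Complex.exp (Complex.I * (t * (W ω - A ω) : ℝ))
          * Complex.exp (Complex.I * (t * A ω : ℝ)) := by
      rw [← Complex.exp_add]; push_cast; ring_nf
    rw [this]; push_cast; ring
  have hA2 : A ω ^ 2 ≤ b ^ 2 := by
    rw [← sq_abs]; exact pow_le_pow_left₀ (abs_nonneg _) (hAb ω) 2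
  have n1 : ‖(ξ ω : ℂ) * Complex.exp (Complex.I * (t * (W ω - A ω) : ℝ))
          * (Complex.exp (Complex.I * (t * A ω : ℝ)) - 1 - Complex.I * (t * A ω : ℝ))‖
        ≤ a * (2 * (t ^ 2 * b ^ 2)) := by
    rw [norm_mul, norm_mul, hnorm, mul_one, Complex.norm_real]
    refine mul_le_mul (hξa ω) ((norm_exp_I_sub_one_sub_le _).trans ?_) (norm_nonneg _) ha
    rw [mul_pow]; gcongr
  have n2 : ‖Complex.I * t * ((ξ ω * A ω : ℝ) : ℂ)
          * (Complex.exp (Complex.I * (t * (W ω - A ω) : ℝ))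
            - Complex.exp (Complex.I * (t * (W ω - B ω) : ℝ)))‖ ≤ |t| * (a * b) * (|t| * b) := by
    rw [norm_mul, norm_mul, norm_mul, Complex.norm_I, one_mul, Complex.norm_real,
      Complex.norm_real]
    refine mul_le_mul (mul_le_mul le_rfl (hξA ω) (abs_nonneg _) (abs_nonneg _))
      ((norm_exp_I_sub_exp_I_le _ _).trans ?_) (norm_nonneg _) (by positivity)
    rw [← mul_sub, abs_mul]
    refine mul_le_mul le_rfl ?_ (abs_nonneg _) (abs_nonneg _)
    rw [show W ω - A ω - (W ω - B ω) = B ω - A ω by ring]; exact hBAb ω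
  have n3 : ‖Complex.I * t * m * (Complex.exp (Complex.I * (t * (W ω - B ω) : ℝ))
            - Complex.exp (Complex.I * (t * W ω : ℝ)))‖ ≤ |t| * (a * b) * (|t| * b) := by
    rw [norm_mul, norm_mul, norm_mul, Complex.norm_I, one_mul, Complex.norm_real,
      Complex.norm_real]
    refine mul_le_mul (mul_le_mul le_rfl hmb (abs_nonneg _) (abs_nonneg _))
      ((norm_exp_I_sub_exp_I_le _ _).trans ?_) (norm_nonneg _) (by positivity)
    rw [← mul_sub, abs_mul]
    refine mul_le_mul le_rfl ?_ (abs_nonneg _) (abs_nonneg _)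
    rw [show W ω - B ω - W ω = -B ω by ring, abs_neg]; exact hBb ω
  have n12 := norm_add_le ((ξ ω : ℂ) * Complex.exp (Complex.I * (t * (W ω - A ω) : ℝ))
          * (Complex.exp (Complex.I * (t * A ω : ℝ)) - 1 - Complex.I * (t * A ω : ℝ)))
    (Complex.I * t * ((ξ ω * A ω : ℝ) : ℂ)
          * (Complex.exp (Complex.I * (t * (W ω - A ω) : ℝ))
            - Complex.exp (Complex.I * (t * (W ω - B ω) : ℝ))))
  rw [d1]
  refine (norm_add_le _ _).trans ?_
  have ht : |t| * |t| = t ^ 2 := by rw [← sq, sq_abs]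
  have e3 : |t| * (a * b) * (|t| * b) = t ^ 2 * a * b ^ 2 := by rw [← ht]; ring
  rw [e3] at n2 n3
  linarith

/-- Quantitative central limit theorem for bounded summands with dependency neighbourhoods
`N₁ k ⊆ N₂ k`. -/
theorem norm_charFun_sum_sub_gaussian_le {ι : Type*} [DecidableEq ι] (s : Finset ι)
    (ξ : ι → Ω → ℝ) (hξ : ∀ k, Measurable (ξ k)) {a D : ℝ} (hξa : ∀ k ∈ s, ∀ ω, |ξ k ω| ≤ a)
    (N₁ N₂ : ι → Finset ι) (h12 : ∀ k ∈ s, N₁ k ⊆ N₂ k) (h2s : ∀ k ∈ s, N₂ k ⊆ s)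
    (hcard : ∀ k ∈ s, ((N₂ k).card : ℝ) ≤ D) (hmean : ∀ k ∈ s, ∫ ω, ξ k ω ∂P = 0)
    (hi1 : ∀ k ∈ s, IndepFun (ξ k) (fun ω => ∑ l ∈ s \ N₁ k, ξ l ω) P)
    (hi2 : ∀ k ∈ s, IndepFun (fun ω => ξ k ω * ∑ l ∈ N₁ k, ξ l ω)
      (fun ω => ∑ l ∈ s \ N₂ k, ξ l ω) P) :
    ‖∫ ω, Complex.exp (Complex.I * (∑ k ∈ s, ξ k ω : ℝ)) ∂P
      - (Real.exp (-(∫ ω, (∑ k ∈ s, ξ k ω) ^ 2 ∂P) / 2) : ℝ)‖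
      ≤ s.card * (4 * a * (D * a) ^ 2) := by
  rcases s.eq_empty_or_nonempty with rfl | ⟨k₀, hk₀⟩
  · simp
  have ha : 0 ≤ a := by
    obtain ⟨ω⟩ := nonempty_of_isProbabilityMeasure P
    exact (abs_nonneg _).trans (hξa k₀ hk₀ ω)
  set W : Ω → ℝ := fun ω => ∑ k ∈ s, ξ k ω with hWdef
  have hW : Measurable W := by fun_prop
  have hWb : ∀ ω, |W ω| ≤ s.card * a := fun ω =>
    abs_sum_le_of_card_le ha le_rfl fun k hk => hξa k hk ω
  set V : ℝ := ∫ ω, W ω ^ 2 ∂P with hV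
  have hV0 : 0 ≤ V := integral_nonneg fun ω => sq_nonneg _
  have hnorm : ∀ x : ℝ, ‖Complex.exp (Complex.I * x)‖ = 1 := fun x => by
    rw [mul_comm, Complex.norm_exp_ofReal_mul_I]
  set φ : ℝ → ℂ := fun t => ∫ ω, Complex.exp (Complex.I * (t * W ω : ℝ)) ∂P with hφ
  have hderiv : ∀ t, HasDerivAt φ
      (∫ ω, Complex.I * W ω * Complex.exp (Complex.I * (t * W ω : ℝ)) ∂P) t := by
    intro t
    refine (hasDerivAt_integral_of_dominated_loc_of_deriv_le (bound := fun _ => s.card * a)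
      (F := fun t ω => Complex.exp (Complex.I * (t * W ω : ℝ)))
      (F' := fun t ω => Complex.I * W ω * Complex.exp (Complex.I * (t * W ω : ℝ)))
      (s := Set.univ) Filter.univ_mem (Eventually.of_forall fun x => ?_) ?_ ?_ ?_ ?_ ?_).2
    · exact (by fun_prop : Measurable _).aestronglyMeasurable
    · exact Integrable.of_bound (by fun_prop : Measurable _).aestronglyMeasurable 1
        (ae_of_all _ fun ω => (hnorm _).le)
    · exact (by fun_prop : Measurable _).aestronglyMeasurable
    · refine ae_of_all _ fun ω x _ => ?_
      rw [norm_mul, hnorm, mul_one, norm_mul, Complex.norm_I, one_mul, Complex.norm_real]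
      exact hWb ω
    · exact integrable_const _
    · refine ae_of_all _ fun ω x _ => ?_
      have h1 : HasDerivAt (fun x : ℝ => Complex.I * ((x * W ω : ℝ) : ℂ)) (Complex.I * W ω) x := by
        have := ((hasDerivAt_id x).mul_const (W ω)).ofReal_comp.const_mul Complex.I
        simpa using this
      exact h1.cexp.congr_deriv (mul_comm _ _)
  have hξA : ∀ k ∈ s, ∀ ω, |∑ l ∈ N₁ k, ξ l ω| ≤ D * a := fun k hk ω =>
    abs_sum_le_of_card_le ha ((Nat.cast_le.2 (Finset.card_le_card (h12 k hk))).trans (hcard k hk))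
      fun l hl => hξa l (h2s k hk (h12 k hk hl)) ω
  have hξB : ∀ k ∈ s, ∀ ω, |∑ l ∈ N₂ k, ξ l ω| ≤ D * a := fun k hk ω =>
    abs_sum_le_of_card_le ha (hcard k hk) fun l hl => hξa l (h2s k hk hl) ω
  have hξBA : ∀ k ∈ s, ∀ ω, |∑ l ∈ N₂ k, ξ l ω - ∑ l ∈ N₁ k, ξ l ω| ≤ D * a := by
    intro k hk ω
    rw [← Finset.sum_sdiff (h12 k hk), add_sub_cancel_right]
    exact abs_sum_le_of_card_le ha
      ((Nat.cast_le.2 (Finset.card_le_card Finset.sdiff_subset)).trans (hcard k hk))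
      fun l hl => hξa l (h2s k hk (Finset.sdiff_subset hl)) ω
  have hint : ∀ k ∈ s, Integrable (ξ k) P := fun k hk =>
    Integrable.of_bound (hξ k).aestronglyMeasurable a (ae_of_all _ fun ω => hξa k hk ω)
  -- Summands outside `N₁ k` do not correlate with `ξ k`, so the variance is exactly the sum of the
  -- local coefficients.
  have hVsum : V = ∑ k ∈ s, ∫ ω, ξ k ω * ∑ l ∈ N₁ k, ξ l ω ∂P := by
    have hterm : ∀ k ∈ s, ∫ ω, ξ k ω * ∑ l ∈ N₁ k, ξ l ω ∂P = ∫ ω, ξ k ω * W ω ∂P := by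
      intro k hk
      have hsub : ∀ ω, ξ k ω * W ω
          = ξ k ω * ∑ l ∈ s \ N₁ k, ξ l ω + ξ k ω * ∑ l ∈ N₁ k, ξ l ω := fun ω => by
        rw [hWdef, ← mul_add, Finset.sum_sdiff ((h12 k hk).trans (h2s k hk))]
      have hz : ∫ ω, ξ k ω * ∑ l ∈ s \ N₁ k, ξ l ω ∂P = 0 := by
        rw [(hi1 k hk).integral_fun_mul_eq_mul_integral (hξ k).aestronglyMeasurable
          (by fun_prop), hmean k hk, zero_mul]
      simp_rw [hsub]
      rw [integral_add, hz, zero_add]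
      · refine (hint k hk).mul_bdd (c := ((s \ N₁ k).card : ℝ) * a) (by fun_prop)
          (ae_of_all _ fun ω => ?_)
        exact abs_sum_le_of_card_le ha le_rfl fun l hl => hξa l (Finset.sdiff_subset hl) ω
      · exact (hint k hk).mul_bdd (c := D * a) (by fun_prop) (ae_of_all _ fun ω => hξA k hk ω)
    rw [Finset.sum_congr rfl hterm, ← integral_finsetSum _ fun k hk =>
      (hint k hk).mul_bdd (c := s.card * a) hW.aestronglyMeasurable (ae_of_all _ hWb)]
    refine integral_congr_ae (ae_of_all _ fun ω => ?_)
    simp only [← Finset.sum_mul, sq]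
    rfl
  -- The characteristic function almost solves the Gaussian equation `φ' = -tVφ`.
  have hode : ∀ t : ℝ, ‖(∫ ω, Complex.I * W ω * Complex.exp (Complex.I * (t * W ω : ℝ)) ∂P)
      + t * V * φ t‖ ≤ s.card * (4 * t ^ 2 * a * (D * a) ^ 2) := by
    intro t
    have h1 : ∫ ω, Complex.I * W ω * Complex.exp (Complex.I * (t * W ω : ℝ)) ∂P
        = Complex.I * ∑ k ∈ s, ∫ ω, (ξ k ω : ℂ) * Complex.exp (Complex.I * (t * W ω : ℝ)) ∂P := by
      rw [← integral_finsetSum, ← integral_const_mul]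
      · refine integral_congr_ae (ae_of_all _ fun ω => ?_)
        simp only [← Finset.sum_mul, hWdef]
        push_cast
        ring
      · intro k hk
        refine Integrable.of_bound (by fun_prop : Measurable _).aestronglyMeasurable a
          (ae_of_all _ fun ω => ?_)
        rw [norm_mul, hnorm, mul_one, Complex.norm_real]
        exact hξa k hk ω
    have h2 : (∫ ω, Complex.I * W ω * Complex.exp (Complex.I * (t * W ω : ℝ)) ∂P) + t * V * φ t
        = Complex.I * ∑ k ∈ s, (∫ ω, (ξ k ω : ℂ) * Complex.exp (Complex.I * (t * W ω : ℝ)) ∂P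
          - Complex.I * t * (∫ ω, ξ k ω * ∑ l ∈ N₁ k, ξ l ω ∂P : ℝ) * φ t) := by
      rw [h1, Finset.sum_sub_distrib, ← Finset.sum_mul, ← Finset.mul_sum, hVsum, mul_sub]
      push_cast
      ring_nf
      simp only [Complex.I_sq]; ring
    rw [h2, norm_mul, Complex.norm_I, one_mul]
    refine (norm_sum_le _ _).trans ((Finset.sum_le_card_nsmul _ _ _ fun k hk => ?_).trans
      (nsmul_eq_mul _ _).le)
    refine norm_integral_mul_exp_sub_le (B := fun ω => ∑ l ∈ N₂ k, ξ l ω) hW (hξ k)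
      (by fun_prop) (by fun_prop) (hξa k hk)
      (hξA k hk) (hξB k hk) (hξBA k hk) (hmean k hk) ?_ ?_ t
    · convert hi1 k hk using 3 with ω
      rw [hWdef, sub_eq_iff_eq_add, Finset.sum_sdiff ((h12 k hk).trans (h2s k hk))]
    · convert hi2 k hk using 3 with ω
      rw [hWdef, sub_eq_iff_eq_add, Finset.sum_sdiff (h2s k hk)]
  -- Integrating factor, normalized so that `g 1 = 1` and `g ≤ 1` on `[0,1]`. Then `(φ g)' = (φ' +
  -- tVφ) g` is small, and `φ g` goes from `e^{-V/2}` at `0` to the characteristic function at `1`.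
  set g : ℝ → ℝ := fun t => Real.exp ((t ^ 2 - 1) * V / 2) with hg
  have hgd : ∀ t, HasDerivAt g (g t * (t * V)) t := by
    intro t
    have h1 : HasDerivAt (fun t : ℝ => (t ^ 2 - 1) * V / 2) (t * V) t := by
      have := ((((hasDerivAt_id t).pow 2).sub_const 1).mul_const V).div_const 2
      exact this.congr_deriv (by simp; ring)
    exact h1.exp
  have hmain := norm_image_sub_le_of_norm_deriv_le_segment_01'
    (f := fun t => φ t * (g t : ℂ))
    (f' := fun t => (∫ ω, Complex.I * W ω * Complex.exp (Complex.I * (t * W ω : ℝ)) ∂P) * (g t : ℂ)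
      + φ t * ((g t * (t * V) : ℝ) : ℂ)) (C := s.card * (4 * a * (D * a) ^ 2))
    (fun t _ => ((hderiv t).mul (hgd t).ofReal_comp).hasDerivWithinAt) ?_
  · have e1 : φ 1 * (g 1 : ℂ) = ∫ ω, Complex.exp (Complex.I * (W ω : ℝ)) ∂P := by simp [hφ, hg]
    have e0 : φ 0 * (g 0 : ℂ) = (Real.exp (-V / 2) : ℝ) := by
      simp [hφ, hg]
    rw [e1, e0] at hmain
    exact hmain
  · intro t ht
    have : (∫ ω, Complex.I * W ω * Complex.exp (Complex.I * (t * W ω : ℝ)) ∂P) * (g t : ℂ)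
        + φ t * ((g t * (t * V) : ℝ) : ℂ)
        = ((∫ ω, Complex.I * W ω * Complex.exp (Complex.I * (t * W ω : ℝ)) ∂P) + t * V * φ t)
          * (g t : ℂ) := by push_cast; ring
    rw [this, norm_mul, Complex.norm_real, Real.norm_of_nonneg (Real.exp_pos _).le]
    have ht2 : t ^ 2 ≤ 1 := by nlinarith [ht.1, ht.2]
    have hg1 : g t ≤ 1 := by
      rw [hg]
      refine Real.exp_le_one_iff.2 ?_
      have := mul_nonneg (sub_nonneg.2 ht2) hV0
      linarith
    refine (mul_le_mul (hode t) hg1 (Real.exp_pos _).le (by positivity)).trans ?_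
    rw [mul_one]
    have hX : 0 ≤ a * (D * a) ^ 2 := by positivity
    refine mul_le_mul_of_nonneg_left ?_ (Nat.cast_nonneg _)
    nlinarith

end DependencyNeighbourhoods

/-! ### The `L²` norm as a real number. -/

section L2Norm

variable {Ω : Type*} [MeasurableSpace Ω] {P : Measure Ω}

/-- The `L²` norm `(E|f|²)^{1/2}` as a real number. -/
noncomputable def l2norm (P : Measure Ω) (f : Ω → ℝ) : ℝ := (eLpNorm f 2 P).toReal

lemma l2norm_nonneg (f : Ω → ℝ) : 0 ≤ l2norm P f := ENNReal.toReal_nonneg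

lemma ofReal_l2norm {f : Ω → ℝ} (hf : MemLp f 2 P) : ENNReal.ofReal (l2norm P f) = eLpNorm f 2 P :=
  ENNReal.ofReal_toReal hf.eLpNorm_ne_top

lemma norm_toLp_eq_l2norm {f : Ω → ℝ} (hf : MemLp f 2 P) : ‖hf.toLp f‖ = l2norm P f :=
  Lp.norm_toLp f hf

lemma inner_toLp_eq_integral {f g : Ω → ℝ} (hf : MemLp f 2 P) (hg : MemLp g 2 P) :
    inner ℝ (hf.toLp f) (hg.toLp g) = ∫ ω, f ω * g ω ∂P := by
  rw [L2.inner_def]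
  refine integral_congr_ae ?_
  filter_upwards [hf.coeFn_toLp, hg.coeFn_toLp] with ω h1 h2
  rw [h1, h2]; simp [mul_comm]

lemma l2norm_sq {f : Ω → ℝ} (hf : MemLp f 2 P) : l2norm P f ^ 2 = ∫ ω, f ω ^ 2 ∂P := by
  rw [← norm_toLp_eq_l2norm hf, ← real_inner_self_eq_norm_sq, inner_toLp_eq_integral]
  simp_rw [sq]

lemma abs_integral_mul_le_l2norm {f g : Ω → ℝ} (hf : MemLp f 2 P) (hg : MemLp g 2 P) :
    |∫ ω, f ω * g ω ∂P| ≤ l2norm P f * l2norm P g := by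
  rw [← inner_toLp_eq_integral hf hg, ← norm_toLp_eq_l2norm hf, ← norm_toLp_eq_l2norm hg]
  exact abs_real_inner_le_norm _ _

lemma l2norm_add_le {f g : Ω → ℝ} (hf : MemLp f 2 P) (hg : MemLp g 2 P) :
    l2norm P (fun ω => f ω + g ω) ≤ l2norm P f + l2norm P g := by
  have h := norm_add_le (hf.toLp f) (hg.toLp g)
  rwa [← MemLp.toLp_add hf hg, norm_toLp_eq_l2norm, norm_toLp_eq_l2norm, norm_toLp_eq_l2norm] at h

lemma l2norm_sub_le {f g : Ω → ℝ} (hf : MemLp f 2 P) (hg : MemLp g 2 P) :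
    l2norm P (fun ω => f ω - g ω) ≤ l2norm P f + l2norm P g := by
  have h := norm_sub_le (hf.toLp f) (hg.toLp g)
  rwa [← MemLp.toLp_sub hf hg, norm_toLp_eq_l2norm, norm_toLp_eq_l2norm, norm_toLp_eq_l2norm] at h

lemma l2norm_sum_le {ι : Type*} (s : Finset ι) {f : ι → Ω → ℝ} (hf : ∀ i, MemLp (f i) 2 P) :
    l2norm P (fun ω => ∑ i ∈ s, f i ω) ≤ ∑ i ∈ s, l2norm P (f i) := by
  classical
  induction s using Finset.induction_on with
  | empty => simp [l2norm]
  | insert i s hi ih =>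
    simp only [Finset.sum_insert hi]
    exact (l2norm_add_le (hf i) (memLp_finsetSum _ fun j _ => hf j)).trans
      (add_le_add le_rfl ih)

lemma l2norm_const_mul (c : ℝ) (f : Ω → ℝ) : l2norm P (fun ω => c * f ω) = |c| * l2norm P f := by
  have := eLpNorm_const_smul (μ := P) c f 2
  simp only [l2norm]
  rw [show (fun ω => c * f ω) = c • f from rfl, this, ENNReal.toReal_mul]
  simp

lemma l2norm_congr {f g : Ω → ℝ} (h : f =ᵐ[P] g) : l2norm P f = l2norm P g := by
  simp only [l2norm, eLpNorm_congr_ae h]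

lemma l2norm_condExp_le {Ω : Type*} {m mΩ : MeasurableSpace Ω} {P : Measure Ω} {f : Ω → ℝ} (hf : MemLp f 2 P) :
    l2norm P (P[f|m]) ≤ l2norm P f :=
  ENNReal.toReal_mono hf.eLpNorm_ne_top (eLpNorm_condExp_le_eLpNorm f one_le_two)

lemma integral_le_l2norm [IsProbabilityMeasure P] {f : Ω → ℝ} (hf : MemLp f 2 P) :
    ∫ ω, |f ω| ∂P ≤ l2norm P f := by
  have h := abs_integral_mul_le_l2norm (P := P) (f := fun ω => |f ω|) (g := fun _ => (1 : ℝ))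
    hf.abs (memLp_const 1)
  have h1 : l2norm P (fun _ : Ω => (1 : ℝ)) = 1 := by
    have := l2norm_sq (P := P) (f := fun _ => (1 : ℝ)) (memLp_const 1)
    simp at this
    rcases this with h | h
    · exact h
    · have := l2norm_nonneg (P := P) (fun _ : Ω => (1 : ℝ)); linarith
  have h2 : l2norm P (fun ω => |f ω|) = l2norm P f := by
    simp only [l2norm]; congr 1; exact eLpNorm_norm f
  rw [h1, h2] at h
  simp only [mul_one] at h
  exact (le_abs_self _).trans h

/-- Pythagoras for a linear combination of orthogonal variables of equal norm. -/
lemma l2norm_sum_orthogonal {ι : Type*} (s : Finset ι) (c : ι → ℝ) {f : ι → Ω → ℝ} {p : ℝ}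
    (hf : ∀ i, MemLp (f i) 2 P) (hp : ∀ i, l2norm P (f i) = p) (hp0 : 0 ≤ p)
    (horth : ∀ i j, i ≠ j → ∫ ω, f i ω * f j ω ∂P = 0) :
    l2norm P (fun ω => ∑ i ∈ s, c i * f i ω) = p * √(∑ i ∈ s, c i ^ 2) := by
  classical
  have hmem : MemLp (fun ω => ∑ i ∈ s, c i * f i ω) 2 P :=
    memLp_finsetSum _ fun i _ => (hf i).const_mul (c i)
  refine (Real.sqrt_sq (l2norm_nonneg _)).symm.trans ?_
  nth_rewrite 1 [← Real.sqrt_sq hp0]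
  rw [← Real.sqrt_mul (sq_nonneg p), l2norm_sq hmem]
  congr 1
  have hint : ∀ i j, Integrable (fun ω => f i ω * f j ω) P := fun i j =>
    (hf i).integrable_mul (hf j)
  calc ∫ ω, (∑ i ∈ s, c i * f i ω) ^ 2 ∂P
      = ∫ ω, ∑ i ∈ s, ∑ j ∈ s, c i * c j * (f i ω * f j ω) ∂P := by
        congr 1; ext ω; rw [sq, Finset.sum_mul_sum]
        exact Finset.sum_congr rfl fun i _ => Finset.sum_congr rfl fun j _ => by ring
    _ = ∑ i ∈ s, ∑ j ∈ s, c i * c j * ∫ ω, f i ω * f j ω ∂P := by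
        rw [integral_finsetSum _ fun i _ => integrable_finsetSum _ fun j _ =>
          (hint i j).const_mul _]
        refine Finset.sum_congr rfl fun i _ => ?_
        rw [integral_finsetSum _ fun j _ => (hint i j).const_mul _]
        exact Finset.sum_congr rfl fun j _ => integral_const_mul _ _
    _ = p ^ 2 * ∑ i ∈ s, c i ^ 2 := by
        rw [Finset.mul_sum]
        refine Finset.sum_congr rfl fun i hi => ?_
        rw [Finset.sum_eq_single_of_mem i hi fun j _ hj => by rw [horth i j hj.symm, mul_zero]]
        have : ∫ ω, f i ω * f i ω ∂P = p ^ 2 := by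
          rw [← hp i, l2norm_sq (hf i)]; simp_rw [sq]
        rw [this]; ring

end L2Norm

/-! ### The sequence of past innovations and the transition operator. -/

section PastMaps

variable {Ω : Type*}

/-- The past `(ε_k, ε_{k-1}, …)` of the innovations at time `k`. -/
def past (ε : ℤ → Ω → ℝ) (k : ℤ) (ω : Ω) : ℕ → ℝ := fun i => ε (k - i) ω

/-- Prepending an entry to a sequence. -/
def consSeq (e : ℝ) (x : ℕ → ℝ) : ℕ → ℝ := fun i => Nat.casesOn i e x

/-- The sequence without its first entry. -/
def tailSeq (x : ℕ → ℝ) : ℕ → ℝ := fun i => x (i + 1)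

lemma measurable_consSeq : Measurable fun p : (ℕ → ℝ) × ℝ => consSeq p.2 p.1 := by
  refine measurable_pi_lambda _ fun i => ?_
  cases i with
  | zero => exact measurable_snd
  | succ i => exact (measurable_pi_apply i).comp measurable_fst

lemma measurable_tailSeq : Measurable tailSeq :=
  measurable_pi_lambda _ fun i => measurable_pi_apply (i + 1)

lemma past_eq_consSeq (ε : ℤ → Ω → ℝ) (k : ℤ) (ω : Ω) :
    past ε k ω = consSeq (ε k ω) (past ε (k - 1) ω) := by
  funext i
  cases i with
  | zero => simp [past, consSeq]
  | succ i =>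
    simp only [past, consSeq]
    congr 1
    push_cast; ring

lemma tailSeq_past (ε : ℤ → Ω → ℝ) (k : ℤ) (ω : Ω) : tailSeq (past ε k ω) = past ε (k - 1) ω := by
  rw [past_eq_consSeq]; rfl

lemma tailSeq_iterate_past (ε : ℤ → Ω → ℝ) (k : ℤ) (i : ℕ) (ω : Ω) :
    tailSeq^[i] (past ε k ω) = past ε (k - i) ω := by
  induction i with
  | zero => simp
  | succ i ih =>
    rw [Function.iterate_succ_apply', ih, tailSeq_past]
    congr 1; push_cast; ring

lemma pastSigma_eq_biSup (ε : ℤ → Ω → ℝ) (k : ℤ) :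
    pastSigma ε k = ⨆ j ∈ Set.Iic k, MeasurableSpace.comap (ε j) inferInstance := by
  rw [pastSigma, iSup_subtype']

/-- Lets `𝓕_k`-measurable variables be treated as functions of one sequence-valued variable, so that
conditional distributions apply. -/
lemma pastSigma_eq_comap (ε : ℤ → Ω → ℝ) (k : ℤ) :
    pastSigma ε k = MeasurableSpace.comap (past ε k) inferInstance := by
  apply le_antisymm
  · refine iSup_le fun j => ?_
    have hj : ε j = (fun x : ℕ → ℝ => x (k - j).toNat) ∘ past ε k := by
      funext ω
      have : (j : ℤ) ≤ k := j.2
      simp only [Function.comp, past]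
      congr 1
      omega
    conv_lhs => rw [hj]
    rw [← MeasurableSpace.comap_comp]
    exact MeasurableSpace.comap_mono (measurable_pi_apply _).comap_le
  · rw [show (inferInstance : MeasurableSpace (ℕ → ℝ)) = MeasurableSpace.pi from rfl,
      MeasurableSpace.pi, MeasurableSpace.comap_iSup]
    refine iSup_le fun i => ?_
    rw [MeasurableSpace.comap_comp]
    exact le_iSup (fun j : Set.Iic k => MeasurableSpace.comap (ε j) inferInstance)
      ⟨k - i, by simp⟩

lemma pastSigma_mono (ε : ℤ → Ω → ℝ) {k l : ℤ} (h : k ≤ l) : pastSigma ε k ≤ pastSigma ε l :=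
  iSup_le fun j => le_iSup (fun j : Set.Iic l => MeasurableSpace.comap (ε j) inferInstance)
    ⟨j, le_trans j.2 h⟩

variable [mΩ : MeasurableSpace Ω]

/-- A sequence of i.i.d. real random variables indexed by `ℤ`. -/
structure IsIID (P : Measure Ω) (ε : ℤ → Ω → ℝ) : Prop where
  meas : ∀ j, Measurable (ε j)
  indep : iIndepFun ε P
  ident : ∀ j, IdentDistrib (ε j) (ε 0) P P

/-- The transition operator `(Kφ)(x) = E φ(ε_0, x_0, x_1, …)`. -/
noncomputable def transition (P : Measure Ω) (ε : ℤ → Ω → ℝ) (φ : (ℕ → ℝ) → ℝ) (x : ℕ → ℝ) : ℝ :=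
  ∫ e, φ (consSeq e x) ∂(P.map (ε 0))

lemma measurable_past {ε : ℤ → Ω → ℝ} (hε : ∀ j, Measurable (ε j)) (k : ℤ) :
    Measurable (past ε k) :=
  measurable_pi_lambda _ fun i => hε (k - i)

lemma pastSigma_le {ε : ℤ → Ω → ℝ} (hε : ∀ j, Measurable (ε j)) (k : ℤ) : pastSigma ε k ≤ mΩ :=
  iSup_le fun j => (hε j).comap_le

variable {P : Measure Ω} {ε : ℤ → Ω → ℝ}

lemma IsIID.indep_sigma (h : IsIID P ε) {S T : Set ℤ} (hST : Disjoint S T) :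
    Indep (⨆ j ∈ S, MeasurableSpace.comap (ε j) inferInstance)
      (⨆ j ∈ T, MeasurableSpace.comap (ε j) inferInstance) P :=
  indep_iSup_of_disjoint (fun j => (h.meas j).comap_le) h.indep hST

lemma IsIID.indepFun_past (h : IsIID P ε) (k : ℤ) : IndepFun (past ε (k - 1)) (ε k) P := by
  have := h.indep_sigma (S := Set.Iic (k - 1)) (T := {k}) (by simp)
  rw [← pastSigma_eq_biSup, pastSigma_eq_comap] at this
  simpa [IndepFun_iff_Indep] using this

lemma measurable_transition [SFinite (P.map (ε 0))] {φ : (ℕ → ℝ) → ℝ} (hφ : Measurable φ) :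
    Measurable (transition P ε φ) :=
  (StronglyMeasurable.integral_prod_right' (ν := P.map (ε 0))
    (f := fun p : (ℕ → ℝ) × ℝ => φ (consSeq p.2 p.1))
    (hφ.comp measurable_consSeq).stronglyMeasurable).measurable

variable [IsProbabilityMeasure P]

/-- Stationarity: whatever `k` is, the law of the past is the infinite product of the law of `ε 0`.
-/
lemma IsIID.map_past (h : IsIID P ε) (k : ℤ) : P.map (past ε k) = P.map (past ε 0) := by
  have key : ∀ k, P.map (past ε k) = Measure.infinitePi fun _ : ℕ => P.map (ε 0) := by
    intro k
    have hinj : Function.Injective fun i : ℕ => k - (i : ℤ) := fun a b hab => by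
      simpa using hab
    have := (iIndepFun_iff_map_fun_eq_infinitePi_map fun i : ℕ => h.meas (k - i)).1
      (h.indep.precomp hinj)
    simp only [(h.ident _).map_eq] at this
    exact this
  rw [key, key]

lemma IsIID.identDistrib_past (h : IsIID P ε) (k l : ℤ) :
    IdentDistrib (past ε k) (past ε l) P P where
  aemeasurable_fst := (measurable_past h.meas k).aemeasurable
  aemeasurable_snd := (measurable_past h.meas l).aemeasurable
  map_eq := by rw [h.map_past k, h.map_past l]

lemma IsIID.l2norm_comp_past (h : IsIID P ε) {φ : (ℕ → ℝ) → ℝ} (hφ : Measurable φ) (k l : ℤ) :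
    l2norm P (fun ω => φ (past ε k ω)) = l2norm P (fun ω => φ (past ε l ω)) := by
  have := ((h.identDistrib_past k l).comp hφ).eLpNorm_eq 2
  simp only [l2norm]
  exact congrArg ENNReal.toReal this

lemma IsIID.integral_comp_past (h : IsIID P ε) {φ : (ℕ → ℝ) → ℝ} (hφ : Measurable φ) (k l : ℤ) :
    ∫ ω, φ (past ε k ω) ∂P = ∫ ω, φ (past ε l ω) ∂P :=
  ((h.identDistrib_past k l).comp hφ).integral_eq

/-- The newest innovation is independent of the earlier ones, so its conditional law is constant and
conditioning on `𝓕_{k-1}` just integrates it out. -/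
lemma IsIID.condExp_comp_past (h : IsIID P ε) {φ : (ℕ → ℝ) → ℝ} (hφ : Measurable φ) (k : ℤ)
    (hint : Integrable (fun ω => φ (past ε k ω)) P) :
    P[fun ω => φ (past ε k ω) | pastSigma ε (k - 1)]
      =ᵐ[P] fun ω => transition P ε φ (past ε (k - 1) ω) := by
  have hX := measurable_past h.meas (k - 1)
  have hcd : condDistrib (ε k) (past ε (k - 1)) P =ᵐ[P.map (past ε (k - 1))]
      Kernel.const _ (P.map (ε 0)) := by
    have : IsProbabilityMeasure (P.map (ε 0)) :=
      Measure.isProbabilityMeasure_map (h.meas 0).aemeasurable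
    rw [condDistrib_ae_eq_iff_measure_eq_compProd _ (h.meas k).aemeasurable,
      Measure.compProd_const,
      (indepFun_iff_map_prod_eq_prod_map_map hX.aemeasurable (h.meas k).aemeasurable).1
        (h.indepFun_past k), (h.ident k).map_eq]
  have hmain := condExp_prod_ae_eq_integral_condDistrib (μ := P) (X := past ε (k - 1)) (Y := ε k)
    (f := fun p : (ℕ → ℝ) × ℝ => φ (consSeq p.2 p.1)) hX (h.meas k).aemeasurable
    (hφ.comp measurable_consSeq).stronglyMeasurable (by simpa only [← past_eq_consSeq] using hint)
  simp only [← past_eq_consSeq] at hmain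
  rw [pastSigma_eq_comap]
  filter_upwards [hmain, ae_of_ae_map hX.aemeasurable hcd] with ω h1 h2
  rw [h1, h2]
  rfl

end PastMaps

/-! ### Stationary martingale differences and centering. -/

section MartingaleDifferences

variable {Ω : Type*} [mΩ : MeasurableSpace Ω]

/-- `φ(ε_k, ε_{k-1}, …)`, `k ∈ ℤ`, are square integrable martingale differences. -/
structure IsMDiff (P : Measure Ω) (ε : ℤ → Ω → ℝ) (φ : (ℕ → ℝ) → ℝ) : Prop where
  meas : Measurable φ
  memLp : ∀ k, MemLp (fun ω => φ (past ε k ω)) 2 P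
  condExp : ∀ k, P[fun ω => φ (past ε k ω) | pastSigma ε (k - 1)] =ᵐ[P] 0

/-- `φ` minus its conditional mean given the sequence without the first entry. -/
noncomputable def center (P : Measure Ω) (ε : ℤ → Ω → ℝ) (φ : (ℕ → ℝ) → ℝ) (x : ℕ → ℝ) : ℝ :=
  φ x - transition P ε φ (tailSeq x)

variable {P : Measure Ω} [IsProbabilityMeasure P] {ε : ℤ → Ω → ℝ}

lemma IsMDiff.sub {φ ψ : (ℕ → ℝ) → ℝ} (hφ : IsMDiff P ε φ) (hψ : IsMDiff P ε ψ) :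
    IsMDiff P ε fun x => φ x - ψ x where
  meas := hφ.meas.sub hψ.meas
  memLp k := (hφ.memLp k).sub (hψ.memLp k)
  condExp k := by
    have := condExp_sub ((hφ.memLp k).integrable one_le_two) ((hψ.memLp k).integrable one_le_two)
      (pastSigma ε (k - 1))
    refine EventuallyEq.trans this ?_
    filter_upwards [hφ.condExp k, hψ.condExp k] with ω h1 h2
    simp [h1, h2]

/-- Since `k < l`, the factor at time `k` is `𝓕_{l-1}`-measurable and comes out of the conditional
expectation. Only the later factor needs to be a martingale difference. -/
lemma IsMDiff.integral_mul_eq_zero (h : IsIID P ε) {φ ψ : (ℕ → ℝ) → ℝ} (hφ : IsMDiff P ε φ)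
    (hψ : Measurable ψ) (hψ2 : ∀ k, MemLp (fun ω => ψ (past ε k ω)) 2 P) {k l : ℤ} (hkl : k < l) :
    ∫ ω, ψ (past ε k ω) * φ (past ε l ω) ∂P = 0 := by
  have hle := pastSigma_le h.meas (l - 1)
  have hm : StronglyMeasurable[pastSigma ε (l - 1)] fun ω => ψ (past ε k ω) := by
    refine Measurable.stronglyMeasurable ?_
    refine hψ.comp (Measurable.mono ?_ (pastSigma_mono ε (Int.le_sub_one_of_lt hkl)) le_rfl)
    rw [pastSigma_eq_comap]
    exact comap_measurable _
  have := condExp_mul_of_stronglyMeasurable_left hm ((hψ2 k).integrable_mul (hφ.memLp l))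
    ((hφ.memLp l).integrable one_le_two)
  rw [← integral_condExp hle, show (fun ω => ψ (past ε k ω) * φ (past ε l ω))
    = (fun ω => ψ (past ε k ω)) * fun ω => φ (past ε l ω) from rfl, integral_congr_ae this]
  refine integral_eq_zero_of_ae ?_
  filter_upwards [hφ.condExp l] with ω h1
  simp [h1]

lemma IsMDiff.l2norm_sum (h : IsIID P ε) {φ : (ℕ → ℝ) → ℝ} (hφ : IsMDiff P ε φ) (s : Finset ℤ)
    (c : ℤ → ℝ) (i : ℤ) :
    l2norm P (fun ω => ∑ k ∈ s, c k * φ (past ε (k - i) ω))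
      = l2norm P (fun ω => φ (past ε 0 ω)) * √(∑ k ∈ s, c k ^ 2) := by
  refine l2norm_sum_orthogonal s c (f := fun k ω => φ (past ε (k - i) ω)) (fun k => hφ.memLp _)
    (fun k => h.l2norm_comp_past hφ.meas _ _) (l2norm_nonneg _) fun k l hkl => ?_
  rcases lt_or_gt_of_ne hkl with hlt | hlt
  · exact hφ.integral_mul_eq_zero h hφ.meas hφ.memLp (sub_lt_sub_right hlt i)
  · simp_rw [mul_comm (φ (past ε (k - i) _))]
    exact hφ.integral_mul_eq_zero h hφ.meas hφ.memLp (sub_lt_sub_right hlt i)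

lemma IsIID.memLp_transition (h : IsIID P ε) {φ : (ℕ → ℝ) → ℝ} (hφ : Measurable φ)
    (hφ2 : ∀ k, MemLp (fun ω => φ (past ε k ω)) 2 P) (k : ℤ) :
    MemLp (fun ω => transition P ε φ (past ε k ω)) 2 P := by
  have := h.condExp_comp_past hφ (k + 1) ((hφ2 _).integrable one_le_two)
  rw [add_sub_cancel_right] at this
  exact (memLp_congr_ae this).1 ((hφ2 _).condExp one_le_two)

lemma IsIID.isMDiff_center (h : IsIID P ε) {φ : (ℕ → ℝ) → ℝ} (hφ : Measurable φ)
    (hφ2 : ∀ k, MemLp (fun ω => φ (past ε k ω)) 2 P) : IsMDiff P ε (center P ε φ) where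
  meas := hφ.sub ((measurable_transition hφ).comp measurable_tailSeq)
  memLp k := by
    simp only [center, tailSeq_past]
    exact (hφ2 k).sub (h.memLp_transition hφ hφ2 (k - 1))
  condExp k := by
    simp only [center, tailSeq_past]
    have hle := pastSigma_le h.meas (k - 1)
    have hm : StronglyMeasurable[pastSigma ε (k - 1)]
        fun ω => transition P ε φ (past ε (k - 1) ω) := by
      refine ((measurable_transition hφ).comp ?_).stronglyMeasurable
      rw [pastSigma_eq_comap]
      exact comap_measurable _
    have hi := (h.memLp_transition hφ hφ2 (k - 1)).integrable one_le_two
    have := condExp_sub ((hφ2 k).integrable one_le_two) hi (pastSigma ε (k - 1))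
    refine EventuallyEq.trans this ?_
    rw [condExp_of_stronglyMeasurable hle hm hi]
    filter_upwards [h.condExp_comp_past hφ k ((hφ2 k).integrable one_le_two)] with ω h1
    simp [h1]

/-- Centering fixes `ψ` almost surely and is the identity minus an `L²` contraction, whence the
factor `2`. So an approximation can be made a martingale difference at bounded cost. -/
lemma IsMDiff.l2norm_sub_center_le (h : IsIID P ε) {φ ψ : (ℕ → ℝ) → ℝ} (hψ : IsMDiff P ε ψ)
    (hφ : Measurable φ) (hφ2 : ∀ k, MemLp (fun ω => φ (past ε k ω)) 2 P) :
    l2norm P (fun ω => ψ (past ε 0 ω) - center P ε φ (past ε 0 ω))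
      ≤ 2 * l2norm P (fun ω => ψ (past ε 0 ω) - φ (past ε 0 ω)) := by
  set D : Ω → ℝ := fun ω => ψ (past ε 0 ω) - φ (past ε 0 ω) with hD
  have hD2 : MemLp D 2 P := (hψ.memLp 0).sub (hφ2 0)
  have key : (fun ω => ψ (past ε 0 ω) - center P ε φ (past ε 0 ω))
      =ᵐ[P] fun ω => D ω - (P[D | pastSigma ε (0 - 1)]) ω := by
    have := condExp_sub ((hψ.memLp 0).integrable one_le_two) ((hφ2 0).integrable one_le_two)
      (pastSigma ε (0 - 1))
    filter_upwards [this, hψ.condExp 0,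
      h.condExp_comp_past hφ 0 ((hφ2 0).integrable one_le_two)] with ω h1 h2 h3
    have h4 : (P[D | pastSigma ε (0 - 1)]) ω = 0 - transition P ε φ (past ε (0 - 1) ω) := by
      rw [← h3, ← Pi.zero_apply (M := fun _ : Ω => ℝ) ω, ← h2]; exact h1
    rw [h4, center, tailSeq_past, hD]
    simp only
    ring
  rw [l2norm_congr key, two_mul]
  exact (l2norm_sub_le hD2 (hD2.condExp one_le_two)).trans
    (add_le_add le_rfl (l2norm_condExp_le hD2))

end MartingaleDifferences

/-! ### Bounded functions of finitely many innovations. -/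

section FiniteWindow

variable {Ω : Type*}

/-- The sequence with the entries after the `L`-th replaced by `0`. -/
def truncSeq (L : ℕ) (x : ℕ → ℝ) : ℕ → ℝ := fun i => if i ≤ L then x i else 0

lemma continuous_truncSeq (L : ℕ) : Continuous (truncSeq L) := by
  refine continuous_pi fun i => ?_
  by_cases h : i ≤ L
  · simpa [truncSeq, h] using continuous_apply i
  · simpa [truncSeq, h] using continuous_const

lemma tendsto_truncSeq (x : ℕ → ℝ) : Tendsto (fun L => truncSeq L x) atTop (𝓝 x) := by
  refine tendsto_pi_nhds.2 fun i => tendsto_const_nhds.congr' ?_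
  filter_upwards [eventually_ge_atTop i] with L hL
  simp [truncSeq, hL]

lemma dependsOn_comp_truncSeq (φ : (ℕ → ℝ) → ℝ) (L : ℕ) :
    DependsOn (fun x => φ (truncSeq L x)) (Set.Iic L) := by
  intro x y hxy
  have : truncSeq L x = truncSeq L y := by
    funext i
    simp only [truncSeq]
    split_ifs with h
    · exact hxy i h
    · rfl
  simp only [this]

lemma comp_truncSeq_of_dependsOn {φ : (ℕ → ℝ) → ℝ} {L : ℕ} (hφ : DependsOn φ (Set.Iic L))
    (x : ℕ → ℝ) : φ (truncSeq L x) = φ x :=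
  hφ fun i hi => by
    have : i ≤ L := hi
    simp [truncSeq, this]

/-- Such a function factors through `truncSeq L`, which reads only `ε_{k-L}, …, ε_k`. An arbitrary
superset `S` of this window is allowed, to fit `IsIID.indep_sigma`. -/
lemma measurable_comp_past_of_dependsOn {ε : ℤ → Ω → ℝ} {φ : (ℕ → ℝ) → ℝ}
    (hφm : Measurable φ) {L : ℕ} (hφ : DependsOn φ (Set.Iic L)) (k : ℤ) {S : Set ℤ}
    (hS : ∀ j : ℤ, k - L ≤ j → j ≤ k → j ∈ S) :
    Measurable[⨆ j ∈ S, MeasurableSpace.comap (ε j) inferInstance]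
      fun ω => φ (past ε k ω) := by
  rw [show (fun ω => φ (past ε k ω)) = fun ω => φ (truncSeq L (past ε k ω)) from
    funext fun ω => (comp_truncSeq_of_dependsOn hφ _).symm]
  refine hφm.comp (@measurable_pi_lambda _ _ _ (_) _ _ fun i => ?_)
  by_cases h : i ≤ L
  · have hj : (k - i : ℤ) ∈ S := hS _ (by omega) (by omega)
    have : Measurable[⨆ j ∈ S, MeasurableSpace.comap (ε j) inferInstance] (ε (k - i)) :=
      (comap_measurable (ε (k - i))).mono
        (le_iSup₂_of_le (f := fun j (_ : j ∈ S) => MeasurableSpace.comap (ε j) inferInstance)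
          (k - i) hj le_rfl) le_rfl
    simpa [truncSeq, h, past] using this
  · simp [truncSeq, h]

variable [mΩ : MeasurableSpace Ω]

/-- Averaging replaces entry `0` and leaves the other entries in place, so the window does not grow.
-/
lemma dependsOn_center {P : Measure Ω} {ε : ℤ → Ω → ℝ} {φ : (ℕ → ℝ) → ℝ} {L : ℕ}
    (hφ : DependsOn φ (Set.Iic L)) : DependsOn (center P ε φ) (Set.Iic L) := by
  intro x y hxy
  have h2 : ∀ e, φ (consSeq e (tailSeq x)) = φ (consSeq e (tailSeq y)) := fun e =>
    hφ fun i hi => by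
      cases i with
      | zero => rfl
      | succ i => exact hxy (i + 1) hi
  simp only [center, transition, h2, hφ hxy]

lemma abs_center_le {P : Measure Ω} [IsProbabilityMeasure P] {ε : ℤ → Ω → ℝ}
    (hε : Measurable (ε 0)) {φ : (ℕ → ℝ) → ℝ} {K : ℝ}
    (hφ : ∀ x, |φ x| ≤ K) (x : ℕ → ℝ) : |center P ε φ x| ≤ 2 * K := by
  have : IsProbabilityMeasure (P.map (ε 0)) := Measure.isProbabilityMeasure_map hε.aemeasurable
  have h1 : |transition P ε φ (tailSeq x)| ≤ K := by
    have := norm_integral_le_of_norm_le_const (μ := P.map (ε 0))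
      (f := fun e => φ (consSeq e (tailSeq x))) (C := K) (ae_of_all _ fun _ => hφ _)
    simpa [transition] using this
  rw [center, two_mul]
  exact (abs_sub _ _).trans (add_le_add (hφ x) h1)

variable {P : Measure Ω} [IsProbabilityMeasure P] {ε : ℤ → Ω → ℝ}

lemma IsIID.memLp_of_bounded (h : IsIID P ε) {φ : (ℕ → ℝ) → ℝ} (hφ : Measurable φ) {K : ℝ}
    (hK : ∀ x, |φ x| ≤ K) (k : ℤ) : MemLp (fun ω => φ (past ε k ω)) 2 P :=
  MemLp.of_bound (hφ.comp (measurable_past h.meas k)).aestronglyMeasurable K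
    (ae_of_all _ fun _ => hK _)

/-- Square integrable functions of the past are approximated by bounded functions of finitely
many innovations. -/
lemma IsIID.exists_dependsOn_l2norm_sub_le (h : IsIID P ε) {φ : (ℕ → ℝ) → ℝ} (hφ : Measurable φ)
    (hφ2 : MemLp (fun ω => φ (past ε 0 ω)) 2 P) {δ : ℝ} (hδ : 0 < δ) :
    ∃ (g : (ℕ → ℝ) → ℝ) (L : ℕ) (K : ℝ), Measurable g ∧ (∀ x, |g x| ≤ K) ∧
      DependsOn g (Set.Iic L) ∧
      l2norm P (fun ω => φ (past ε 0 ω) - g (past ε 0 ω)) ≤ δ := by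
  have hpm := measurable_past h.meas 0
  set π := P.map (past ε 0) with hπ
  have : IsProbabilityMeasure π := Measure.isProbabilityMeasure_map hpm.aemeasurable
  have hφπ : MemLp φ 2 π :=
    (memLp_map_measure_iff hφ.aestronglyMeasurable hpm.aemeasurable).2 hφ2
  obtain ⟨f, hf, -⟩ := hφπ.exists_boundedContinuous_eLpNorm_sub_le (by simp)
    (ε := ENNReal.ofReal (δ / 2)) (by simpa using hδ)
  have hfb : ∀ x, |f x| ≤ ‖f‖ := fun x => f.norm_coe_le_norm x
  have hfm : Measurable f := f.continuous.measurable
  have hgm : ∀ L, Measurable fun x => f (truncSeq L x) := fun L =>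
    hfm.comp (continuous_truncSeq L).measurable
  have h1 : l2norm P (fun ω => φ (past ε 0 ω) - f (past ε 0 ω)) ≤ δ / 2 := by
    have e : eLpNorm (fun ω => φ (past ε 0 ω) - f (past ε 0 ω)) 2 P = eLpNorm (φ - ⇑f) 2 π := by
      rw [hπ, eLpNorm_map_measure (hφ.sub hfm).aestronglyMeasurable hpm.aemeasurable]
      rfl
    rw [l2norm, e]
    exact ENNReal.toReal_le_of_le_ofReal (by positivity) hf
  have hmem : ∀ L, MemLp (fun ω => f (past ε 0 ω) - f (truncSeq L (past ε 0 ω))) 2 P := fun L =>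
    (h.memLp_of_bounded hfm hfb 0).sub
      (h.memLp_of_bounded (φ := fun x => f (truncSeq L x)) (hgm L) (fun x => hfb _) 0)
  -- Truncations converge coordinatewise and `f` is continuous for the product topology, so bounded
  -- convergence applies. This is why `f` was taken continuous.
  have h2 : Tendsto (fun L : ℕ => ∫ ω, (f (past ε 0 ω) - f (truncSeq L (past ε 0 ω))) ^ 2 ∂P)
      atTop (𝓝 (∫ _, (0 : ℝ) ∂P)) := by
    refine tendsto_integral_of_dominated_convergence (fun _ => (2 * ‖f‖) ^ 2)
      (fun L => ((hmem L).1.pow 2)) (integrable_const _) (fun L => ae_of_all _ fun ω => ?_)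
      (ae_of_all _ fun ω => ?_)
    · rw [norm_pow]
      refine pow_le_pow_left₀ (norm_nonneg _) ?_ 2
      rw [two_mul]
      exact (norm_sub_le _ _).trans (add_le_add (hfb _) (hfb _))
    · have := (f.continuous.tendsto _).comp (tendsto_truncSeq (past ε 0 ω))
      have := (tendsto_const_nhds (x := f (past ε 0 ω))).sub this
      have := this.pow 2
      simpa using this
  rw [integral_zero] at h2
  obtain ⟨L, hL⟩ := (h2.eventually (gt_mem_nhds (show (0 : ℝ) < (δ / 2) ^ 2 by positivity))).exists
  refine ⟨fun x => f (truncSeq L x), L, ‖f‖, hgm L, fun x => hfb _, dependsOn_comp_truncSeq f L, ?_⟩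
  have h3 : l2norm P (fun ω => f (past ε 0 ω) - f (truncSeq L (past ε 0 ω))) ≤ δ / 2 := by
    rw [← l2norm_sq (hmem L)] at hL
    exact (lt_of_pow_lt_pow_left₀ 2 (by positivity) hL).le
  have h4 := l2norm_add_le (hφ2.sub (h.memLp_of_bounded hfm hfb 0)) (hmem L)
  simp only [sub_add_sub_cancel, Pi.sub_apply] at h4
  exact h4.trans ((add_le_add h1 h3).trans (add_halves δ).le)

end FiniteWindow

/-! ### The projection decomposition of the process. -/

section Decomposition

variable {Ω : Type*} [mΩ : MeasurableSpace Ω] {P : Measure Ω} [IsProbabilityMeasure P]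
  {ε : ℤ → Ω → ℝ} {G : (ℕ → ℝ) → ℝ}

lemma IsIID.iterate_transition (h : IsIID P ε) (hG : Measurable G)
    (hG2 : ∀ k, MemLp (fun ω => G (past ε k ω)) 2 P) (i : ℕ) :
    Measurable ((transition P ε)^[i] G) ∧
      ∀ k, MemLp (fun ω => (transition P ε)^[i] G (past ε k ω)) 2 P := by
  induction i with
  | zero => exact ⟨hG, hG2⟩
  | succ i ih =>
    simp only [Function.iterate_succ_apply']
    exact ⟨measurable_transition ih.1, h.memLp_transition ih.1 ih.2⟩

/-- Tower property: each further step into the past averages out one more innovation. -/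
lemma IsIID.condExp_iterate (h : IsIID P ε) (hG : Measurable G)
    (hG2 : ∀ k, MemLp (fun ω => G (past ε k ω)) 2 P) (k : ℤ) (i : ℕ) :
    P[fun ω => G (past ε k ω) | pastSigma ε (k - i)]
      =ᵐ[P] fun ω => (transition P ε)^[i] G (past ε (k - i) ω) := by
  induction i with
  | zero =>
    simp only [Nat.cast_zero, sub_zero, Function.iterate_zero, id]
    have hm : StronglyMeasurable[pastSigma ε k] fun ω => G (past ε k ω) := by
      refine (hG.comp ?_).stronglyMeasurable
      rw [pastSigma_eq_comap]
      exact comap_measurable _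
    rw [condExp_of_stronglyMeasurable (pastSigma_le h.meas k) hm
      ((hG2 k).integrable one_le_two)]
  | succ i ih =>
    obtain ⟨m1, m2⟩ := h.iterate_transition hG hG2 i
    have hk : k - ((i + 1 : ℕ) : ℤ) = k - i - 1 := by push_cast; ring
    rw [hk]
    simp only [Function.iterate_succ_apply']
    have t1 := condExp_condExp_of_le (μ := P) (f := fun ω => G (past ε k ω))
      (pastSigma_mono ε (show k - (i : ℤ) - 1 ≤ k - i by omega)) (pastSigma_le h.meas (k - i))
    exact t1.symm.trans ((condExp_congr_ae ih).trans
      (h.condExp_comp_past m1 (k - i) ((m2 _).integrable one_le_two)))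

/-- The function `H_i` with `𝓟_k X_{k+i} = H_i(ε_k, ε_{k-1}, …)`. -/
noncomputable def mdPart (P : Measure Ω) (ε : ℤ → Ω → ℝ) (G : (ℕ → ℝ) → ℝ) (i : ℕ) :
    (ℕ → ℝ) → ℝ :=
  center P ε ((transition P ε)^[i] G)

lemma IsIID.isMDiff_mdPart (h : IsIID P ε) (hG : Measurable G)
    (hG2 : ∀ k, MemLp (fun ω => G (past ε k ω)) 2 P) (i : ℕ) : IsMDiff P ε (mdPart P ε G i) :=
  h.isMDiff_center (h.iterate_transition hG hG2 i).1 (h.iterate_transition hG hG2 i).2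

lemma mdPart_past (P : Measure Ω) (ε : ℤ → Ω → ℝ) (G : (ℕ → ℝ) → ℝ) (i : ℕ) (k : ℤ) (ω : Ω) :
    mdPart P ε G i (past ε (k - i) ω) = (transition P ε)^[i] G (past ε (k - i) ω)
      - (transition P ε)^[i + 1] G (past ε (k - (i + 1 : ℕ)) ω) := by
  rw [mdPart, center, tailSeq_past, Function.iterate_succ_apply']
  congr 3
  push_cast; ring

/-- Telescoping of `E(X_k | 𝓕_{k-i})` in `i`. It holds pointwise, because the iterates are fixed
versions of the conditional expectations. -/
lemma sum_mdPart_Ico (P : Measure Ω) (ε : ℤ → Ω → ℝ) (G : (ℕ → ℝ) → ℝ) {A M : ℕ} (hAM : A ≤ M)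
    (k : ℤ) (ω : Ω) :
    (transition P ε)^[A] G (past ε (k - A) ω)
      = ∑ i ∈ Finset.Ico A M, mdPart P ε G i (past ε (k - i) ω)
        + (transition P ε)^[M] G (past ε (k - M) ω) := by
  simp_rw [mdPart_past]
  rw [← neg_inj, neg_add, ← Finset.sum_neg_distrib]
  simp_rw [neg_sub]
  rw [Finset.sum_Ico_sub (fun i : ℕ => (transition P ε)^[i] G (past ε (k - i) ω)) hAM]
  ring

lemma IsIID.proj_eq_mdPart (h : IsIID P ε) (hG : Measurable G)
    (hG2 : ∀ k, MemLp (fun ω => G (past ε k ω)) 2 P) (i : ℕ) :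
    proj P ε 0 (fun ω => G (past ε i ω)) =ᵐ[P] fun ω => mdPart P ε G i (past ε 0 ω) := by
  have h1 := h.condExp_iterate hG hG2 i i
  have h2 := h.condExp_iterate hG hG2 i (i + 1)
  have e1 : (i : ℤ) - (i : ℕ) = 0 := sub_self _
  have e2 : (i : ℤ) - (i + 1 : ℕ) = 0 - 1 := by push_cast; ring
  rw [e1] at h1
  rw [e2] at h2
  filter_upwards [h1, h2] with ω w1 w2
  have := mdPart_past P ε G i i ω
  rw [e1, e2] at this
  rw [this, proj, Pi.sub_apply, w1, w2]

/-- Triviality of the tail: `E(X_0 | 𝓕_{-i}) → 0` in `L²`. -/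
lemma IsIID.tendsto_l2norm_iterate (h : IsIID P ε) (hG : Measurable G)
    (hG2 : ∀ k, MemLp (fun ω => G (past ε k ω)) 2 P) (hG0 : ∫ ω, G (past ε 0 ω) ∂P = 0) :
    Tendsto (fun i => l2norm P fun ω => (transition P ε)^[i] G (past ε 0 ω)) atTop (𝓝 0) := by
  rw [Metric.tendsto_atTop]
  intro δ hδ
  obtain ⟨g, L, K, hg, hgK, hgL, hgd⟩ :=
    h.exists_dependsOn_l2norm_sub_le hG (hG2 0) (show 0 < δ / 3 by positivity)
  refine ⟨L + 1, fun i hi => ?_⟩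
  rw [Real.dist_eq, sub_zero, abs_of_nonneg (l2norm_nonneg _)]
  have hg2 := h.memLp_of_bounded hg hgK 0
  have hD2 : MemLp (fun ω => G (past ε 0 ω) - g (past ε 0 ω)) 2 P := (hG2 0).sub hg2
  -- For `i > L` the window `[-L, 0]` of `g` is disjoint from `(-∞, -i]`, so conditioning leaves
  -- only the mean.
  have hind : P[fun ω => g (past ε 0 ω) | pastSigma ε (0 - i)]
      =ᵐ[P] fun _ => ∫ ω, g (past ε 0 ω) ∂P := by
    have hS : Disjoint (Set.Icc (-(L : ℤ)) 0) (Set.Iic (0 - (i : ℤ))) := by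
      rw [Set.disjoint_left]
      intro j hj hj'
      simp only [Set.mem_Icc, Set.mem_Iic] at hj hj'
      omega
    have hI := h.indep_sigma hS
    rw [← pastSigma_eq_biSup] at hI
    refine condExp_indep_eq (iSup₂_le fun j _ => (h.meas j).comap_le) (pastSigma_le h.meas _)
      (measurable_comp_past_of_dependsOn hg hgL 0 fun j h1 h2 => ?_).stronglyMeasurable hI
    simp only [Set.mem_Icc]
    exact ⟨by omega, h2⟩
  have hsub := condExp_sub ((hG2 0).integrable one_le_two) (hg2.integrable one_le_two)
    (pastSigma ε (0 - (i : ℤ)))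
  have hcond := h.condExp_iterate hG hG2 0 i
  have key : (fun ω => (transition P ε)^[i] G (past ε (0 - i) ω)) =ᵐ[P] fun ω =>
      (P[fun ω => G (past ε 0 ω) - g (past ε 0 ω) | pastSigma ε (0 - i)]) ω
        + ∫ ω, g (past ε 0 ω) ∂P := by
    filter_upwards [hind, hsub, hcond] with ω h1 h2 h3
    have h4 : (P[fun ω => G (past ε 0 ω) - g (past ε 0 ω) | pastSigma ε (0 - i)]) ω
      = (transition P ε)^[i] G (past ε (0 - i) ω) - ∫ ω, g (past ε 0 ω) ∂P := by
      rw [← h3, ← h1]; exact h2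
    rw [h4]; ring
  have hmean : |∫ ω, g (past ε 0 ω) ∂P| ≤ δ / 3 := by
    have : ∫ ω, g (past ε 0 ω) ∂P = - ∫ ω, (G (past ε 0 ω) - g (past ε 0 ω)) ∂P := by
      rw [integral_sub ((hG2 0).integrable one_le_two) (hg2.integrable one_le_two), hG0]; ring
    rw [this, abs_neg]
    exact (abs_integral_le_integral_abs).trans ((integral_le_l2norm hD2).trans hgd)
  have hconst : l2norm P (fun _ => ∫ ω, g (past ε 0 ω) ∂P) = |∫ ω, g (past ε 0 ω) ∂P| := by
    have := l2norm_sq (P := P) (memLp_const (p := 2) (∫ ω, g (past ε 0 ω) ∂P))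
    simp only [integral_const, probReal_univ, one_smul] at this
    rw [← abs_of_nonneg (l2norm_nonneg (P := P) fun _ => ∫ ω, g (past ε 0 ω) ∂P)]
    exact (sq_eq_sq_iff_abs_eq_abs _ _).1 this
  rw [h.l2norm_comp_past (h.iterate_transition hG hG2 i).1 0 (0 - i), l2norm_congr key]
  refine (l2norm_add_le (hD2.condExp one_le_two) (memLp_const _)).trans_lt ?_
  have := l2norm_condExp_le (m := pastSigma ε (0 - (i : ℤ))) hD2
  rw [hconst]
  linarith

end Decomposition

/-! ### Uniform approximation by finite-window processes. -/

section Approximation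

variable {Ω : Type*} [mΩ : MeasurableSpace Ω] {P : Measure Ω} {ε : ℤ → Ω → ℝ} {G : (ℕ → ℝ) → ℝ}

/-- The `L²` norm `‖𝓟_0 X_i‖`. -/
noncomputable def projNorm (P : Measure Ω) (ε : ℤ → Ω → ℝ) (G : (ℕ → ℝ) → ℝ) (i : ℕ) : ℝ :=
  l2norm P fun ω => mdPart P ε G i (past ε 0 ω)

lemma projNorm_nonneg (i : ℕ) : 0 ≤ projNorm P ε G i := l2norm_nonneg _

lemma integrable_fun_mul {f g : Ω → ℝ} (hf : MemLp f 2 P) (hg : MemLp g 2 P) :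
    Integrable (fun ω => f ω * g ω) P :=
  hf.integrable_mul hg

variable [IsProbabilityMeasure P]

/-- Linear combinations of the remainders `E(X_k | 𝓕_{k-A})` are controlled by the tail of
`∑ ‖𝓟_0 X_i‖`. -/
lemma IsIID.l2norm_sum_iterate_le (h : IsIID P ε) (hG : Measurable G)
    (hG2 : ∀ k, MemLp (fun ω => G (past ε k ω)) 2 P) (hG0 : ∫ ω, G (past ε 0 ω) ∂P = 0)
    (hsum : Summable (projNorm P ε G)) (A : ℕ) (s : Finset ℤ) (c : ℤ → ℝ) :
    l2norm P (fun ω => ∑ k ∈ s, c k * (transition P ε)^[A] G (past ε (k - A) ω))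
      ≤ (∑' i, projNorm P ε G (i + A)) * √(∑ k ∈ s, c k ^ 2) := by
  set q : ℕ → ℝ := fun M => l2norm P fun ω => (transition P ε)^[M] G (past ε 0 ω) with hq
  -- The remainder at lag `M` is bounded only by the triangle inequality, which ignores
  -- orthogonality. This is harmless because `s` and `c` are fixed while `M → ∞`.
  have hlim : Tendsto (fun M => (∑' i, projNorm P ε G (i + A)) * √(∑ k ∈ s, c k ^ 2)
      + ∑ k ∈ s, |c k| * q M) atTop
      (𝓝 ((∑' i, projNorm P ε G (i + A)) * √(∑ k ∈ s, c k ^ 2) + ∑ k ∈ s, |c k| * 0)) :=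
    tendsto_const_nhds.add (tendsto_finsetSum _ fun k _ =>
      (h.tendsto_l2norm_iterate hG hG2 hG0).const_mul _)
  simp only [mul_zero, Finset.sum_const_zero, add_zero] at hlim
  refine ge_of_tendsto hlim ?_
  filter_upwards [eventually_ge_atTop A] with M hM
  have hH := fun i => h.isMDiff_mdPart hG hG2 i
  have hcomb : ∀ i : ℕ, MemLp (fun ω => ∑ k ∈ s, c k * mdPart P ε G i (past ε (k - i) ω)) 2 P :=
    fun i => memLp_finsetSum _ fun k _ => ((hH i).memLp _).const_mul _
  have hR2 := (h.iterate_transition hG hG2 M).2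
  have hRem : ∀ k : ℤ, MemLp (fun ω => c k * (transition P ε)^[M] G (past ε (k - M) ω)) 2 P :=
    fun k => (hR2 _).const_mul _
  have hsplit : (fun ω => ∑ k ∈ s, c k * (transition P ε)^[A] G (past ε (k - A) ω))
      = fun ω => ∑ i ∈ Finset.Ico A M, ∑ k ∈ s, c k * mdPart P ε G i (past ε (k - i) ω)
        + ∑ k ∈ s, c k * (transition P ε)^[M] G (past ε (k - M) ω) := by
    funext ω
    rw [Finset.sum_comm, ← Finset.sum_add_distrib]
    refine Finset.sum_congr rfl fun k _ => ?_
    rw [sum_mdPart_Ico P ε G hM, mul_add, Finset.mul_sum]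
  rw [hsplit]
  refine (l2norm_add_le (memLp_finsetSum _ fun i _ => hcomb i)
    (memLp_finsetSum _ fun k _ => hRem k)).trans (add_le_add ?_ ?_)
  · refine (l2norm_sum_le _ hcomb).trans ?_
    simp_rw [fun i : ℕ => (hH i).l2norm_sum h s c i]
    rw [← Finset.sum_mul]
    refine mul_le_mul_of_nonneg_right ?_ (Real.sqrt_nonneg _)
    rw [Finset.sum_Ico_eq_sum_range]
    simp_rw [add_comm A]
    exact Summable.sum_le_tsum _ (fun i _ => projNorm_nonneg _)
      ((summable_nat_add_iff A).2 hsum)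
  · refine (l2norm_sum_le _ hRem).trans (Finset.sum_le_sum fun k _ => ?_)
    rw [l2norm_const_mul, h.l2norm_comp_past (h.iterate_transition hG hG2 M).1 _ 0]

/-- The process is approximated, uniformly over linear combinations with normalized coefficients,
by a bounded mean zero function of finitely many innovations. -/
theorem IsIID.exists_finiteWindow_approx (h : IsIID P ε) (hG : Measurable G)
    (hG2 : ∀ k, MemLp (fun ω => G (past ε k ω)) 2 P) (hG0 : ∫ ω, G (past ε 0 ω) ∂P = 0)
    (hsum : Summable (projNorm P ε G)) {δ : ℝ} (hδ : 0 < δ) :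
    ∃ (g : (ℕ → ℝ) → ℝ) (L : ℕ) (K : ℝ), Measurable g ∧ (∀ x, |g x| ≤ K) ∧
      DependsOn g (Set.Iic L) ∧ (∀ k, ∫ ω, g (past ε k ω) ∂P = 0) ∧
      ∀ (s : Finset ℤ) (c : ℤ → ℝ),
        l2norm P (fun ω => ∑ k ∈ s, c k * (G (past ε k ω) - g (past ε k ω)))
          ≤ δ * √(∑ k ∈ s, c k ^ 2) := by
  obtain ⟨A, hA⟩ := ((tendsto_sum_nat_add (projNorm P ε G)).eventually
    (gt_mem_nhds (half_pos hδ))).exists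
  have hH := fun i => h.isMDiff_mdPart hG hG2 i
  -- There are `A` lags and centering doubles each error, so the total is at most `δ/2`. The tail of
  -- lags beyond `A` takes the other half.
  have hδA : 0 < δ / (4 * (A + 1)) := by positivity
  choose f L K hf hfK hfL hfd using fun i =>
    h.exists_dependsOn_l2norm_sub_le (hH i).meas ((hH i).memLp 0) hδA
  have hf2 := fun i => h.memLp_of_bounded (hf i) (hfK i)
  have hF := fun i => h.isMDiff_center (hf i) (hf2 i)
  have htail : ∀ i : ℕ, Measurable (tailSeq^[i]) := fun i => measurable_tailSeq.iterate i
  -- Centering before summing makes every lag's error a martingale difference, so it scales with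
  -- `√(∑ c_k²)` and not with `∑ |c_k|`. The window length is a crude sum bounding every `L i + i`.
  refine ⟨fun x => ∑ i ∈ Finset.range A, center P ε (f i) (tailSeq^[i] x),
    ∑ i ∈ Finset.range A, (L i + i), ∑ i ∈ Finset.range A, 2 * K i,
    Finset.measurable_fun_sum _ fun i _ => (hF i).meas.comp (htail i), fun x =>
      (Finset.abs_sum_le_sum_abs _ _).trans (Finset.sum_le_sum fun i _ =>
        abs_center_le (h.meas 0) (hfK i) _), ?_, fun k => ?_, fun s c => ?_⟩
  · intro x y hxy
    refine Finset.sum_congr rfl fun i hi => dependsOn_center (hfL i) fun j hj => ?_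
    have hit : ∀ (i j : ℕ) (z : ℕ → ℝ), tailSeq^[i] z j = z (j + i) := by
      intro i
      induction i with
      | zero => intro j z; rfl
      | succ i ih =>
        intro j z
        rw [Function.iterate_succ_apply, ih]
        rfl
    rw [hit, hit]
    refine hxy _ ?_
    have h1 : j ≤ L i := hj
    have h2 := Finset.single_le_sum (f := fun i => L i + i) (fun i _ => Nat.zero_le _) hi
    simp only [Set.mem_Iic]
    omega
  · simp only [tailSeq_iterate_past]
    rw [integral_finsetSum _ fun i _ => ((hF i).memLp _).integrable one_le_two]
    refine Finset.sum_eq_zero fun i _ => ?_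
    rw [← integral_condExp (pastSigma_le h.meas (k - i - 1)),
      integral_congr_ae ((hF i).condExp (k - i))]
    simp
  · simp only [tailSeq_iterate_past]
    have hD := fun i => (hH i).sub (hF i)
    have hsplit : (fun ω => ∑ k ∈ s, c k * (G (past ε k ω)
          - ∑ i ∈ Finset.range A, center P ε (f i) (past ε (k - i) ω)))
        = fun ω => ∑ i ∈ Finset.range A, ∑ k ∈ s, c k * (mdPart P ε G i (past ε (k - i) ω)
            - center P ε (f i) (past ε (k - i) ω))
          + ∑ k ∈ s, c k * (transition P ε)^[A] G (past ε (k - A) ω) := by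
      funext ω
      rw [Finset.sum_comm, ← Finset.sum_add_distrib]
      refine Finset.sum_congr rfl fun k _ => ?_
      have := sum_mdPart_Ico P ε G (Nat.zero_le A) k ω
      simp only [Function.iterate_zero, id, Nat.cast_zero, sub_zero, Nat.Ico_zero_eq_range] at this
      rw [this, ← Finset.mul_sum, Finset.sum_sub_distrib]
      ring
    have hcomb : ∀ i : ℕ, MemLp (fun ω => ∑ k ∈ s, c k * (mdPart P ε G i (past ε (k - i) ω)
        - center P ε (f i) (past ε (k - i) ω))) 2 P :=
      fun i => memLp_finsetSum _ fun k _ => ((hD i).memLp _).const_mul _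
    rw [hsplit]
    refine (l2norm_add_le (memLp_finsetSum _ fun i _ => hcomb i) (memLp_finsetSum _ fun k _ =>
      ((h.iterate_transition hG hG2 A).2 _).const_mul _)).trans ?_
    have b1 := h.l2norm_sum_iterate_le hG hG2 hG0 hsum A s c
    have b2 := l2norm_sum_le (Finset.range A) hcomb
    simp_rw [fun i : ℕ => (hD i).l2norm_sum h s c i, ← Finset.sum_mul] at b2
    have b3 : ∑ i ∈ Finset.range A, l2norm P (fun ω => mdPart P ε G i (past ε 0 ω)
        - center P ε (f i) (past ε 0 ω)) ≤ δ / 2 := by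
      refine (Finset.sum_le_card_nsmul _ _ (2 * (δ / (4 * (A + 1)))) fun i _ => ?_).trans ?_
      · refine ((hH i).l2norm_sub_center_le h (hf i) (hf2 i)).trans ?_
        have := hfd i
        gcongr
      · rw [Finset.card_range, nsmul_eq_mul]
        have hA0 : (0 : ℝ) < A + 1 := by positivity
        rw [show (A : ℝ) * (2 * (δ / (4 * (A + 1)))) = (A / (A + 1)) * (δ / 2) by
          field_simp; norm_num]
        exact mul_le_of_le_one_left (by positivity) ((div_le_one hA0).2 (by linarith))
    have hs := Real.sqrt_nonneg (∑ k ∈ s, c k ^ 2)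
    have b4 := mul_le_mul_of_nonneg_right b3 hs
    have b5 := mul_le_mul_of_nonneg_right hA.le hs
    linarith

end Approximation

/-! ### Stationary covariances and their summability. -/

section Covariance

variable {Ω : Type*} [mΩ : MeasurableSpace Ω] {P : Measure Ω} [IsProbabilityMeasure P]
  {ε : ℤ → Ω → ℝ} {G : (ℕ → ℝ) → ℝ}

lemma IsIID.integral_mul_comp_past (h : IsIID P ε) (hG : Measurable G) (a b : ℤ) :
    ∫ ω, G (past ε a ω) * G (past ε b ω) ∂P
      = covariance P (fun n ω => G (past ε n ω)) (a - b) := by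
  have key : ∀ (k l : ℤ) (n : ℕ), ∫ ω, G (past ε k ω) * G (past ε (k - n) ω) ∂P
      = ∫ ω, G (past ε l ω) * G (past ε (l - n) ω) ∂P := by
    intro k l n
    have := h.integral_comp_past (φ := fun x => G x * G (tailSeq^[n] x))
      (hG.mul (hG.comp (measurable_tailSeq.iterate n))) k l
    simpa only [tailSeq_iterate_past] using this
  rw [covariance]
  rcases le_total a b with hab | hab
  · obtain ⟨n, hn⟩ := Int.eq_ofNat_of_zero_le (sub_nonneg.2 hab)
    have := key b 0 n
    rw [show b - (n : ℤ) = a by omega, show (0 : ℤ) - n = a - b by omega] at this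
    simp_rw [mul_comm (G (past ε a _))]
    exact this
  · obtain ⟨n, hn⟩ := Int.eq_ofNat_of_zero_le (sub_nonneg.2 hab)
    have := key a n n
    rw [show a - (n : ℤ) = b by omega, sub_self] at this
    rw [this, hn]
    simp_rw [mul_comm (G (past ε (n : ℤ) _))]

lemma IsIID.covariance_neg (h : IsIID P ε) (hG : Measurable G) (k : ℤ) :
    covariance P (fun n ω => G (past ε n ω)) (-k)
      = covariance P (fun n ω => G (past ε n ω)) k := by
  rw [show -k = 0 - k by ring, ← h.integral_mul_comp_past hG 0 k]
  rfl

/-- Expand `X_0` into its projections at times `-i`. By orthogonality each meets only the projection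
of `X_k` at the same time, which has lag `i + k`; then use Cauchy–Schwarz. -/
lemma IsIID.abs_covariance_le (h : IsIID P ε) (hG : Measurable G)
    (hG2 : ∀ k, MemLp (fun ω => G (past ε k ω)) 2 P) (hG0 : ∫ ω, G (past ε 0 ω) ∂P = 0) (k : ℕ)
    (hsum : Summable fun i => projNorm P ε G i * projNorm P ε G (i + k)) :
    |covariance P (fun n ω => G (past ε n ω)) k|
      ≤ ∑' i, projNorm P ε G i * projNorm P ε G (i + k) := by
  have hH := fun i => h.isMDiff_mdPart hG hG2 i
  have hterm : ∀ i : ℕ, |∫ ω, mdPart P ε G i (past ε (0 - i) ω) * G (past ε k ω) ∂P|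
      ≤ projNorm P ε G i * projNorm P ε G (i + k) := by
    intro i
    have hX : (fun ω => mdPart P ε G i (past ε (0 - i) ω) * G (past ε k ω)) = fun ω =>
        ∑ j ∈ Finset.range (i + k + 1),
          mdPart P ε G i (past ε (0 - i) ω) * mdPart P ε G j (past ε (k - j) ω)
        -- Stopping at lag `i + k + 1` puts the remainder at time `-i - 1`, just before the
        -- projection at `-i`, which is therefore orthogonal to it.
        + (transition P ε)^[i + k + 1] G (past ε (k - (i + k + 1 : ℕ)) ω)
          * mdPart P ε G i (past ε (0 - i) ω) := by
      funext ω
      have := sum_mdPart_Ico P ε G (Nat.zero_le (i + k + 1)) k ω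
      simp only [Function.iterate_zero, id, Nat.cast_zero, sub_zero, Nat.Ico_zero_eq_range] at this
      rw [this, mul_add, Finset.mul_sum]
      ring
    obtain ⟨m1, m2⟩ := h.iterate_transition hG hG2 (i + k + 1)
    rw [hX, integral_add (integrable_finsetSum _ fun j _ =>
      integrable_fun_mul ((hH i).memLp _) ((hH j).memLp _)) (integrable_fun_mul (m2 _) ((hH i).memLp _)),
      (hH i).integral_mul_eq_zero h m1 m2 (by push_cast; omega), add_zero,
      integral_finsetSum _ fun j _ => integrable_fun_mul ((hH i).memLp _) ((hH j).memLp _),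
      Finset.sum_range_succ, Finset.sum_eq_zero, zero_add]
    · refine (abs_integral_mul_le_l2norm ((hH i).memLp _) ((hH (i + k)).memLp _)).trans_eq ?_
      rw [h.l2norm_comp_past (hH i).meas _ 0, h.l2norm_comp_past (hH (i + k)).meas _ 0]
      rfl
    · intro j hj
      have hj' := Finset.mem_range.1 hj
      exact (hH j).integral_mul_eq_zero h (hH i).meas (hH i).memLp (by omega)
  have hlim : Tendsto (fun M : ℕ => ∑' i, projNorm P ε G i * projNorm P ε G (i + k)
      + (l2norm P fun ω => (transition P ε)^[M] G (past ε 0 ω))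
        * l2norm P fun ω => G (past ε k ω)) atTop
      (𝓝 (∑' i, projNorm P ε G i * projNorm P ε G (i + k)
        + 0 * l2norm P fun ω => G (past ε k ω))) :=
    tendsto_const_nhds.add ((h.tendsto_l2norm_iterate hG hG2 hG0).mul_const _)
  rw [zero_mul, add_zero] at hlim
  refine ge_of_tendsto' hlim fun M => ?_
  obtain ⟨m1, m2⟩ := h.iterate_transition hG hG2 M
  have hX : (fun ω => G (past ε 0 ω) * G (past ε k ω)) = fun ω =>
      ∑ i ∈ Finset.range M, mdPart P ε G i (past ε (0 - i) ω) * G (past ε k ω)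
      + (transition P ε)^[M] G (past ε (0 - M) ω) * G (past ε k ω) := by
    funext ω
    have := sum_mdPart_Ico P ε G (Nat.zero_le M) 0 ω
    simp only [Function.iterate_zero, id, Nat.cast_zero, sub_zero, Nat.Ico_zero_eq_range] at this
    rw [this, add_mul, Finset.sum_mul]
  rw [covariance, hX, integral_add (integrable_finsetSum _ fun i _ =>
      integrable_fun_mul ((hH i).memLp _) (hG2 k)) (integrable_fun_mul (m2 _) (hG2 k)),
    integral_finsetSum _ fun i _ => integrable_fun_mul ((hH i).memLp _) (hG2 k)]
  refine (abs_add_le _ _).trans (add_le_add ?_ ?_)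
  · refine (Finset.abs_sum_le_sum_abs _ _).trans ((Finset.sum_le_sum fun i _ => hterm i).trans ?_)
    exact hsum.sum_le_tsum _ fun i _ => mul_nonneg (projNorm_nonneg _) (projNorm_nonneg _)
  · refine (abs_integral_mul_le_l2norm (m2 _) (hG2 k)).trans_eq ?_
    rw [h.l2norm_comp_past m1 _ 0]

/-- The covariances are absolutely summable. -/
theorem IsIID.summable_covariance (h : IsIID P ε) (hG : Measurable G)
    (hG2 : ∀ k, MemLp (fun ω => G (past ε k ω)) 2 P) (hG0 : ∫ ω, G (past ε 0 ω) ∂P = 0)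
    (hsum : Summable (projNorm P ε G)) :
    Summable fun k : ℤ => |covariance P (fun n ω => G (past ε n ω)) k| := by
  have hprod : Summable fun x : ℕ × ℕ => projNorm P ε G x.1 * projNorm P ε G x.2 :=
    hsum.mul_of_nonneg hsum (fun i => projNorm_nonneg i) fun i => projNorm_nonneg i
  -- Reindexing by (covariance lag, `i`) makes the double sum of bounds a subsum of the square of `∑
  -- ‖𝓟_0 X_i‖`.
  have hinj : Function.Injective fun x : ℕ × ℕ => (x.2, x.2 + x.1) := by
    rintro ⟨a, b⟩ ⟨c, d⟩ hx
    simp only [Prod.mk.injEq] at hx ⊢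
    omega
  have hp2 := hprod.comp_injective hinj
  have hnat : Summable fun k : ℕ => |covariance P (fun n ω => G (past ε n ω)) k| :=
    Summable.of_nonneg_of_le (fun k => abs_nonneg _) (fun k =>
      h.abs_covariance_le hG hG2 hG0 k (hp2.prod_factor k)) hp2.prod
  refine Summable.of_nat_of_neg hnat ?_
  simpa only [h.covariance_neg hG] using hnat

lemma IsIID.summable_projNorm (h : IsIID P ε) (hG : Measurable G)
    (hG2 : ∀ k, MemLp (fun ω => G (past ε k ω)) 2 P)
    (hκ : kappa P ε (fun n ω => G (past ε n ω)) < ⊤) : Summable (projNorm P ε G) := by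
  have : ∀ i : ℕ, (eLpNorm (proj P ε 0 fun ω => G (past ε i ω)) 2 P).toReal
      = projNorm P ε G i := fun i => l2norm_congr (h.proj_eq_mdPart hG hG2 i)
  have h2 := ENNReal.summable_toReal hκ.ne
  simpa only [this] using h2

end Covariance

/-! ### The uniform central limit theorem for linear combinations. -/

/-- Compares Gaussian characteristic functions through standard deviations, so an `L²` approximation
suffices even for vanishing variances. -/
lemma abs_exp_neg_sq_sub_le (u v : ℝ) :
    |Real.exp (-u ^ 2 / 2) - Real.exp (-v ^ 2 / 2)| ≤ |u - v| := by
  have hd : ∀ x : ℝ, HasDerivAt (fun x : ℝ => Real.exp (-x ^ 2 / 2))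
      (Real.exp (-x ^ 2 / 2) * -x) x := by
    intro x
    have h1 : HasDerivAt (fun x : ℝ => -x ^ 2 / 2) (-x) x :=
      (((hasDerivAt_id x).pow 2).neg.div_const 2).congr_deriv (by simp; ring)
    exact h1.exp
  have hb : ∀ x : ℝ, ‖Real.exp (-x ^ 2 / 2) * -x‖ ≤ 1 := by
    intro x
    rw [norm_mul, norm_neg, Real.norm_of_nonneg (Real.exp_pos _).le, Real.norm_eq_abs, neg_div,
      Real.exp_neg, inv_mul_le_iff₀ (Real.exp_pos _), mul_one]
    have h1 := Real.add_one_le_exp (x ^ 2 / 2)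
    nlinarith [sq_nonneg (|x| - 1), sq_abs x]
  have := convex_univ.norm_image_sub_le_of_norm_hasDerivWithin_le
    (fun x _ => (hd x).hasDerivWithinAt) (fun x _ => hb x) (Set.mem_univ v) (Set.mem_univ u)
  simpa using this

section LinearCombinations

variable {Ω : Type*} [mΩ : MeasurableSpace Ω] {P : Measure Ω}

lemma indepFun_of_measurable {m₁ m₂ : MeasurableSpace Ω} (hI : Indep m₁ m₂ P) {f g : Ω → ℝ}
    (hf : Measurable[m₁] f) (hg : Measurable[m₂] g) : IndepFun f g P := by
  rw [IndepFun_iff_Indep]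
  exact indep_of_indep_of_le_left (indep_of_indep_of_le_right hI hg.comap_le) hf.comap_le

variable [IsProbabilityMeasure P] {ε : ℤ → Ω → ℝ} {G : (ℕ → ℝ) → ℝ}

/-- Quantitative central limit theorem for bounded functions of finitely many innovations. -/
lemma IsIID.norm_charFun_finiteWindow_le (h : IsIID P ε) {g : (ℕ → ℝ) → ℝ} {L : ℕ} {K : ℝ}
    (hg : Measurable g) (hK : ∀ x, |g x| ≤ K) (hL : DependsOn g (Set.Iic L))
    (hmean : ∀ k, ∫ ω, g (past ε k ω) ∂P = 0) (s : Finset ℤ) (c : ℤ → ℝ) {b : ℝ}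
    (hc : ∀ k ∈ s, |c k| ≤ b) :
    ‖∫ ω, Complex.exp (Complex.I * (∑ k ∈ s, c k * g (past ε k ω) : ℝ)) ∂P
      - (Real.exp (-(∫ ω, (∑ k ∈ s, c k * g (past ε k ω)) ^ 2 ∂P) / 2) : ℝ)‖
      ≤ s.card * (4 * (b * K) * ((4 * L + 1) * (b * K)) ^ 2) := by
  have hm : ∀ (S : Set ℤ) (k : ℤ), (∀ j : ℤ, k - L ≤ j → j ≤ k → j ∈ S) →
      Measurable[⨆ j ∈ S, MeasurableSpace.comap (ε j) inferInstance]
        fun ω => c k * g (past ε k ω) := fun S k hS =>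
    (measurable_comp_past_of_dependsOn hg hL k hS).const_mul (c k)
  refine norm_charFun_sum_sub_gaussian_le s (fun k ω => c k * g (past ε k ω))
    (fun k => (hg.comp (measurable_past h.meas k)).const_mul _) (fun k hk ω => ?_)
    -- Term `k` reads `[k-L, k]`, and its product with its neighbourhood sum reads `[k-2L, k+L]`.
    -- Terms at distance more than `L`, respectively `2L`, read none of these innovations.
    (fun k => s.filter fun l => |l - k| ≤ L) (fun k => s.filter fun l => |l - k| ≤ 2 * L)
    (fun k _ l hl => ?_) (fun k _ => Finset.filter_subset _ _) (fun k _ => ?_)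
    (fun k _ => ?_) (fun k _ => ?_) fun k _ => ?_
  · rw [abs_mul]
    exact mul_le_mul (hc k hk) (hK _) (abs_nonneg _) ((abs_nonneg _).trans (hc k hk))
  · simp only [Finset.mem_filter] at hl ⊢
    exact ⟨hl.1, by omega⟩
  · have hsub : (s.filter fun l => |l - k| ≤ 2 * L) ⊆ Finset.Icc (k - 2 * L) (k + 2 * L) := by
      intro l hl
      simp only [Finset.mem_filter, abs_le, Finset.mem_Icc] at hl ⊢
      omega
    have := Finset.card_le_card hsub
    rw [Int.card_Icc] at this
    exact (Nat.cast_le.2 (show _ ≤ 4 * L + 1 by omega)).trans_eq (by push_cast; rfl)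
  · rw [integral_const_mul, hmean, mul_zero]
  · refine indepFun_of_measurable (h.indep_sigma (disjoint_compl_right (a := Set.Icc (k - L : ℤ) k)))
      (hm _ k fun j h1 h2 => ⟨h1, h2⟩) ?_
    refine Finset.measurable_fun_sum _ fun l hl => hm _ l fun j h1 h2 hj => ?_
    simp only [Finset.mem_sdiff, Finset.mem_filter, not_and, not_le, lt_abs] at hl
    have := hl.2 hl.1
    obtain ⟨h3, h4⟩ := hj
    omega
  · refine indepFun_of_measurable
      (h.indep_sigma (disjoint_compl_right (a := Set.Icc (k - 2 * L : ℤ) (k + L))))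
      (Measurable.mul (hm _ k fun j h1 h2 => ⟨by omega, by omega⟩)
        (Finset.measurable_fun_sum _ fun l hl => hm _ l fun j h1 h2 => ?_)) ?_
    · simp only [Finset.mem_filter, abs_le] at hl
      exact ⟨by omega, by omega⟩
    · refine Finset.measurable_fun_sum _ fun l hl => hm _ l fun j h1 h2 hj => ?_
      simp only [Finset.mem_sdiff, Finset.mem_filter, not_and, not_le, lt_abs] at hl
      have := hl.2 hl.1
      obtain ⟨h3, h4⟩ := hj
      omega

/-- Central limit theorem for linear combinations of the process with small coefficients,
uniformly in the coefficients. -/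
theorem IsIID.exists_norm_charFun_le (h : IsIID P ε) (hG : Measurable G)
    (hG2 : ∀ k, MemLp (fun ω => G (past ε k ω)) 2 P) (hG0 : ∫ ω, G (past ε 0 ω) ∂P = 0)
    (hsum : Summable (projNorm P ε G)) {C : ℝ} (hC : 0 ≤ C) {η : ℝ} (hη : 0 < η) :
    ∃ N : ℕ, ∀ n : ℕ, N ≤ n → ∀ (s : Finset ℤ) (c : ℤ → ℝ), s.card ≤ n →
      (∀ k ∈ s, |c k| ≤ C / √n) →
      ‖∫ ω, Complex.exp (Complex.I * (∑ k ∈ s, c k * G (past ε k ω) : ℝ)) ∂P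
        - (Real.exp (-(∫ ω, (∑ k ∈ s, c k * G (past ε k ω)) ^ 2 ∂P) / 2) : ℝ)‖ ≤ η := by
  obtain ⟨g, L, K, hg, hK, hL, hmean, happ⟩ :=
    h.exists_finiteWindow_approx hG hG2 hG0 hsum (show 0 < η / (3 * (C + 1)) by positivity)
  have hK0 : 0 ≤ K := (abs_nonneg _).trans (hK 0)
  -- At most `n` summands, each contributing order `(C/√n)³`. The window `L` and the bound `K` were
  -- fixed before `n`.
  have hlim : Tendsto (fun n : ℕ => 4 * (C * K) * ((4 * L + 1) * (C * K)) ^ 2 * (√n)⁻¹) atTop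
      (𝓝 (4 * (C * K) * ((4 * L + 1) * (C * K)) ^ 2 * 0)) :=
    (tendsto_inv_atTop_zero.comp
      (Real.tendsto_sqrt_atTop.comp tendsto_natCast_atTop_atTop)).const_mul _
  rw [mul_zero] at hlim
  obtain ⟨N, hN⟩ := eventually_atTop.1 ((hlim.eventually (gt_mem_nhds
    (show 0 < η / 3 by positivity))).and (eventually_gt_atTop 0))
  refine ⟨N, fun n hn s c hs hc => ?_⟩
  obtain ⟨hNn, hn0⟩ := hN n hn
  have hn0' : (0 : ℝ) < n := Nat.cast_pos.2 hn0
  have hsq : √(n : ℝ) * √n = n := Real.mul_self_sqrt hn0'.le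
  have hsqpos : 0 < √(n : ℝ) := Real.sqrt_pos.2 hn0'
  set W : Ω → ℝ := fun ω => ∑ k ∈ s, c k * G (past ε k ω) with hW
  set W' : Ω → ℝ := fun ω => ∑ k ∈ s, c k * g (past ε k ω) with hW'
  have hg2 := h.memLp_of_bounded hg hK
  have hW2 : MemLp W 2 P := memLp_finsetSum _ fun k _ => (hG2 k).const_mul _
  have hW2' : MemLp W' 2 P := memLp_finsetSum _ fun k _ => (hg2 k).const_mul _
  have hWm : Measurable W := Finset.measurable_fun_sum _ fun k _ =>
    (hG.comp (measurable_past h.meas k)).const_mul _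
  have hWm' : Measurable W' := Finset.measurable_fun_sum _ fun k _ =>
    (hg.comp (measurable_past h.meas k)).const_mul _
  have hcC : √(∑ k ∈ s, c k ^ 2) ≤ C := by
    rw [Real.sqrt_le_left hC]
    refine (Finset.sum_le_card_nsmul _ _ (C ^ 2 / n) fun k hk => ?_).trans ?_
    · rw [← sq_abs]
      refine (pow_le_pow_left₀ (abs_nonneg _) (hc k hk) 2).trans_eq ?_
      rw [div_pow, Real.sq_sqrt hn0'.le]
    · rw [nsmul_eq_mul, mul_div_assoc', div_le_iff₀ hn0', mul_comm]
      gcongr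
  have hdist : l2norm P (fun ω => W ω - W' ω) ≤ η / 3 := by
    have h1 := happ s c
    simp only [mul_sub, Finset.sum_sub_distrib] at h1
    refine h1.trans ?_
    rw [div_mul_eq_mul_div, div_le_div_iff₀ (by positivity) (by norm_num)]
    nlinarith [mul_le_mul_of_nonneg_left hcC hη.le]
  have hWW : ∀ ω, W ω - W' ω + W' ω = W ω := fun ω => sub_add_cancel _ _
  have hnorm : |l2norm P W - l2norm P W'| ≤ η / 3 := by
    have h1 := l2norm_add_le (hW2.sub hW2') hW2'
    have h2 := l2norm_sub_le hW2 (hW2.sub hW2')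
    simp only [Pi.sub_apply, hWW, sub_sub_cancel] at h1 h2
    have h3 : l2norm P (W - W') ≤ η / 3 := hdist
    have h1' : l2norm P W ≤ l2norm P (W - W') + l2norm P W' := h1
    have h2' : l2norm P W' ≤ l2norm P W + l2norm P (W - W') := h2
    rw [abs_le]
    constructor <;> linarith
  have hexp1 : ∀ x : ℝ, ‖Complex.exp (Complex.I * x)‖ ≤ 1 := fun x => by
    rw [mul_comm, Complex.norm_exp_ofReal_mul_I]
  have hint : ∀ V : Ω → ℝ, Measurable V →
      Integrable (fun ω => Complex.exp (Complex.I * (V ω : ℝ))) P := fun V hV =>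
    Integrable.of_bound (by fun_prop : Measurable _).aestronglyMeasurable 1
      (ae_of_all _ fun ω => hexp1 _)
  have t1 : ‖∫ ω, Complex.exp (Complex.I * (W ω : ℝ)) ∂P
      - ∫ ω, Complex.exp (Complex.I * (W' ω : ℝ)) ∂P‖ ≤ η / 3 := by
    rw [← integral_sub (hint W hWm) (hint W' hWm')]
    refine (norm_integral_le_integral_norm _).trans
      (le_trans ?_ ((integral_le_l2norm (hW2.sub hW2')).trans hdist))
    refine integral_mono_of_nonneg (ae_of_all _ fun ω => norm_nonneg _)
      ((hW2.sub hW2').abs.integrable one_le_two) (ae_of_all _ fun ω => ?_)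
    exact norm_exp_I_sub_exp_I_le _ _
  have t2 : ‖∫ ω, Complex.exp (Complex.I * (W' ω : ℝ)) ∂P
      - (Real.exp (-(∫ ω, W' ω ^ 2 ∂P) / 2) : ℝ)‖ ≤ η / 3 := by
    refine (h.norm_charFun_finiteWindow_le hg hK hL hmean s c hc).trans (le_trans ?_ hNn.le)
    have hle : (s.card : ℝ) ≤ n := Nat.cast_le.2 hs
    refine (mul_le_mul_of_nonneg_right hle (by positivity)).trans_eq ?_
    have e : C / √(n : ℝ) * K = C * K * (√n)⁻¹ := by ring
    rw [e]
    have e2 : (n : ℝ) * ((√n)⁻¹ * (√n)⁻¹) = 1 := by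
      rw [← mul_inv, hsq, mul_inv_cancel₀ hn0'.ne']
    linear_combination (4 * (C * K) * ((4 * L + 1) * (C * K)) ^ 2 * (√(n : ℝ))⁻¹) * e2
  have t3 : ‖((Real.exp (-(∫ ω, W' ω ^ 2 ∂P) / 2) : ℝ) : ℂ)
      - (Real.exp (-(∫ ω, W ω ^ 2 ∂P) / 2) : ℝ)‖ ≤ η / 3 := by
    rw [← Complex.ofReal_sub, Complex.norm_real, ← l2norm_sq hW2, ← l2norm_sq hW2']
    refine (abs_exp_neg_sq_sub_le _ _).trans ?_
    rw [abs_sub_comm]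
    exact hnorm
  calc _ ≤ _ := norm_sub_le_norm_sub_add_norm_sub _ (∫ ω, Complex.exp (Complex.I * (W' ω : ℝ)) ∂P) _
    _ ≤ η / 3 + (η / 3 + η / 3) := add_le_add t1
        ((norm_sub_le_norm_sub_add_norm_sub _ _ _).trans (add_le_add t2 t3))
    _ = η := by ring

end LinearCombinations

/-! ### Exponentials at the Fourier frequencies. -/

lemma sum_Icc_int_eq_sum_range {M : Type*} [AddCommMonoid M] (n : ℕ) (F : ℤ → M) :
    ∑ k ∈ Finset.Icc (1 : ℤ) n, F k = ∑ i ∈ Finset.range n, F (i + 1) := by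
  symm
  refine Finset.sum_nbij' (fun i => (i : ℤ) + 1) (fun k => (k - 1).toNat) ?_ ?_ ?_ ?_ ?_
  · intro i hi; simp only [Finset.mem_range, Finset.mem_Icc] at *; omega
  · intro k hk; simp only [Finset.mem_range, Finset.mem_Icc] at *; omega
  · intro i hi; simp
  · intro k hk; simp only [Finset.mem_Icc] at hk; omega
  · intro i hi; rfl

lemma sum_Icc_nat_eq_sum_Icc_int {M : Type*} [AddCommMonoid M] (n : ℕ) (F : ℤ → M) :
    ∑ k ∈ Finset.Icc 1 n, F (k : ℤ) = ∑ k ∈ Finset.Icc (1 : ℤ) n, F k := by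
  refine Finset.sum_nbij' (fun i => (i : ℤ)) (fun k => k.toNat) ?_ ?_ ?_ ?_ ?_
  · intro i hi; simp only [Finset.mem_Icc] at *; omega
  · intro k hk; simp only [Finset.mem_Icc] at *; omega
  · intro i hi; simp
  · intro k hk; simp only [Finset.mem_Icc] at hk; omega
  · intro i hi; rfl

/-- The exponential `e^{2πiak/n}`. -/
noncomputable def fourierExp (n : ℕ) (a k : ℤ) : ℂ :=
  Complex.exp (Complex.I * (k : ℂ) * ((2 * Real.pi * a / n : ℝ) : ℂ))

lemma norm_fourierExp (n : ℕ) (a k : ℤ) : ‖fourierExp n a k‖ = 1 := by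
  rw [fourierExp, show Complex.I * (k : ℂ) * ((2 * Real.pi * a / n : ℝ) : ℂ)
    = ((k * (2 * Real.pi * a / n) : ℝ) : ℂ) * Complex.I by push_cast; ring,
    Complex.norm_exp_ofReal_mul_I]

lemma fourierExp_add_right (n : ℕ) (a k l : ℤ) :
    fourierExp n a (k + l) = fourierExp n a k * fourierExp n a l := by
  rw [fourierExp, fourierExp, fourierExp, ← Complex.exp_add]; push_cast; ring_nf

lemma fourierExp_add_left (n : ℕ) (a b k : ℤ) :
    fourierExp n (a + b) k = fourierExp n a k * fourierExp n b k := by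
  rw [fourierExp, fourierExp, fourierExp, ← Complex.exp_add]; push_cast; ring_nf

lemma conj_fourierExp (n : ℕ) (a k : ℤ) :
    (starRingEnd ℂ) (fourierExp n a k) = fourierExp n (-a) k := by
  rw [fourierExp, fourierExp, ← Complex.exp_conj]
  simp only [map_mul, Complex.conj_I, Complex.conj_ofReal, map_intCast]
  push_cast; ring_nf

lemma fourierExp_natCast_add_one (n : ℕ) (a : ℤ) (i : ℕ) :
    fourierExp n a (i + 1) = fourierExp n a 1 * fourierExp n a 1 ^ i := by
  rw [fourierExp_add_right, mul_comm]
  congr 1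
  rw [fourierExp, fourierExp, ← Complex.exp_nat_mul]; push_cast; ring_nf

/-- Orthogonality of the Fourier frequencies. -/
lemma sum_fourierExp {n : ℕ} (hn : 0 < n) (a : ℤ) :
    ∑ k ∈ Finset.Icc (1 : ℤ) n, fourierExp n a k = if (n : ℤ) ∣ a then (n : ℂ) else 0 := by
  have hn0 : (n : ℂ) ≠ 0 := Nat.cast_ne_zero.2 hn.ne'
  have hpi : (2 * Real.pi * Complex.I : ℂ) ≠ 0 := Complex.two_pi_I_ne_zero
  have h1 : fourierExp n a 1 = 1 ↔ (n : ℤ) ∣ a := by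
    rw [fourierExp, Complex.exp_eq_one_iff]
    constructor
    · rintro ⟨m, hm⟩
      refine ⟨m, ?_⟩
      have : (a : ℂ) * (2 * Real.pi * Complex.I) = (n * m : ℂ) * (2 * Real.pi * Complex.I) := by
        push_cast at hm
        field_simp at hm
        linear_combination (2 * Real.pi * Complex.I : ℂ) * hm
      exact_mod_cast mul_right_cancel₀ hpi this
    · rintro ⟨m, rfl⟩
      refine ⟨m, ?_⟩
      push_cast
      field_simp
  rw [sum_Icc_int_eq_sum_range]
  simp_rw [fourierExp_natCast_add_one]
  rw [← Finset.mul_sum]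
  split_ifs with hd
  · rw [h1.2 hd]; simp
  · have hne : fourierExp n a 1 ≠ 1 := fun h => hd (h1.1 h)
    rw [geom_sum_eq hne]
    have : fourierExp n a 1 ^ n = 1 := by
      rw [fourierExp, ← Complex.exp_nat_mul, Complex.exp_eq_one_iff]
      refine ⟨a, ?_⟩
      push_cast
      field_simp
    rw [this]; simp

/-! ### Second moments of the discrete Fourier transforms. -/

section Covariances

variable {r : ℤ → ℝ}

/-- The averaged truncation error `n⁻¹ ∑_h |r(h)| #{l ∈ [1, n] : l + h ∉ [1, n]}`. -/
noncomputable def edgeError (r : ℤ → ℝ) (n : ℕ) : ℝ :=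
  ∑' h : ℤ, |r h| * (((Finset.Icc (1 : ℤ) n).filter
    fun l => l + h ∉ Finset.Icc (1 : ℤ) n).card / n : ℝ)

lemma edge_card_div_le_one (n : ℕ) (h : ℤ) : (((Finset.Icc (1 : ℤ) n).filter
    fun l => l + h ∉ Finset.Icc (1 : ℤ) n).card / n : ℝ) ≤ 1 := by
  refine div_le_one_of_le₀ ?_ (Nat.cast_nonneg _)
  refine Nat.cast_le.2 ((Finset.card_filter_le _ _).trans ?_)
  simp

/-- For each lag `h` at most `|h|` indices are pushed out of `[1, n]`. Dominated convergence, with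
`|r h|` as dominating series, does the rest. -/
lemma tendsto_edgeError (hr : Summable fun h => |r h|) :
    Tendsto (edgeError r) atTop (𝓝 0) := by
  rw [← tsum_zero (α := ℝ) (β := ℤ)]
  refine tendsto_tsum_of_dominated_convergence hr (fun h => ?_) (Eventually.of_forall fun n h => ?_)
  · rw [← mul_zero |r h|]
    refine Tendsto.const_mul _ ?_
    refine squeeze_zero (fun n => by positivity) (fun n => ?_)
      (tendsto_const_div_atTop_nhds_zero_nat (h.natAbs : ℝ))
    refine div_le_div_of_nonneg_right (Nat.cast_le.2 ?_) (Nat.cast_nonneg _)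
    have hsub : ((Finset.Icc (1 : ℤ) n).filter fun l => l + h ∉ Finset.Icc (1 : ℤ) n)
        ⊆ Finset.Ioc (n - h) n ∪ Finset.Ico 1 (1 - h) := by
      intro l hl
      simp only [Finset.mem_filter, Finset.mem_Icc, Finset.mem_union, Finset.mem_Ioc,
        Finset.mem_Ico] at hl ⊢
      omega
    refine (Finset.card_le_card hsub).trans ((Finset.card_union_le _ _).trans ?_)
    simp only [Int.card_Ioc, Int.card_Ico]
    omega
  · rw [norm_mul, Real.norm_eq_abs, abs_abs]
    exact mul_le_of_le_one_right (abs_nonneg _)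
      (by rw [Real.norm_of_nonneg (by positivity)]; exact edge_card_div_le_one n h)

lemma summable_mul_fourierExp (hr : Summable fun h => |r h|) (n : ℕ) (a : ℤ) :
    Summable fun h => (r h : ℂ) * fourierExp n a h := by
  refine Summable.of_norm ?_
  simpa only [norm_mul, norm_fourierExp, mul_one, Complex.norm_real, Real.norm_eq_abs] using hr

/-- Covariances of the discrete Fourier transforms at two Fourier frequencies. -/
lemma norm_sum_covariance_sub_le (hr : Summable fun h => |r h|) {n : ℕ} (hn : 0 < n) (a b : ℤ) :
    ‖∑ k ∈ Finset.Icc (1 : ℤ) n, ∑ l ∈ Finset.Icc (1 : ℤ) n,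
        (r (k - l) : ℂ) * (fourierExp n a k * fourierExp n b l)
      - if (n : ℤ) ∣ a + b then n * ∑' h, (r h : ℂ) * fourierExp n a h else 0‖
      ≤ n * edgeError r n := by
  set J := Finset.Icc (1 : ℤ) n with hJ
  set φ : ℤ → ℂ := fun h => (r h : ℂ) * fourierExp n a h with hφ
  have hφs : Summable φ := summable_mul_fourierExp hr n a
  -- With `h = k - l`, the inner sum is the full series up to the lags leaving `[1, n]`. The
  -- remaining sum over `l` is governed by the orthogonality relation at `a + b`.
  have hinner : ∀ l : ℤ, ∑' h, φ h - ∑ k ∈ J, φ (k - l)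
      = ∑' h, if l + h ∈ J then 0 else φ h := by
    intro l
    have e1 : ∑ k ∈ J, φ (k - l) = ∑' h, if l + h ∈ J then φ h else 0 := by
      rw [← (Equiv.subRight l).tsum_eq fun h => if l + h ∈ J then φ h else 0]
      simp only [Equiv.subRight_apply, add_sub_cancel]
      rw [tsum_eq_sum (s := J) fun k hk => if_neg hk]
      exact Finset.sum_congr rfl fun k hk => (if_pos hk).symm
    have hs : Summable fun h => if l + h ∈ J then φ h else 0 := by
      refine Summable.of_norm_bounded hφs.norm fun h => ?_
      split_ifs
      · exact le_rfl
      · simp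
    rw [e1, ← hφs.tsum_sub hs]
    refine tsum_congr fun h => ?_
    split_ifs <;> simp
  have hkey : ∑ k ∈ J, ∑ l ∈ J, (r (k - l) : ℂ) * (fourierExp n a k * fourierExp n b l)
      - (if (n : ℤ) ∣ a + b then n * ∑' h, φ h else 0)
      = - ∑ l ∈ J, fourierExp n (a + b) l * ∑' h, if l + h ∈ J then 0 else φ h := by
    have e1 : (if (n : ℤ) ∣ a + b then n * ∑' h, φ h else 0)
        = ∑ l ∈ J, fourierExp n (a + b) l * ∑' h, φ h := by
      rw [← Finset.sum_mul, sum_fourierExp hn, ite_mul, zero_mul]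
    rw [e1, Finset.sum_comm, ← Finset.sum_sub_distrib, ← Finset.sum_neg_distrib]
    refine Finset.sum_congr rfl fun l _ => ?_
    rw [← hinner, mul_sub, Finset.mul_sum, neg_sub]
    congr 1
    refine Finset.sum_congr rfl fun k _ => ?_
    have : fourierExp n a k = fourierExp n a (k - l) * fourierExp n a l := by
      rw [← fourierExp_add_right, sub_add_cancel]
    rw [hφ, this, fourierExp_add_left]
    ring
  rw [hkey, norm_neg]
  have hs : ∀ l : ℤ, Summable fun h => if l + h ∈ J then 0 else |r h| := fun l => by
    refine hr.of_nonneg_of_le (fun h => ?_) fun h => ?_ <;> split_ifs <;> simp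
  calc ‖∑ l ∈ J, fourierExp n (a + b) l * ∑' h, if l + h ∈ J then 0 else φ h‖
      ≤ ∑ l ∈ J, ∑' h, if l + h ∈ J then 0 else |r h| := by
        refine (norm_sum_le _ _).trans (Finset.sum_le_sum fun l _ => ?_)
        rw [norm_mul, norm_fourierExp, one_mul]
        refine tsum_of_norm_bounded (hs l).hasSum fun h => ?_
        split_ifs
        · simp
        · rw [hφ, norm_mul, norm_fourierExp, mul_one, Complex.norm_real]; rfl
    _ = n * edgeError r n := by
        have hn0 : (n : ℝ) ≠ 0 := Nat.cast_ne_zero.2 hn.ne'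
        rw [← Summable.tsum_finsetSum fun l _ => hs l, edgeError, ← tsum_mul_left]
        refine tsum_congr fun h => ?_
        rw [Finset.card_filter]
        push_cast
        rw [show (n : ℝ) * (|r h| * ((∑ l ∈ J, if l + h ∉ J then (1 : ℝ) else 0) / n))
          = |r h| * ∑ l ∈ J, if l + h ∉ J then (1 : ℝ) else 0 by field_simp, Finset.mul_sum]
        refine Finset.sum_congr rfl fun l _ => ?_
        split_ifs <;> simp_all

/-- Asymptotic variance of a combination of the discrete Fourier transforms at two distinct
Fourier frequencies in `(0, π)`. -/
lemma abs_variance_sub_le (hr : Summable fun h => |r h|) {n j l : ℕ}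
    (hj : 1 ≤ j) (hl : 1 ≤ l) (hjn : 2 * j < n) (hln : 2 * l < n) (hjl : j ≠ l) (A B : ℂ)
    {Fj Fl : ℝ} (hFj : ∑' h, (r h : ℂ) * fourierExp n j h = Fj)
    (hFl : ∑' h, (r h : ℂ) * fourierExp n l h = Fl)
    (hFj' : ∑' h, (r h : ℂ) * fourierExp n (-j) h = Fj)
    (hFl' : ∑' h, (r h : ℂ) * fourierExp n (-l) h = Fl) :
    |∑ k ∈ Finset.Icc (1 : ℤ) n, ∑ k' ∈ Finset.Icc (1 : ℤ) n, r (k - k') *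
        ((A * fourierExp n j k + B * fourierExp n l k).re
          * (A * fourierExp n j k' + B * fourierExp n l k').re)
      - n / 2 * (‖A‖ ^ 2 * Fj + ‖B‖ ^ 2 * Fl)| ≤ (‖A‖ + ‖B‖) ^ 2 * (n * edgeError r n) := by
  have hn : 0 < n := by omega
  set J := Finset.Icc (1 : ℤ) n with hJ
  -- A real part is half the sum of a number and its conjugate, so four frequencies occur, with `σ`
  -- the conjugate pairing. Since all are below `n/2` in modulus and `0 < j ≠ l > 0`, the sum of two
  -- is divisible by `n` only for conjugate partners.
  let a : Fin 4 → ℤ := ![j, -j, l, -l]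
  let α : Fin 4 → ℂ := ![A, (starRingEnd ℂ) A, B, (starRingEnd ℂ) B]
  let σ : Fin 4 → Fin 4 := ![1, 0, 3, 2]
  let F : Fin 4 → ℂ := ![Fj, Fj, Fl, Fl]
  have hF : ∀ q, ∑' h, (r h : ℂ) * fourierExp n (a q) h = F q := by
    intro q
    fin_cases q
    exacts [hFj, hFj', hFl, hFl']
  have hdvd : ∀ q q', (n : ℤ) ∣ a q + a q' ↔ q' = σ q := by
    intro q q'
    have h1 : (n : ℤ) ∣ a q + a q' ↔ a q + a q' = 0 := by
      refine ⟨fun h => Int.eq_zero_of_abs_lt_dvd h ?_, fun h => h ▸ dvd_zero _⟩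
      have hb : ∀ q, 2 * |a q| < n := by
        intro q; fin_cases q <;> simp [a] <;> omega
      have := abs_add_le (a q) (a q')
      have := hb q
      have := hb q'
      omega
    rw [h1]
    fin_cases q <;> fin_cases q' <;> simp [a, σ] <;> omega
  have hre : ∀ k : ℤ, (((A * fourierExp n j k + B * fourierExp n l k).re : ℝ) : ℂ)
      = 1 / 2 * ∑ q, α q * fourierExp n (a q) k := by
    intro k
    rw [Complex.re_eq_add_conj]
    simp only [Fin.sum_univ_four, α, a, map_add, map_mul, conj_fourierExp, Matrix.cons_val]
    ring
  have hsum : ((∑ k ∈ J, ∑ k' ∈ J, r (k - k') *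
        ((A * fourierExp n j k + B * fourierExp n l k).re
          * (A * fourierExp n j k' + B * fourierExp n l k').re)
      - n / 2 * (‖A‖ ^ 2 * Fj + ‖B‖ ^ 2 * Fl) : ℝ) : ℂ)
      = 1 / 4 * ∑ q, ∑ q', α q * α q' * (∑ k ∈ J, ∑ k' ∈ J,
          (r (k - k') : ℂ) * (fourierExp n (a q) k * fourierExp n (a q') k')
          - if (n : ℤ) ∣ a q + a q' then n * ∑' h, (r h : ℂ) * fourierExp n (a q) h else 0) := by
    have e1 : ∑ q, ∑ q', α q * α q' *
        (if (n : ℤ) ∣ a q + a q' then n * ∑' h, (r h : ℂ) * fourierExp n (a q) h else 0)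
        = 2 * n * (‖A‖ ^ 2 * Fj + ‖B‖ ^ 2 * Fl) := by
      simp_rw [hdvd, hF, mul_ite, mul_zero, Finset.sum_ite_eq', Finset.mem_univ, if_true]
      simp only [Fin.sum_univ_four, α, σ, F, Matrix.cons_val]
      have hA : A * (starRingEnd ℂ) A = (‖A‖ : ℂ) ^ 2 := Complex.mul_conj' A
      have hB : B * (starRingEnd ℂ) B = (‖B‖ : ℂ) ^ 2 := Complex.mul_conj' B
      linear_combination (2 * n * Fj) * hA + (2 * n * Fl) * hB
    have e2 : ∑ q, ∑ q', α q * α q' * ∑ k ∈ J, ∑ k' ∈ J,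
          (r (k - k') : ℂ) * (fourierExp n (a q) k * fourierExp n (a q') k')
        = 4 * ∑ k ∈ J, ∑ k' ∈ J, (r (k - k') : ℂ) *
        (((A * fourierExp n j k + B * fourierExp n l k).re : ℝ)
          * ((A * fourierExp n j k' + B * fourierExp n l k').re : ℝ)) := by
      have hterm : ∀ k k' : ℤ, 4 * ((r (k - k') : ℂ) *
          (((A * fourierExp n j k + B * fourierExp n l k).re : ℝ)
            * ((A * fourierExp n j k' + B * fourierExp n l k').re : ℝ)))
          = ∑ q, ∑ q', α q * α q' *
            ((r (k - k') : ℂ) * (fourierExp n (a q) k * fourierExp n (a q') k')) := by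
        intro k k'
        rw [hre, hre]
        trans (r (k - k') : ℂ) * ((∑ q, α q * fourierExp n (a q) k)
          * ∑ q, α q * fourierExp n (a q) k')
        · ring
        rw [Finset.sum_mul_sum, Finset.mul_sum]
        refine Finset.sum_congr rfl fun q _ => ?_
        rw [Finset.mul_sum]
        exact Finset.sum_congr rfl fun q' _ => by ring
      simp_rw [Finset.mul_sum (s := J), hterm]
      rw [Finset.sum_congr rfl fun q _ => Finset.sum_comm, Finset.sum_comm]
      refine Finset.sum_congr rfl fun k _ => ?_
      rw [Finset.sum_congr rfl fun q _ => Finset.sum_comm, Finset.sum_comm]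
    simp_rw [mul_sub, Finset.sum_sub_distrib]
    rw [e1, e2]
    push_cast
    ring
  rw [← Real.norm_eq_abs, ← Complex.norm_real, hsum, norm_mul]
  have hα : ∑ q, ‖α q‖ = 2 * (‖A‖ + ‖B‖) := by
    simp only [Fin.sum_univ_four, α, Matrix.cons_val, Complex.norm_conj]
    ring
  calc _ ≤ ‖(1 / 4 : ℂ)‖ * ∑ q, ∑ q', ‖α q‖ * ‖α q'‖ * (n * edgeError r n) := by
        refine mul_le_mul_of_nonneg_left ?_ (norm_nonneg _)
        refine (norm_sum_le _ _).trans (Finset.sum_le_sum fun q _ =>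
          (norm_sum_le _ _).trans (Finset.sum_le_sum fun q' _ => ?_))
        rw [norm_mul, norm_mul]
        exact mul_le_mul_of_nonneg_left (norm_sum_covariance_sub_le hr hn _ _) (by positivity)
    _ = 1 / 4 * ((∑ q, ‖α q‖) * (∑ q, ‖α q‖) * (n * edgeError r n)) := by
        rw [Finset.sum_mul_sum, Finset.sum_mul]
        simp_rw [Finset.sum_mul]
        norm_num
    _ = _ := by rw [hα]; ring

end Covariances

/-! ### Uniform limits over pairs of frequencies. -/

/-- `n → ∞`, uniformly over pairs `j ≠ l` in `[1, m_n]`. -/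
def pairFilter : Filter (ℕ × ℕ × ℕ) :=
  comap Prod.fst atTop ⊓ 𝓟 {p | (1 ≤ p.2.1 ∧ p.2.1 ≤ numFreq p.1) ∧
    (1 ≤ p.2.2 ∧ p.2.2 ≤ numFreq p.1) ∧ p.2.1 ≠ p.2.2}

instance : pairFilter.IsCountablyGenerated := by unfold pairFilter; infer_instance

lemma eventually_pairFilter {q : ℕ × ℕ × ℕ → Prop} :
    (∀ᶠ p in pairFilter, q p) ↔ ∃ N, ∀ n ≥ N, ∀ j l, 1 ≤ j → j ≤ numFreq n → 1 ≤ l →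
      l ≤ numFreq n → j ≠ l → q (n, j, l) := by
  rw [pairFilter, eventually_inf_principal, eventually_comap, eventually_atTop]
  constructor
  · rintro ⟨N, hN⟩
    exact ⟨N, fun n hn j l h1 h2 h3 h4 h5 => hN n hn (n, j, l) rfl ⟨⟨h1, h2⟩, ⟨h3, h4⟩, h5⟩⟩
  · rintro ⟨N, hN⟩
    refine ⟨N, fun n hn => ?_⟩
    rintro ⟨_, j, l⟩ rfl ⟨⟨h1, h2⟩, ⟨h3, h4⟩, h5⟩
    exact hN _ hn j l h1 h2 h3 h4 h5

lemma tendsto_fst_pairFilter : Tendsto Prod.fst pairFilter atTop :=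
  tendsto_comap.mono_left inf_le_left

/-! ### Joint asymptotic normality of the Fourier transforms. -/

section DFT

lemma fourierSum_fourierFreq {Ω : Type*} (X : ℤ → Ω → ℝ) (n j : ℕ) (ω : Ω) :
    fourierSum X n (fourierFreq n j) ω
      = ∑ k ∈ Finset.Icc (1 : ℤ) n, (X k ω : ℂ) * fourierExp n j k := by
  rw [← sum_Icc_nat_eq_sum_Icc_int n fun k => (X k ω : ℂ) * fourierExp n j k]
  simp only [fourierSum, fourierExp, fourierFreq, Int.cast_natCast]

variable {Ω : Type*} [mΩ : MeasurableSpace Ω]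

/-- The normalized discrete Fourier transform `S_n(θ_j) / (2πn f(θ_j))^{1/2}`. -/
noncomputable def normDFT (P : Measure Ω) (X : ℤ → Ω → ℝ) (n j : ℕ) (ω : Ω) : ℂ :=
  fourierSum X n (fourierFreq n j) ω
    / (√(2 * Real.pi * n * spectralDensity P X (fourierFreq n j)) : ℝ)

/-- Real and imaginary parts of the normalized discrete Fourier transforms at two Fourier
frequencies. -/
noncomputable def dftCoord (P : Measure Ω) (X : ℤ → Ω → ℝ) (p : ℕ × ℕ × ℕ) (ω : Ω) : Fin 4 → ℝ :=
  ![(normDFT P X p.1 p.2.1 ω).re, (normDFT P X p.1 p.2.1 ω).im,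
    (normDFT P X p.1 p.2.2 ω).re, (normDFT P X p.1 p.2.2 ω).im]

lemma norm_normDFT_sq {P : Measure Ω} {X : ℤ → Ω → ℝ} {n j : ℕ}
    (hf : 0 ≤ spectralDensity P X (fourierFreq n j)) (ω : Ω) :
    ‖normDFT P X n j ω‖ ^ 2 = normPeriodogram P X n (fourierFreq n j) ω := by
  rw [normDFT, norm_div, Complex.norm_real, Real.norm_of_nonneg (Real.sqrt_nonneg _), div_pow,
    Real.sq_sqrt (by positivity), normPeriodogram, periodogram]
  field_simp

/-- Evenness makes the series equal to its own conjugate, so taking the real part in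
`spectralDensity` loses nothing. -/
lemma tsum_covariance_mul_exp_eq {P : Measure Ω} {X : ℤ → Ω → ℝ}
    (heven : ∀ k, covariance P X (-k) = covariance P X k) (θ : ℝ) :
    ∑' k : ℤ, (covariance P X k : ℂ) * Complex.exp (Complex.I * (k : ℂ) * (θ : ℂ))
      = ((2 * Real.pi * spectralDensity P X θ : ℝ) : ℂ) := by
  have hconj : (starRingEnd ℂ) (∑' k : ℤ,
      (covariance P X k : ℂ) * Complex.exp (Complex.I * (k : ℂ) * (θ : ℂ)))
      = ∑' k : ℤ, (covariance P X k : ℂ) * Complex.exp (Complex.I * (k : ℂ) * (θ : ℂ)) := by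
    rw [Complex.conj_tsum, ← (Equiv.neg ℤ).tsum_eq]
    refine tsum_congr fun k => ?_
    simp only [Equiv.neg_apply, map_mul, Complex.conj_ofReal, heven, ← Complex.exp_conj,
      Complex.conj_I, map_intCast]
    push_cast
    ring_nf
  rw [spectralDensity, ← mul_assoc, mul_one_div_cancel (by positivity), one_mul]
  exact (Complex.conj_eq_iff_re.1 hconj).symm

lemma spectralDensity_neg {P : Measure Ω} {X : ℤ → Ω → ℝ}
    (heven : ∀ k, covariance P X (-k) = covariance P X k) (θ : ℝ) :
    spectralDensity P X (-θ) = spectralDensity P X θ := by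
  rw [spectralDensity, spectralDensity, ← (Equiv.neg ℤ).tsum_eq]
  congr 3
  refine funext fun k => ?_
  simp only [Equiv.neg_apply, heven]
  push_cast
  ring_nf

variable {P : Measure Ω} [IsProbabilityMeasure P] {ε : ℤ → Ω → ℝ} {G : (ℕ → ℝ) → ℝ}

/-- Joint asymptotic normality of the discrete Fourier transforms at two Fourier frequencies,
uniformly in the frequencies. -/
theorem IsIID.tendsto_charFun_dftCoord (h : IsIID P ε) (hG : Measurable G)
    (hG2 : ∀ k, MemLp (fun ω => G (past ε k ω)) 2 P) (hG0 : ∫ ω, G (past ε 0 ω) ∂P = 0)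
    (hsum : Summable (projNorm P ε G)) {fmin : ℝ} (hfmin : 0 < fmin)
    (hf : ∀ θ, fmin ≤ spectralDensity P (fun n ω => G (past ε n ω)) θ) (s : Fin 4 → ℝ) :
    Tendsto (fun p => ∫ ω, Complex.exp (Complex.I *
        (∑ q, s q * dftCoord P (fun n ω => G (past ε n ω)) p ω q : ℝ)) ∂P) pairFilter
      (𝓝 (Real.exp (-(∑ q, s q ^ 2 / 2) / 2) : ℝ)) := by
  set X : ℤ → Ω → ℝ := fun n ω => G (past ε n ω) with hX
  set r : ℤ → ℝ := covariance P X with hr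
  have hrs : Summable fun k => |r k| := h.summable_covariance hG hG2 hG0 hsum
  have heven : ∀ k, covariance P X (-k) = covariance P X k := h.covariance_neg hG
  set f : ℕ → ℕ → ℝ := fun n j => spectralDensity P X (fourierFreq n j) with hfdef
  have hfpos : ∀ n j, 0 < f n j := fun n j => hfmin.trans_le (hf _)
  set C : ℝ := (∑ q, |s q|) / √(2 * Real.pi * fmin) with hC
  have hC0 : 0 ≤ C := by positivity
  -- Uses `s₀ Re z + s₁ Im z = Re((s₀ - i s₁) z)`. The lower bound `fmin` makes `A` and `B` of order
  -- `1/√n`.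
  let A : ℕ × ℕ × ℕ → ℂ := fun p =>
    ((s 0 : ℂ) - s 1 * Complex.I) / (√(2 * Real.pi * p.1 * f p.1 p.2.1) : ℝ)
  let B : ℕ × ℕ × ℕ → ℂ := fun p =>
    ((s 2 : ℂ) - s 3 * Complex.I) / (√(2 * Real.pi * p.1 * f p.1 p.2.2) : ℝ)
  let c : ℕ × ℕ × ℕ → ℤ → ℝ := fun p k =>
    (A p * fourierExp p.1 p.2.1 k + B p * fourierExp p.1 p.2.2 k).re
  have hlin : ∀ p ω, ∑ q, s q * dftCoord P X p ω q
      = ∑ k ∈ Finset.Icc (1 : ℤ) p.1, c p k * G (past ε k ω) := by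
    intro p ω
    have hc : ∑ k ∈ Finset.Icc (1 : ℤ) p.1, c p k * G (past ε k ω)
        = (A p * fourierSum X p.1 (fourierFreq p.1 p.2.1) ω
          + B p * fourierSum X p.1 (fourierFreq p.1 p.2.2) ω).re := by
      rw [fourierSum_fourierFreq, fourierSum_fourierFreq, Finset.mul_sum, Finset.mul_sum,
        ← Finset.sum_add_distrib, Complex.re_sum]
      refine Finset.sum_congr rfl fun k _ => ?_
      rw [← Complex.re_mul_ofReal]
      congr 1
      simp only [hX]
      ring
    rw [hc]
    simp only [Fin.sum_univ_four, dftCoord, normDFT, A, B, Matrix.cons_val, hfdef,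
      Complex.add_re, Complex.mul_re, Complex.div_ofReal_re, Complex.div_ofReal_im,
      Complex.sub_re, Complex.sub_im, Complex.mul_im, Complex.ofReal_re, Complex.ofReal_im,
      Complex.I_re, Complex.I_im]
    ring
  have hAsq : ∀ (n j : ℕ) (x y : ℝ), 0 < n →
      ‖((x : ℂ) - y * Complex.I) / (√(2 * Real.pi * n * f n j) : ℝ)‖ ^ 2
        = (x ^ 2 + y ^ 2) / (2 * Real.pi * n * f n j) := by
    intro n j x y hn
    have := hfpos n j
    rw [norm_div, div_pow, Complex.norm_real, Real.norm_of_nonneg (Real.sqrt_nonneg _),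
      Real.sq_sqrt (by positivity), ← Complex.normSq_eq_norm_sq, Complex.normSq_apply]
    simp
    ring
  have hAle : ∀ (n j : ℕ) (x y : ℝ), 0 < n →
      ‖((x : ℂ) - y * Complex.I) / (√(2 * Real.pi * n * f n j) : ℝ)‖
        ≤ (|x| + |y|) / √(2 * Real.pi * fmin) / √n := by
    intro n j x y hn
    have hfm := hf (fourierFreq n j)
    rw [norm_div, Complex.norm_real, Real.norm_of_nonneg (Real.sqrt_nonneg _), div_div,
      ← Real.sqrt_mul (by positivity)]
    have hn' : (0 : ℝ) < n := Nat.cast_pos.2 hn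
    refine div_le_div₀ (by positivity) ?_ (by positivity) (Real.sqrt_le_sqrt ?_)
    · refine (norm_sub_le _ _).trans ?_
      simp
    · rw [mul_right_comm]
      exact mul_le_mul_of_nonneg_left hfm (by positivity)
  have hABle : ∀ p : ℕ × ℕ × ℕ, 0 < p.1 → ‖A p‖ + ‖B p‖ ≤ C / √p.1 := by
    intro p hp
    refine (add_le_add (hAle p.1 p.2.1 (s 0) (s 1) hp) (hAle p.1 p.2.2 (s 2) (s 3) hp)).trans_eq ?_
    rw [hC, Fin.sum_univ_four]
    ring
  have hcle : ∀ p : ℕ × ℕ × ℕ, 0 < p.1 → ∀ k, |c p k| ≤ C / √p.1 := by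
    intro p hp k
    refine (Complex.abs_re_le_norm _).trans ((norm_add_le _ _).trans ?_)
    simp only [norm_mul, norm_fourierExp, mul_one]
    exact hABle p hp
  set V : ℕ × ℕ × ℕ → ℝ := fun p =>
    ∫ ω, (∑ k ∈ Finset.Icc (1 : ℤ) p.1, c p k * G (past ε k ω)) ^ 2 ∂P with hV
  have hVsum : ∀ p : ℕ × ℕ × ℕ, V p = ∑ k ∈ Finset.Icc (1 : ℤ) p.1,
      ∑ k' ∈ Finset.Icc (1 : ℤ) p.1, r (k - k') * (c p k * c p k') := by
    intro p
    have hint : ∀ k k' : ℤ, Integrable (fun ω => c p k * c p k' *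
        (G (past ε k ω) * G (past ε k' ω))) P := fun k k' =>
      (integrable_fun_mul (hG2 k) (hG2 k')).const_mul _
    have e : ∀ ω, (∑ k ∈ Finset.Icc (1 : ℤ) p.1, c p k * G (past ε k ω)) ^ 2
        = ∑ k ∈ Finset.Icc (1 : ℤ) p.1, ∑ k' ∈ Finset.Icc (1 : ℤ) p.1,
          c p k * c p k' * (G (past ε k ω) * G (past ε k' ω)) := by
      intro ω
      rw [sq, Finset.sum_mul_sum]
      exact Finset.sum_congr rfl fun _ _ => Finset.sum_congr rfl fun _ _ => by ring
    simp only [hV, e]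
    rw [integral_finsetSum _ fun k _ => integrable_finsetSum _ fun k' _ => hint k k']
    refine Finset.sum_congr rfl fun k _ => ?_
    rw [integral_finsetSum _ fun k' _ => hint k k']
    refine Finset.sum_congr rfl fun k' _ => ?_
    rw [integral_const_mul, h.integral_mul_comp_past hG, mul_comm]
  have hVlim : Tendsto V pairFilter (𝓝 (∑ q, s q ^ 2 / 2)) := by
    rw [tendsto_iff_dist_tendsto_zero]
    have hz : Tendsto (fun p : ℕ × ℕ × ℕ => C ^ 2 * edgeError r p.1) pairFilter (𝓝 (C ^ 2 * 0)) :=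
      ((tendsto_edgeError hrs).comp tendsto_fst_pairFilter).const_mul _
    rw [mul_zero] at hz
    refine squeeze_zero' (Eventually.of_forall fun p => dist_nonneg) ?_ hz
    rw [eventually_pairFilter]
    refine ⟨1, fun n hn j l hj1 hj2 hl1 hl2 hjl => ?_⟩
    have hn0 : (0 : ℝ) < n := Nat.cast_pos.2 hn
    have hF : ∀ a : ℕ, ∑' k, (r k : ℂ) * fourierExp n a k
        = ((2 * Real.pi * f n a : ℝ) : ℂ) := fun a => by
      rw [hfdef, ← tsum_covariance_mul_exp_eq heven]
      simp only [fourierExp, fourierFreq, Int.cast_natCast, hr]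
    have hF' : ∀ a : ℕ, ∑' k, (r k : ℂ) * fourierExp n (-a) k
        = ((2 * Real.pi * f n a : ℝ) : ℂ) := fun a => by
      simp only [hfdef]
      rw [← spectralDensity_neg heven, ← tsum_covariance_mul_exp_eq heven]
      simp only [fourierExp, fourierFreq, hr]
      refine tsum_congr fun k => ?_
      push_cast
      ring_nf
    have hmain := abs_variance_sub_le hrs hj1 hl1
      (by simp only [numFreq] at hj2; omega) (by simp only [numFreq] at hl2; omega) hjl
      (A (n, j, l)) (B (n, j, l)) (hF j) (hF l) (hF' j) (hF' l)
    rw [Real.dist_eq, hVsum]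
    -- The normalization cancels the spectral density exactly, so the only variance error is the
    -- edge error.
    have hval : ∑ q, s q ^ 2 / 2 = n / 2 * (‖A (n, j, l)‖ ^ 2 * (2 * Real.pi * f n j)
        + ‖B (n, j, l)‖ ^ 2 * (2 * Real.pi * f n l)) := by
      have h1 := hfpos n j
      have h2 := hfpos n l
      simp only [A, B]
      rw [hAsq n j _ _ hn, hAsq n l _ _ hn, Fin.sum_univ_four]
      field_simp
      ring
    rw [hval]
    refine hmain.trans ?_
    have hρ : 0 ≤ edgeError r n := tsum_nonneg fun h => by positivity
    have hsq := pow_le_pow_left₀ (by positivity) (hABle (n, j, l) hn) 2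
    rw [div_pow, Real.sq_sqrt hn0.le] at hsq
    refine (mul_le_mul_of_nonneg_right hsq (by positivity)).trans_eq ?_
    field_simp
  have hexp : Tendsto (fun p => ((Real.exp (-(V p) / 2) : ℝ) : ℂ)) pairFilter
      (𝓝 (Real.exp (-(∑ q, s q ^ 2 / 2) / 2) : ℝ)) :=
    (Complex.continuous_ofReal.tendsto _).comp
      ((Real.continuous_exp.tendsto _).comp (hVlim.neg.div_const 2))
  have hdiff : Tendsto (fun p => (∫ ω, Complex.exp (Complex.I *
        (∑ q, s q * dftCoord P X p ω q : ℝ)) ∂P) - ((Real.exp (-(V p) / 2) : ℝ) : ℂ)) pairFilter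
      (𝓝 0) := by
    rw [Metric.tendsto_nhds]
    intro η hη
    obtain ⟨N, hN⟩ := h.exists_norm_charFun_le hG hG2 hG0 hsum hC0 (half_pos hη)
    rw [eventually_pairFilter]
    refine ⟨max N 1, fun n hn j l _ _ _ _ _ => ?_⟩
    rw [dist_zero_right]
    simp only [hlin]
    refine (hN n (le_of_max_le_left hn) (Finset.Icc (1 : ℤ) n) (c (n, j, l)) (by simp)
      fun k _ => hcle (n, j, l) (le_of_max_le_right hn) k).trans_lt (half_lt_self hη)
  simpa using hdiff.add hexp

end DFT

/-! ### Gaussian averages of exponentials. -/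

section GaussianMixture

lemma integral_exp_gaussianReal (y : ℝ) :
    ∫ s, Complex.exp (Complex.I * (s * y : ℝ)) ∂(gaussianReal 0 1)
      = (Real.exp (-y ^ 2 / 2) : ℝ) := by
  have := charFun_gaussianReal (μ := 0) (v := 1) y
  rw [charFun_apply_real] at this
  convert this using 1
  · congr 1; ext s; push_cast; ring_nf
  · push_cast; congr 1; simp; ring

lemma integral_exp_neg_sq_gaussianReal {a : ℝ} (ha : 0 ≤ a) :
    ∫ s, Real.exp (-a * s ^ 2 / 2) ∂(gaussianReal 0 1) = (√(1 + a))⁻¹ := by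
  rw [integral_gaussianReal_eq_integral_smul one_ne_zero]
  have h1 : ∀ s : ℝ, gaussianPDFReal 0 1 s • Real.exp (-a * s ^ 2 / 2)
      = (√(2 * Real.pi))⁻¹ * Real.exp (-((1 + a) / 2) * s ^ 2) := by
    intro s
    rw [gaussianPDFReal, smul_eq_mul, mul_assoc, ← Real.exp_add]
    simp only [NNReal.coe_one, mul_one, sub_zero]
    ring_nf
  simp_rw [h1]
  rw [integral_const_mul, integral_gaussian, ← Real.sqrt_inv, ← Real.sqrt_mul (by positivity),
    ← Real.sqrt_inv]
  congr 1
  field_simp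

/-- The standard Gaussian measure on `ℝ⁴`. -/
noncomputable def gaussianFour : Measure (Fin 4 → ℝ) := Measure.pi fun _ => gaussianReal 0 1

instance : IsProbabilityMeasure gaussianFour := by unfold gaussianFour; infer_instance

lemma integral_exp_gaussianFour (x : Fin 4 → ℝ) :
    ∫ s, Complex.exp (Complex.I * (∑ q, s q * x q : ℝ)) ∂gaussianFour
      = (Real.exp (-(∑ q, x q ^ 2) / 2) : ℝ) := by
  have h1 : ∀ s : Fin 4 → ℝ, Complex.exp (Complex.I * (∑ q, s q * x q : ℝ))
      = ∏ q, Complex.exp (Complex.I * (s q * x q : ℝ)) := by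
    intro s
    rw [← Complex.exp_sum, Complex.ofReal_sum, Finset.mul_sum]
  simp_rw [h1]
  rw [gaussianFour, integral_fintype_prod_eq_prod fun q (t : ℝ) =>
    Complex.exp (Complex.I * (t * x q : ℝ))]
  simp_rw [integral_exp_gaussianReal]
  rw [← Complex.ofReal_prod, ← Real.exp_sum, ← Finset.sum_div, Finset.sum_neg_distrib]

lemma integral_exp_neg_sq_gaussianFour {a : Fin 4 → ℝ} (ha : ∀ q, 0 ≤ a q) :
    ∫ s, ((Real.exp (-(∑ q, a q * s q ^ 2) / 2) : ℝ) : ℂ) ∂gaussianFour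
      = ((∏ q, (√(1 + a q))⁻¹ : ℝ) : ℂ) := by
  have h1 : ∀ s : Fin 4 → ℝ, Real.exp (-(∑ q, a q * s q ^ 2) / 2)
      = ∏ q, Real.exp (-a q * s q ^ 2 / 2) := by
    intro s
    rw [← Real.exp_sum, ← Finset.sum_neg_distrib, Finset.sum_div]
    simp only [neg_mul]
  rw [integral_complex_ofReal]
  simp_rw [h1]
  rw [gaussianFour, integral_fintype_prod_eq_prod fun q (t : ℝ) => Real.exp (-a q * t ^ 2 / 2)]
  simp_rw [fun q => integral_exp_neg_sq_gaussianReal (ha q)]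

end GaussianMixture

/-! ### From characteristic functions to Laplace transforms. -/

section LaplaceTransform

variable {Ω : Type*} [mΩ : MeasurableSpace Ω]

lemma measurable_normDFT {P : Measure Ω} {X : ℤ → Ω → ℝ} (hX : ∀ k, Measurable (X k)) (n j : ℕ) :
    Measurable (normDFT P X n j) := by
  unfold normDFT fourierSum
  fun_prop

lemma measurable_dftCoord {P : Measure Ω} {X : ℤ → Ω → ℝ} (hX : ∀ k, Measurable (X k))
    (p : ℕ × ℕ × ℕ) (q : Fin 4) : Measurable fun ω => dftCoord P X p ω q := by
  have h1 := measurable_normDFT (P := P) hX p.1 p.2.1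
  have h2 := measurable_normDFT (P := P) hX p.1 p.2.2
  fin_cases q
  · exact Complex.measurable_re.comp h1
  · exact Complex.measurable_im.comp h1
  · exact Complex.measurable_re.comp h2
  · exact Complex.measurable_im.comp h2

variable {P : Measure Ω} [IsProbabilityMeasure P] {ε : ℤ → Ω → ℝ} {G : (ℕ → ℝ) → ℝ}

/-- As `e^{-|x|²/2}` is the Gaussian average of `e^{i s·x}`, Fubini writes the left side as a
Gaussian average of characteristic functions. Dominated convergence then suffices, without tightness
or a continuity theorem. -/
lemma tendsto_integral_exp_of_tendsto_charFun {V : ℕ × ℕ × ℕ → Ω → Fin 4 → ℝ}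
    (hV : ∀ p q, Measurable fun ω => V p ω q)
    (hchar : ∀ s : Fin 4 → ℝ, Tendsto (fun p => ∫ ω, Complex.exp (Complex.I *
      (∑ q, s q * V p ω q : ℝ)) ∂P) pairFilter (𝓝 (Real.exp (-(∑ q, s q ^ 2 / 2) / 2) : ℝ)))
    (t : Fin 4 → ℝ) :
    Tendsto (fun p => ∫ ω, Real.exp (-(∑ q, (t q * V p ω q) ^ 2) / 2) ∂P) pairFilter
      (𝓝 (∏ q, (√(1 + t q ^ 2 / 2))⁻¹)) := by
  have hnorm : ∀ x : ℝ, ‖Complex.exp (Complex.I * x)‖ ≤ 1 := fun x => by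
    rw [mul_comm, Complex.norm_exp_ofReal_mul_I]
  have hlim : Tendsto (fun p => ∫ s, (∫ ω, Complex.exp (Complex.I *
      (∑ q, (s q * t q) * V p ω q : ℝ)) ∂P) ∂gaussianFour) pairFilter
      (𝓝 (∫ s, ((Real.exp (-(∑ q, (s q * t q) ^ 2 / 2) / 2) : ℝ) : ℂ) ∂gaussianFour)) := by
    refine tendsto_integral_filter_of_dominated_convergence (fun _ => 1)
      (Eventually.of_forall fun p => ?_) (Eventually.of_forall fun p => ae_of_all _ fun s => ?_)
      (integrable_const _) (ae_of_all _ fun s => hchar fun q => s q * t q)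
    · refine (StronglyMeasurable.integral_prod_right' (ν := P)
        (f := fun z : (Fin 4 → ℝ) × Ω => Complex.exp (Complex.I *
          (∑ q, (z.1 q * t q) * V p z.2 q : ℝ))) (Measurable.stronglyMeasurable ?_)
        ).aestronglyMeasurable
      have hVs : ∀ q, Measurable fun z : (Fin 4 → ℝ) × Ω => V p z.2 q := fun q =>
        (hV p q).comp measurable_snd
      fun_prop
    · exact (norm_integral_le_of_norm_le_const (ae_of_all _ fun ω => hnorm _)).trans (by simp)
  have hswap : ∀ p, ∫ s, (∫ ω, Complex.exp (Complex.I *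
      (∑ q, (s q * t q) * V p ω q : ℝ)) ∂P) ∂gaussianFour
      = ((∫ ω, Real.exp (-(∑ q, (t q * V p ω q) ^ 2) / 2) ∂P : ℝ) : ℂ) := by
    intro p
    rw [integral_integral_swap]
    · rw [← integral_complex_ofReal]
      refine integral_congr_ae (ae_of_all _ fun ω => ?_)
      simp only [mul_assoc]
      exact integral_exp_gaussianFour fun q => t q * V p ω q
    · refine Integrable.of_bound (Measurable.aestronglyMeasurable ?_) 1
        (ae_of_all _ fun z => hnorm _)
      have hVs : ∀ q, Measurable fun z : (Fin 4 → ℝ) × Ω => V p z.2 q := fun q =>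
        (hV p q).comp measurable_snd
      fun_prop
  have hval : ∫ s, ((Real.exp (-(∑ q, (s q * t q) ^ 2 / 2) / 2) : ℝ) : ℂ) ∂gaussianFour
      = ((∏ q, (√(1 + t q ^ 2 / 2))⁻¹ : ℝ) : ℂ) := by
    rw [← integral_exp_neg_sq_gaussianFour (a := fun q => t q ^ 2 / 2) fun q => by positivity]
    refine integral_congr_ae (ae_of_all _ fun s => ?_)
    simp only [mul_pow]
    congr 5
    exact funext fun q => by ring
  simp_rw [hswap] at hlim
  rw [hval] at hlim
  simpa only [Function.comp_def, Complex.ofReal_re] using (Complex.continuous_re.tendsto _).comp hlim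

/-- Convergence of the joint Laplace transforms of two normalized periodogram ordinates to the
Laplace transforms of independent standard exponential variables. -/
theorem IsIID.tendsto_laplace (h : IsIID P ε) (hG : Measurable G)
    (hG2 : ∀ k, MemLp (fun ω => G (past ε k ω)) 2 P) (hG0 : ∫ ω, G (past ε 0 ω) ∂P = 0)
    (hsum : Summable (projNorm P ε G)) {fmin : ℝ} (hfmin : 0 < fmin)
    (hf : ∀ θ, fmin ≤ spectralDensity P (fun n ω => G (past ε n ω)) θ) {a b : ℝ} (ha : 0 ≤ a)
    (hb : 0 ≤ b) :
    Tendsto (fun p : ℕ × ℕ × ℕ => ∫ ω, Real.exp (-(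
        a * normPeriodogram P (fun n ω => G (past ε n ω)) p.1 (fourierFreq p.1 p.2.1) ω
        + b * normPeriodogram P (fun n ω => G (past ε n ω)) p.1 (fourierFreq p.1 p.2.2) ω)) ∂P)
      pairFilter (𝓝 ((1 + a)⁻¹ * (1 + b)⁻¹)) := by
  have key := tendsto_integral_exp_of_tendsto_charFun (P := P)
    (V := dftCoord P fun n ω => G (past ε n ω))
    (measurable_dftCoord fun k => hG.comp (measurable_past h.meas k))
    -- The weights turn the half sum of squares into `a|Z_j|² + b|Z_l|²`, with `Z` the normalized
    -- transforms. Each frequency gives two factors `(1+a)^{-1/2}`, hence one exponential-law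
    -- transform.
    (h.tendsto_charFun_dftCoord hG hG2 hG0 hsum hfmin hf) ![√(2 * a), √(2 * a), √(2 * b), √(2 * b)]
  have hval : ∏ q : Fin 4, (√(1 + (![√(2 * a), √(2 * a), √(2 * b), √(2 * b)] q) ^ 2 / 2))⁻¹
      = (1 + a)⁻¹ * (1 + b)⁻¹ := by
    simp only [Fin.prod_univ_four, Matrix.cons_val]
    rw [Real.sq_sqrt (by positivity), Real.sq_sqrt (by positivity),
      mul_div_cancel_left₀ a two_ne_zero, mul_div_cancel_left₀ b two_ne_zero, mul_assoc, ← mul_inv,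
      ← mul_inv, Real.mul_self_sqrt (by positivity), Real.mul_self_sqrt (by positivity)]
  rw [hval] at key
  refine key.congr fun p => integral_congr_ae (ae_of_all _ fun ω => ?_)
  simp only [Fin.sum_univ_four, dftCoord, Matrix.cons_val, mul_pow]
  rw [Real.sq_sqrt (by positivity), Real.sq_sqrt (by positivity),
    ← norm_normDFT_sq (hfmin.le.trans (hf _)), ← norm_normDFT_sq (hfmin.le.trans (hf _)),
    ← Complex.normSq_eq_norm_sq, ← Complex.normSq_eq_norm_sq, Complex.normSq_apply,
    Complex.normSq_apply]
  congr 1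
  ring

end LaplaceTransform

/-! ### A weak law of large numbers. -/

section EmpiricalLaplace

variable {Ω : Type*} [mΩ : MeasurableSpace Ω] {P : Measure Ω} [IsProbabilityMeasure P]

/-- A law of large numbers in `L²` for averages of asymptotically uncorrelated variables. -/
lemma tendsto_integral_sq_average_sub {u : ℕ → ℕ → Ω → ℝ} (hu : ∀ n j, Measurable (u n j))
    (hu0 : ∀ n j ω, 0 ≤ u n j ω) (hu1 : ∀ n j ω, u n j ω ≤ 1) {μ : ℝ} (hμ0 : 0 ≤ μ) (hμ1 : μ ≤ 1)
    (hpair : Tendsto (fun p : ℕ × ℕ × ℕ => ∫ ω, u p.1 p.2.1 ω * u p.1 p.2.2 ω ∂P) pairFilter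
      (𝓝 (μ * μ)))
    (hone : Tendsto (fun p : ℕ × ℕ × ℕ => ∫ ω, u p.1 p.2.1 ω ∂P) pairFilter (𝓝 μ)) :
    Tendsto (fun n => ∫ ω, (1 / (numFreq n : ℝ) * ∑ j ∈ Finset.Icc 1 (numFreq n), u n j ω - μ) ^ 2
      ∂P) atTop (𝓝 0) := by
  have hmn : Tendsto numFreq atTop atTop := by
    refine tendsto_atTop.2 fun b => ?_
    filter_upwards [eventually_ge_atTop (2 * b + 1)] with n hn
    simp only [numFreq]
    omega
  rw [Metric.tendsto_nhds]
  intro η hη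
  have e1 := Metric.tendsto_nhds.1 hpair (η / 6) (by positivity)
  have e2 := Metric.tendsto_nhds.1 hone (η / 6) (by positivity)
  obtain ⟨N, hN⟩ := eventually_pairFilter.1 (e1.and e2)
  have e3 : Tendsto (fun n => (1 : ℝ) / numFreq n) atTop (𝓝 0) :=
    tendsto_one_div_atTop_nhds_zero_nat.comp hmn
  filter_upwards [eventually_ge_atTop N, hmn.eventually_ge_atTop 2,
    e3.eventually (gt_mem_nhds (show (0 : ℝ) < η / 3 by positivity))] with n hnN hm hmη
  set m := numFreq n with hmdef
  have hm0 : (0 : ℝ) < m := Nat.cast_pos.2 (by omega)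
  set J := Finset.Icc 1 m with hJ
  have hJc : J.card = m := by simp [hJ]
  have hint : ∀ j, Integrable (u n j) P := fun j =>
    Integrable.of_bound (hu n j).aestronglyMeasurable 1 (ae_of_all _ fun ω => by
      rw [Real.norm_of_nonneg (hu0 n j ω)]; exact hu1 n j ω)
  have hb : ∀ j ω, |u n j ω - μ| ≤ 1 := fun j ω => by
    have := hu0 n j ω
    have := hu1 n j ω
    rw [abs_le]; constructor <;> linarith
  have hintc : ∀ j, Integrable (fun ω => u n j ω - μ) P := fun j =>
    (hint j).sub (integrable_const _)
  have hprod : ∀ j l, Integrable (fun ω => (u n j ω - μ) * (u n l ω - μ)) P := fun j l =>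
    (hintc j).mul_bdd (c := 1) (hintc l).1 (ae_of_all _ fun ω => hb l ω)
  -- The filter speaks of pairs, so a single index is completed by any other one; this needs `m ≥
  -- 2`.
  have hmean : ∀ j ∈ J, |∫ ω, u n j ω ∂P - μ| < η / 6 := by
    intro j hj
    rw [hJ, Finset.mem_Icc] at hj
    by_cases hj1 : j = 1
    · exact (hN n hnN j 2 hj.1 hj.2 (by norm_num) hm (by omega)).2
    · exact (hN n hnN j 1 hj.1 hj.2 le_rfl (by omega) hj1).2
  -- Off the diagonal, one product and two mean errors give `3 · η/6`. The diagonal is bounded by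
  -- `1`, which costs `1/m` after averaging.
  have hcov : ∀ j ∈ J, ∀ l ∈ J, ∫ ω, (u n j ω - μ) * (u n l ω - μ) ∂P
      ≤ η / 2 + if l = j then 1 else 0 := by
    intro j hj l hl
    split_ifs with hjl
    · have := (le_abs_self _).trans (norm_integral_le_of_norm_le_const (μ := P)
        (f := fun ω => (u n j ω - μ) * (u n l ω - μ)) (C := 1) (ae_of_all _ fun ω => by
          rw [norm_mul]; exact mul_le_one₀ (hb j ω) (norm_nonneg _) (hb l ω)))
      simp only [probReal_univ, mul_one] at this
      linarith
    · have hexp : ∫ ω, (u n j ω - μ) * (u n l ω - μ) ∂P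
          = (∫ ω, u n j ω * u n l ω ∂P - μ * μ) - μ * (∫ ω, u n j ω ∂P - μ)
            - μ * (∫ ω, u n l ω ∂P - μ) := by
        have hjlint : Integrable (fun ω => u n j ω * u n l ω) P :=
          (hint j).mul_bdd (c := 1) (hint l).1 (ae_of_all _ fun ω => by
            rw [Real.norm_of_nonneg (hu0 n l ω)]; exact hu1 n l ω)
        have i1 := (hint j).const_mul μ
        have i2 := (hint l).const_mul μ
        have : ∀ ω, (u n j ω - μ) * (u n l ω - μ)
          = u n j ω * u n l ω - μ * u n j ω - μ * u n l ω + μ * μ := fun ω => by ring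
        simp_rw [this]
        have i3 : Integrable (fun ω => u n j ω * u n l ω - μ * u n j ω) P := hjlint.sub i1
        have i4 : Integrable (fun ω => u n j ω * u n l ω - μ * u n j ω - μ * u n l ω) P := i3.sub i2
        rw [integral_add i4 (integrable_const _), integral_sub i3 i2, integral_sub hjlint i1, integral_const_mul,
          integral_const_mul]
        simp
        ring
      have hj' := Finset.mem_Icc.1 hj
      have hl' := Finset.mem_Icc.1 hl
      have h1 := (hN n hnN j l hj'.1 hj'.2 hl'.1 hl'.2 (Ne.symm hjl)).1
      rw [Real.dist_eq] at h1
      have h2 : |μ * (∫ ω, u n j ω ∂P - μ)| ≤ η / 6 := by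
        rw [abs_mul, abs_of_nonneg hμ0]
        exact (mul_le_of_le_one_left (abs_nonneg _) hμ1).trans (hmean j hj).le
      have h3 : |μ * (∫ ω, u n l ω ∂P - μ)| ≤ η / 6 := by
        rw [abs_mul, abs_of_nonneg hμ0]
        exact (mul_le_of_le_one_left (abs_nonneg _) hμ1).trans (hmean l hl).le
      rw [hexp]
      have := (abs_lt.1 h1).2
      have := (abs_le.1 h2).1
      have := (abs_le.1 h3).1
      linarith
  have hexpand : ∀ ω, (1 / (m : ℝ) * ∑ j ∈ J, u n j ω - μ) ^ 2
      = (1 / (m : ℝ)) ^ 2 * ∑ j ∈ J, ∑ l ∈ J, (u n j ω - μ) * (u n l ω - μ) := by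
    intro ω
    rw [← Finset.sum_mul_sum, Finset.sum_sub_distrib, Finset.sum_const, hJc, nsmul_eq_mul]
    field_simp
  rw [Real.dist_eq, sub_zero, abs_of_nonneg (integral_nonneg fun ω => sq_nonneg _)]
  simp_rw [hexpand]
  rw [integral_const_mul, integral_finsetSum _ fun j _ => integrable_finsetSum _ fun l _ =>
    hprod j l]
  simp_rw [fun j => integral_finsetSum J fun l (_ : l ∈ J) => hprod j l]
  have hbound : ∑ j ∈ J, ∑ l ∈ J, ∫ ω, (u n j ω - μ) * (u n l ω - μ) ∂P
      ≤ m * (m * (η / 2) + 1) := by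
    refine (Finset.sum_le_sum fun j hj => Finset.sum_le_sum fun l hl => hcov j hj l hl).trans ?_
    refine (Finset.sum_le_card_nsmul _ _ (m * (η / 2) + 1) fun j hj => ?_).trans_eq ?_
    · rw [Finset.sum_add_distrib, Finset.sum_const, hJc, nsmul_eq_mul, Finset.sum_ite_eq',
        if_pos hj]
    · rw [hJc, nsmul_eq_mul]
  refine (mul_le_mul_of_nonneg_left hbound (by positivity)).trans_lt ?_
  have : (1 / (m : ℝ)) ^ 2 * (m * (m * (η / 2) + 1)) = η / 2 + 1 / m := by
    field_simp
  rw [this]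
  linarith

end EmpiricalLaplace

/-! ### From moments to uniform convergence of empirical tails. -/

section MomentProblem

variable {α : Type*} {l : Filter α} {m : α → ℕ} {U : α → ℕ → ℝ}

/-- The average of `φ` over the points `U a 1, …, U a (m a)`. -/
noncomputable def pointAverage (m : α → ℕ) (U : α → ℕ → ℝ) (φ : ℝ → ℝ) (a : α) : ℝ :=
  1 / (m a : ℝ) * ∑ j ∈ Finset.Icc 1 (m a), φ (U a j)

lemma pointAverage_mono {φ ψ : ℝ → ℝ} {a : α} (h : ∀ j, φ (U a j) ≤ ψ (U a j)) :
    pointAverage m U φ a ≤ pointAverage m U ψ a :=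
  mul_le_mul_of_nonneg_left (Finset.sum_le_sum fun j _ => h j) (by positivity)

lemma abs_pointAverage_sub_le {φ ψ : ℝ → ℝ} {a : α} {δ : ℝ} (hδ : 0 ≤ δ)
    (h : ∀ j, |φ (U a j) - ψ (U a j)| ≤ δ) :
    |pointAverage m U φ a - pointAverage m U ψ a| ≤ δ := by
  rw [pointAverage, pointAverage, ← mul_sub, ← Finset.sum_sub_distrib, abs_mul,
    abs_of_nonneg (by positivity : (0 : ℝ) ≤ 1 / (m a : ℝ))]
  have h1 : |∑ j ∈ Finset.Icc 1 (m a), (φ (U a j) - ψ (U a j))| ≤ m a * δ := by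
    refine (Finset.abs_sum_le_sum_abs _ _).trans
      ((Finset.sum_le_card_nsmul _ _ δ fun j _ => h j).trans_eq ?_)
    simp
  refine (mul_le_mul_of_nonneg_left h1 (by positivity)).trans ?_
  -- With no points, `1 / 0 = 0` makes both averages vanish.
  rcases Nat.eq_zero_or_pos (m a) with h0 | h0
  · simp [h0, hδ]
  · have : (m a : ℝ) ≠ 0 := Nat.cast_ne_zero.2 h0.ne'
    rw [← mul_assoc, one_div_mul_cancel this, one_mul]

lemma pointAverage_polynomial (p : Polynomial ℝ) (a : α) :
    pointAverage m U (fun x => p.eval x) a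
      = ∑ k ∈ Finset.range (p.natDegree + 1), p.coeff k * pointAverage m U (fun x => x ^ k) a := by
  simp only [pointAverage, Polynomial.eval_eq_sum_range]
  rw [Finset.sum_comm, Finset.mul_sum]
  refine Finset.sum_congr rfl fun k _ => ?_
  rw [← Finset.mul_sum]
  ring

lemma integral_polynomial (p : Polynomial ℝ) :
    ∫ x in (0 : ℝ)..1, p.eval x
      = ∑ k ∈ Finset.range (p.natDegree + 1), p.coeff k * (1 / ((k : ℝ) + 1)) := by
  simp only [Polynomial.eval_eq_sum_range]
  rw [intervalIntegral.integral_finsetSum fun k _ =>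
    (Continuous.intervalIntegrable (by fun_prop) _ _)]
  refine Finset.sum_congr rfl fun k _ => ?_
  rw [intervalIntegral.integral_const_mul, integral_pow]
  simp

/-- Convergence of the moments to those of the uniform law implies convergence of the averages of
continuous functions. -/
lemma tendsto_pointAverage (hU : ∀ a j, U a j ∈ Set.Icc (0 : ℝ) 1)
    (hmom : ∀ k : ℕ, Tendsto (pointAverage m U fun x => x ^ k) l (𝓝 (1 / ((k : ℝ) + 1))))
    {φ : ℝ → ℝ} (hφ : Continuous φ) :
    Tendsto (pointAverage m U φ) l (𝓝 (∫ x in (0 : ℝ)..1, φ x)) := by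
  rw [Metric.tendsto_nhds]
  intro η hη
  obtain ⟨p, hp⟩ := exists_polynomial_near_of_continuousOn 0 1 φ hφ.continuousOn (η / 3)
    (by positivity)
  have hlim : Tendsto (pointAverage m U fun x => p.eval x) l (𝓝 (∫ x in (0 : ℝ)..1, p.eval x)) := by
    rw [integral_polynomial, show (pointAverage m U fun x => p.eval x) = fun a =>
      ∑ k ∈ Finset.range (p.natDegree + 1), p.coeff k * pointAverage m U (fun x => x ^ k) a from
      funext (pointAverage_polynomial p)]
    exact tendsto_finsetSum _ fun k _ => (hmom k).const_mul _
  have hint : |(∫ x in (0 : ℝ)..1, p.eval x) - ∫ x in (0 : ℝ)..1, φ x| ≤ η / 3 := by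
    rw [← intervalIntegral.integral_sub (p.continuous.intervalIntegrable _ _)
      (hφ.intervalIntegrable _ _)]
    have := intervalIntegral.norm_integral_le_of_norm_le_const (a := (0 : ℝ)) (b := 1)
      (f := fun x => p.eval x - φ x) (C := η / 3) fun x hx => by
        rw [Set.uIoc_of_le zero_le_one] at hx
        exact (hp x ⟨hx.1.le, hx.2⟩).le
    simpa using this
  filter_upwards [Metric.tendsto_nhds.1 hlim (η / 3) (by positivity)] with a ha
  rw [Real.dist_eq] at ha ⊢
  have h1 := abs_pointAverage_sub_le (m := m) (φ := φ) (ψ := fun x => p.eval x) (a := a)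
    (by positivity : (0 : ℝ) ≤ η / 3) fun j => by
      rw [abs_sub_comm]; exact (hp _ (hU a j)).le
  rw [abs_lt] at ha ⊢
  rw [abs_le] at h1 hint
  constructor <;> linarith [h1.1, h1.2, hint.1, hint.2, ha.1, ha.2]

/-- The continuous ramp increasing from `0` at `(q-1)/Q` to `1` at `q/Q`. -/
noncomputable def ramp (Q q : ℕ) (v : ℝ) : ℝ := max 0 (min 1 (Q * v - q + 1))

lemma continuous_ramp (Q q : ℕ) : Continuous (ramp Q q) := by
  unfold ramp; fun_prop

lemma ramp_nonneg (Q q : ℕ) (v : ℝ) : 0 ≤ ramp Q q v := le_max_left _ _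

lemma ramp_le_one (Q q : ℕ) (v : ℝ) : ramp Q q v ≤ 1 := max_le zero_le_one (min_le_left _ _)

lemma ramp_eq_one {Q q : ℕ} {v : ℝ} (h : (q : ℝ) ≤ Q * v) : ramp Q q v = 1 := by
  rw [ramp, min_eq_left (by linarith), max_eq_right zero_le_one]

lemma ramp_eq_zero {Q q : ℕ} {v : ℝ} (h : (Q : ℝ) * v ≤ q - 1) : ramp Q q v = 0 :=
  max_eq_left ((min_le_right _ _).trans (by linarith))

lemma integral_ramp_le {Q q : ℕ} (hQ : 0 < Q) (hq : q ≤ Q) :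
    ∫ v in (0 : ℝ)..1, ramp Q q v ≤ 1 - ((q : ℝ) - 1) / Q := by
  have hQ' : (0 : ℝ) < Q := Nat.cast_pos.2 hQ
  have hq' : (q : ℝ) ≤ Q := Nat.cast_le.2 hq
  have hint : ∀ a b, IntervalIntegrable (ramp Q q) volume a b :=
    fun a b => (continuous_ramp Q q).intervalIntegrable a b
  set a : ℝ := max 0 (((q : ℝ) - 1) / Q) with ha
  have ha0 : 0 ≤ a := le_max_left _ _
  have ha1 : a ≤ 1 := max_le zero_le_one ((div_le_one hQ').2 (by linarith))
  rw [← intervalIntegral.integral_add_adjacent_intervals (hint 0 a) (hint a 1)]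
  have h1 : ∫ v in (0 : ℝ)..a, ramp Q q v ≤ 0 := by
    rcases le_total (((q : ℝ) - 1) / Q) 0 with h | h
    · rw [ha, max_eq_left h]; simp
    · refine (intervalIntegral.integral_mono_on ha0 (hint 0 a) (g := fun _ => 0) (by simp)
        fun v hv => ?_).trans (by simp)
      refine (ramp_eq_zero ?_).le
      have := hv.2
      rw [ha, max_eq_right h, le_div_iff₀ hQ'] at this
      linarith
  have h2 : ∫ v in a..1, ramp Q q v ≤ 1 - a :=
    (intervalIntegral.integral_mono_on ha1 (hint a 1) (g := fun _ => 1) (by simp)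
      fun v _ => ramp_le_one Q q v).trans (by simp)
  have h3 : ((q : ℝ) - 1) / Q ≤ a := le_max_right _ _
  linarith

lemma le_integral_ramp {Q q : ℕ} (hQ : 0 < Q) :
    1 - (q : ℝ) / Q ≤ ∫ v in (0 : ℝ)..1, ramp Q q v := by
  have hQ' : (0 : ℝ) < Q := Nat.cast_pos.2 hQ
  have hint : ∀ a b, IntervalIntegrable (ramp Q q) volume a b :=
    fun a b => (continuous_ramp Q q).intervalIntegrable a b
  rcases le_total ((q : ℝ) / Q) 1 with h | h
  · have h0 : (0 : ℝ) ≤ q / Q := by positivity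
    rw [← intervalIntegral.integral_add_adjacent_intervals (hint 0 (q / Q)) (hint (q / Q) 1)]
    have h1 : 0 ≤ ∫ v in (0 : ℝ)..(q / Q), ramp Q q v :=
      intervalIntegral.integral_nonneg h0 fun v _ => ramp_nonneg Q q v
    have h2 : 1 - (q : ℝ) / Q ≤ ∫ v in (q / Q : ℝ)..1, ramp Q q v := by
      refine le_trans (by simp) (intervalIntegral.integral_mono_on h (f := fun _ => (1 : ℝ))
        (by simp) (hint _ 1) fun v hv => ?_)
      refine (ramp_eq_one ?_).ge
      have := hv.1
      rw [div_le_iff₀ hQ'] at this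
      linarith
    linarith
  · have : 0 ≤ ∫ v in (0 : ℝ)..1, ramp Q q v :=
      intervalIntegral.integral_nonneg zero_le_one fun v _ => ramp_nonneg Q q v
    linarith

/-- Convergence of the moments to those of the uniform law implies uniform convergence of the
empirical tail functions. -/
lemma eventually_abs_tail_sub_le (hU : ∀ a j, U a j ∈ Set.Icc (0 : ℝ) 1)
    (hmom : ∀ k : ℕ, Tendsto (pointAverage m U fun x => x ^ k) l (𝓝 (1 / ((k : ℝ) + 1))))
    {η : ℝ} (hη : 0 < η) :
    ∀ᶠ a in l, ∀ u ∈ Set.Icc (0 : ℝ) 1,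
      |pointAverage m U ((Set.Ici u).indicator fun _ => 1) a - (1 - u)| ≤ η := by
  obtain ⟨Q, hQη⟩ := exists_nat_gt (3 / η)
  have hQ' : (0 : ℝ) < Q := (by positivity : 0 < 3 / η).trans hQη
  have hQ : 0 < Q := Nat.cast_pos.1 hQ'
  have hQ3 : 3 / (Q : ℝ) ≤ η := by
    rw [div_lt_iff₀ hη] at hQη
    rw [div_le_iff₀ hQ']
    linarith
  -- Finitely many ramps serve all `u`: with `q = ⌊uQ⌋`, ramps `q` and `q + 2` enclose the
  -- indicator, and `q + 2` may reach `Q + 2`. Two grid cells and one convergence error give `3/Q ≤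
  -- η`.
  have hev : ∀ᶠ a in l, ∀ q ∈ Finset.range (Q + 3),
      dist (pointAverage m U (ramp Q q) a) (∫ v in (0 : ℝ)..1, ramp Q q v) < 1 / Q :=
    (Filter.eventually_all_finset _).2 fun q _ =>
      Metric.tendsto_nhds.1 (tendsto_pointAverage hU hmom (continuous_ramp Q q)) _ (by positivity)
  filter_upwards [hev] with a ha u hu
  set q := ⌊u * Q⌋₊ with hq
  have hq1 : (q : ℝ) ≤ u * Q := Nat.floor_le (mul_nonneg hu.1 hQ'.le)
  have hq2 : u * Q < q + 1 := Nat.lt_floor_add_one _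
  have hqQ : q ≤ Q := by
    have : (q : ℝ) ≤ Q := hq1.trans (mul_le_of_le_one_left hQ'.le hu.2)
    exact_mod_cast this
  have hu2 : u ≤ ((q : ℝ) + 1) / Q := by rw [le_div_iff₀ hQ']; exact hq2.le
  have hu1 : (q : ℝ) / Q ≤ u := by rw [div_le_iff₀ hQ']; exact hq1
  have up1 : pointAverage m U ((Set.Ici u).indicator fun _ => 1) a
      ≤ pointAverage m U (ramp Q q) a := pointAverage_mono fun j => by
    by_cases h : U a j ∈ Set.Ici u
    · have h' : u ≤ U a j := h
      rw [Set.indicator_of_mem h, ramp_eq_one]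
      rw [mul_comm] at hq1
      exact hq1.trans (mul_le_mul_of_nonneg_left h' hQ'.le)
    · rw [Set.indicator_of_notMem h]; exact ramp_nonneg _ _ _
  have lo1 : pointAverage m U (ramp Q (q + 2)) a
      ≤ pointAverage m U ((Set.Ici u).indicator fun _ => 1) a := pointAverage_mono fun j => by
    by_cases h : U a j ∈ Set.Ici u
    · rw [Set.indicator_of_mem h]; exact ramp_le_one _ _ _
    · have h' : U a j < u := not_le.1 h
      rw [Set.indicator_of_notMem h, ramp_eq_zero]
      push_cast
      have := mul_le_mul_of_nonneg_left h'.le hQ'.le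
      linarith
  have up2 := ha q (Finset.mem_range.2 (by omega))
  have lo2 := ha (q + 2) (Finset.mem_range.2 (by omega))
  rw [Real.dist_eq, abs_lt] at up2 lo2
  have up3 := integral_ramp_le hQ hqQ
  have lo3 := le_integral_ramp (q := q + 2) hQ
  push_cast at lo3
  have s1 : ((q : ℝ) + 2) / Q = q / Q + 2 * (1 / Q) := by ring
  have s2 : ((q : ℝ) - 1) / Q = (q + 1) / Q - 2 * (1 / Q) := by ring
  have s3 : 3 / (Q : ℝ) = 3 * (1 / Q) := by ring
  rw [abs_le]
  constructor <;> linarith [up2.2, lo2.1]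

end MomentProblem

/-! ### Convergence in probability as convergence along a filter. -/

section ConvergenceInProbability

variable {Ω : Type*} [mΩ : MeasurableSpace Ω]

/-- The filter of the sets of pairs `(n, ω)` that contain `(n, ω)` with probability tending
to `1`. -/
def inProbability (P : Measure Ω) : Filter (ℕ × Ω) where
  sets := {A | Tendsto (fun n => P {ω | (n, ω) ∉ A}) atTop (𝓝 0)}
  univ_sets := by simp
  sets_of_superset {A B} hA hAB := tendsto_of_tendsto_of_tendsto_of_le_of_le tendsto_const_nhds hA
    (fun _ => zero_le) fun n => measure_mono fun _ hω h => hω (hAB h)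
  inter_sets {A B} hA hB := by
    have hA' : Tendsto (fun n => P {ω | (n, ω) ∉ A}) atTop (𝓝 0) := hA
    have h := hA'.add hB
    rw [add_zero] at h
    refine tendsto_of_tendsto_of_tendsto_of_le_of_le tendsto_const_nhds h (fun _ => zero_le)
      fun n => (measure_mono ?_).trans (measure_union_le _ _)
    intro ω hω
    simp only [Set.mem_inter_iff, Set.mem_ofPred_eq, not_and_or, Set.mem_union] at hω ⊢
    exact hω

lemma eventually_inProbability {P : Measure Ω} {q : ℕ × Ω → Prop} :
    (∀ᶠ x in inProbability P, q x) ↔ Tendsto (fun n => P {ω | ¬ q (n, ω)}) atTop (𝓝 0) :=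
  Iff.rfl

/-- Lets the deterministic moment argument be run on pairs `(n, ω)`, without subsequences and
without measurability of the supremum. -/
lemma tendstoInMeasure_iff_inProbability {P : Measure Ω} {f : ℕ → Ω → ℝ} {c : ℝ} :
    TendstoInMeasure P f atTop (fun _ => c)
      ↔ Tendsto (fun x : ℕ × Ω => f x.1 x.2) (inProbability P) (𝓝 c) := by
  rw [tendstoInMeasure_iff_dist, Metric.tendsto_nhds]
  simp only [eventually_inProbability, not_lt]

variable {P : Measure Ω} [IsProbabilityMeasure P]

lemma tendstoInMeasure_of_tendsto_integral_sq {f : ℕ → Ω → ℝ} {c : ℝ} (hf : ∀ n, MemLp (f n) 2 P)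
    (h : Tendsto (fun n => ∫ ω, (f n ω - c) ^ 2 ∂P) atTop (𝓝 0)) :
    TendstoInMeasure P f atTop fun _ => c := by
  refine tendstoInMeasure_of_tendsto_eLpNorm (p := 2) (by norm_num) (fun n => (hf n).1)
    aestronglyMeasurable_const ?_
  have hd : ∀ n, MemLp (fun ω => f n ω - c) 2 P := fun n => (hf n).sub (memLp_const c)
  have h1 : Tendsto (fun n => l2norm P fun ω => f n ω - c) atTop (𝓝 0) := by
    have := h.sqrt
    rw [Real.sqrt_zero] at this
    refine this.congr fun n => ?_
    rw [← l2norm_sq (hd n), Real.sqrt_sq (l2norm_nonneg _)]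
  have h2 := ENNReal.tendsto_ofReal h1
  rw [ENNReal.ofReal_zero] at h2
  exact h2.congr fun n => ofReal_l2norm (hd n)

/-- Convergence of the Laplace transforms of pairs of nonnegative variables to those of independent
standard exponential variables implies convergence of the moments of `e^{-I}` under the empirical
law. -/
lemma tendsto_pointAverage_exp_neg {I : ℕ → ℕ → Ω → ℝ} (hI : ∀ n j, Measurable (I n j))
    (hI0 : ∀ n j ω, 0 ≤ I n j ω)
    (hlap : ∀ a b : ℝ, 0 ≤ a → 0 ≤ b → Tendsto (fun p : ℕ × ℕ × ℕ =>
      ∫ ω, Real.exp (-(a * I p.1 p.2.1 ω + b * I p.1 p.2.2 ω)) ∂P) pairFilter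
      (𝓝 ((1 + a)⁻¹ * (1 + b)⁻¹))) (k : ℕ) :
    Tendsto (pointAverage (fun x : ℕ × Ω => numFreq x.1)
      (fun x j => Real.exp (-I x.1 j x.2)) fun x => x ^ k) (inProbability P)
      (𝓝 (1 / ((k : ℝ) + 1))) := by
  have hk : (0 : ℝ) ≤ k := Nat.cast_nonneg k
  set u : ℕ → ℕ → Ω → ℝ := fun n j ω => Real.exp (-I n j ω) ^ k with hu
  have hpow : ∀ n j ω, u n j ω = Real.exp (-(k * I n j ω)) := fun n j ω => by
    simp only [hu]
    rw [← Real.exp_nat_mul, mul_neg]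
  have hu0 : ∀ n j ω, 0 ≤ u n j ω := fun n j ω => pow_nonneg (Real.exp_pos _).le k
  have hu1 : ∀ n j ω, u n j ω ≤ 1 := fun n j ω =>
    pow_le_one₀ (Real.exp_pos _).le (Real.exp_le_one_iff.2 (neg_nonpos.2 (hI0 n j ω)))
  have hum : ∀ n j, Measurable (u n j) := fun n j =>
    (Real.measurable_exp.comp (hI n j).neg).pow_const k
  have hpair : Tendsto (fun p : ℕ × ℕ × ℕ => ∫ ω, u p.1 p.2.1 ω * u p.1 p.2.2 ω ∂P) pairFilter
      (𝓝 (1 / ((k : ℝ) + 1) * (1 / ((k : ℝ) + 1)))) := by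
    -- The `k`-th moment of `e^{-I}` is the Laplace transform at `k`, and `(1+k)⁻¹` is the `k`-th
    -- moment of the uniform law.
    have := hlap k k hk hk
    rw [← one_div, add_comm (1 : ℝ)] at this
    refine this.congr fun p => integral_congr_ae (ae_of_all _ fun ω => ?_)
    simp only [hpow]
    rw [← Real.exp_add, neg_add]
  have hone : Tendsto (fun p : ℕ × ℕ × ℕ => ∫ ω, u p.1 p.2.1 ω ∂P) pairFilter
      (𝓝 (1 / ((k : ℝ) + 1))) := by
    have := hlap k 0 hk le_rfl
    rw [add_zero, inv_one, mul_one, ← one_div, add_comm (1 : ℝ)] at this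
    refine this.congr fun p => integral_congr_ae (ae_of_all _ fun ω => ?_)
    simp only [hpow, zero_mul, add_zero]
  have hmem : ∀ n, MemLp (fun ω => 1 / (numFreq n : ℝ) *
      ∑ j ∈ Finset.Icc 1 (numFreq n), u n j ω) 2 P := fun n => by
    have hs : MemLp (fun ω => ∑ j ∈ Finset.Icc 1 (numFreq n), u n j ω) 2 P :=
      memLp_finsetSum _ fun j _ => MemLp.of_bound (hum n j).aestronglyMeasurable 1
        (ae_of_all _ fun ω => by rw [Real.norm_of_nonneg (hu0 n j ω)]; exact hu1 n j ω)
    exact hs.const_mul _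
  have hL2 := tendsto_integral_sq_average_sub hum hu0 hu1 (by positivity)
    (by rw [div_le_one (by positivity)]; linarith) hpair hone
  have := tendstoInMeasure_iff_inProbability.1 (tendstoInMeasure_of_tendsto_integral_sq hmem hL2)
  exact this

end ConvergenceInProbability

/-! ### The uniform law for the empirical distribution function. -/

section Main

variable {Ω : Type*} [mΩ : MeasurableSpace Ω] {P : Measure Ω} [IsProbabilityMeasure P]
  {ε : ℤ → Ω → ℝ} {G : (ℕ → ℝ) → ℝ}

theorem IsIID.tendstoInMeasure_supDistance (h : IsIID P ε) (hG : Measurable G)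
    (hG2 : ∀ k, MemLp (fun ω => G (past ε k ω)) 2 P) (hG0 : ∫ ω, G (past ε 0 ω) ∂P = 0)
    (hsum : Summable (projNorm P ε G)) {fmin : ℝ} (hfmin : 0 < fmin)
    (hf : ∀ θ, fmin ≤ spectralDensity P (fun n ω => G (past ε n ω)) θ) :
    TendstoInMeasure P (fun n => supDistance P (fun n ω => G (past ε n ω)) n) atTop fun _ => 0 := by
  set X : ℤ → Ω → ℝ := fun n ω => G (past ε n ω) with hX
  have hXm : ∀ k, Measurable (X k) := fun k => hG.comp (measurable_past h.meas k)
  set I : ℕ → ℕ → Ω → ℝ := fun n j => normPeriodogram P X n (fourierFreq n j) with hI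
  have hI0 : ∀ n j ω, 0 ≤ I n j ω := fun n j ω => by
    simp only [hI]
    rw [← norm_normDFT_sq (hfmin.le.trans (hf _))]
    positivity
  have hIm : ∀ n j, Measurable (I n j) := fun n j => by
    have : I n j = fun ω => ‖normDFT P X n j ω‖ ^ 2 :=
      funext fun ω => (norm_normDFT_sq (hfmin.le.trans (hf _)) ω).symm
    rw [this]
    exact (measurable_normDFT hXm n j).norm.pow_const 2
  let U : ℕ × Ω → ℕ → ℝ := fun x j => Real.exp (-I x.1 j x.2)
  let m : ℕ × Ω → ℕ := fun x => numFreq x.1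
  have hU : ∀ x j, U x j ∈ Set.Icc (0 : ℝ) 1 := fun x j =>
    ⟨(Real.exp_pos _).le, Real.exp_le_one_iff.2 (neg_nonpos.2 (hI0 _ _ _))⟩
  have hmom : ∀ k : ℕ, Tendsto (pointAverage m U fun x => x ^ k) (inProbability P)
      (𝓝 (1 / ((k : ℝ) + 1))) := 
    tendsto_pointAverage_exp_neg hIm hI0 fun a b ha hb =>
      h.tendsto_laplace hG hG2 hG0 hsum hfmin hf ha hb
  rw [tendstoInMeasure_iff_inProbability, Metric.tendsto_nhds]
  intro η hη
  filter_upwards [eventually_abs_tail_sub_le hU hmom (half_pos hη)] with x hx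
  have hle : supDistance P X x.1 x.2 ≤ η / 2 := by
    refine ciSup_le fun y => ?_
    have hy : (0 : ℝ) ≤ y := y.2
    -- At `u = e^{-y}` the event `I ≤ y` is `e^{-I} ≥ u`, and `1 - u` is the exponential
    -- distribution function at `y`.
    have := hx (Real.exp (-y)) ⟨(Real.exp_pos _).le, Real.exp_le_one_iff.2 (neg_nonpos.2 hy)⟩
    have heq : empiricalCDF P X x.1 x.2 y
        = pointAverage m U ((Set.Ici (Real.exp (-y))).indicator fun _ => 1) x := ?_
    · rw [heq]
      exact this
    rw [empiricalCDF, pointAverage]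
    congr 1
    refine Finset.sum_congr rfl fun j _ => ?_
    simp only [Set.indicator, Set.mem_Iic, Set.mem_Ici, U, Real.exp_le_exp, neg_le_neg_iff]
    rfl
  have h0 : 0 ≤ supDistance P X x.1 x.2 := Real.iSup_nonneg fun y => abs_nonneg _
  rw [Real.dist_eq, sub_zero, abs_of_nonneg h0]
  linarith

end Main

end CausalSpectral

theorem corollary2p2 {Ω : Type*} [MeasurableSpace Ω] (P : Measure Ω) [IsProbabilityMeasure P]
    (ε : ℤ → Ω → ℝ) (hε_meas : ∀ j, Measurable (ε j)) (hε_indep : iIndepFun ε P)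
    (hε_ident : ∀ j, IdentDistrib (ε j) (ε 0) P P)
    (G : (ℕ → ℝ) → ℝ) (hG : Measurable G)
    (X : ℤ → Ω → ℝ) (hX : X = CausalSpectral.causalProcess G ε)
    (hX_L2 : ∀ t, MemLp (X t) 2 P) (hX_mean : ∀ t, ∫ ω, X t ω ∂P = 0)
    (hκ : CausalSpectral.kappa P ε X < ⊤)
    (fmin : ℝ) (hfmin : IsLeast (Set.range (CausalSpectral.spectralDensity P X)) fmin)
    (hfmin_pos : 0 < fmin) :
    TendstoInMeasure P (fun n : ℕ => CausalSpectral.supDistance P X n) atTop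
      (fun _ => (0 : ℝ)) := by
  subst hX
  have h : CausalSpectral.IsIID P ε := ⟨hε_meas, hε_indep, hε_ident⟩
  exact h.tendstoInMeasure_supDistance hG hX_L2 (hX_mean 0) (h.summable_projNorm hG hX_L2 hκ)
    hfmin_pos fun θ => hfmin.2 ⟨θ, rfl⟩
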